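/- Let $p,q\in\mathbb{C}$ with $0<|p|,|q|<1$, and fix a square root $\sqrt{pq}$ (either choice). Put $(z;q)_\infty=\prod_{j\ge 0}(1-zq^j)$, $(z;p,q)_\infty=\prod_{j,k\ge 0}(1-zp^jq^k)$, and let $\Gamma(z;p,q)=(pqz^{-1};p,q)_\infty/(z;p,q)_\infty$ be the elliptic gamma function. Write $\Gamma(a_1,\dots,a_k;p,q)=\prod_i\Gamma(a_i;p,q)$; a sign $\pm1$ or $\pm2$ in an exponent means that the product over all choices of signs is taken, e.g. $\Gamma(z^{\pm2};p,q)=\Gamma(z^2;p,q)\Gamma(z^{-2};p,q)$ and $\Gamma(tw^{\pm1}z^{\pm1};p,q)=\Gamma(twz;p,q)\Gamma(twz^{-1};p,q)\Gamma(tw^{-1}z;p,q)\Gamma(tw^{-1}z^{-1};p,q)$. Let $\mathbb{T}$ be the positively oriented unit circle. The elliptic Fourier transform is $$M(t)_{wz}f(z):=\frac{(p;p)_\infty(q;q)_\infty}{4\pi \mathrm{i}}\int_{\mathbb{T}}\frac{\Gamma(tw^{\pm1}z^{\pm1};p,q)}{\Gamma(t^2,z^{\pm2};p,q)}\,f(z)\,\frac{dz}{z},$$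 and $D(s;y,w):=\Gamma(\sqrt{pq}\,s^{-1}y^{\pm1}w^{\pm1};p,q)$. Functions $\alpha(z,t),\beta(z,t)$ form an integral elliptic Bailey pair with respect to the parameter $t$ if $\alpha(z,t)$ is analytic in $z$ on $\mathbb{T}$ and $\beta(w,t)=M(t)_{wz}\alpha(z,t)$ for $w\in\mathbb{T}$, where the integral converges. Theorem. Let $s,t,y\in\mathbb{C}$, $y\neq0$, satisfy $|s|,|t|<1$ and $|\sqrt{pq}\,y^{\pm1}|<|st|$. If $\alpha(z,t)$ and $\beta(z,t)$ form an integral elliptic Bailey pair with respect to $t$, then the functions $$\alpha'(w,st)=D(s;y,w)\,\alpha(w,t),\qquad \beta'(w,st)=D(t^{-1};y,w)\,M(s)_{wx}\,D(st;y,x)\,\beta(x,t),\qquad w\in\mathbb{T},$$ form an integral elliptic Bailey pair with respect to the parameter $st$; the integral over $x\in\mathbb{T}$ defining $\beta'(w,st)$ converges for every $w\in\mathbb{T}$. -/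

import Mathlib

namespace EllBailey

noncomputable section

/-- The infinite `q`-shifted factorial `(z; q)_∞ = ∏_{j ≥ 0} (1 - z q^j)`. -/
def poch (z q : ℂ) : ℂ := ∏' j : ℕ, (1 - z * q ^ j)

/-- The double infinite product `(z; p, q)_∞ = ∏_{j, k ≥ 0} (1 - z p^j q^k)`. -/
def poch₂ (z p q : ℂ) : ℂ := ∏' jk : ℕ × ℕ, (1 - z * p ^ jk.1 * q ^ jk.2)

/-- The (standard) elliptic gamma function
`Γ(z; p, q) = (p q z⁻¹; p, q)_∞ / (z; p, q)_∞`, for `z ≠ 0`.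
At a pole the value is `0` by the convention for division. -/
def ellGamma (p q z : ℂ) : ℂ := poch₂ (p * q * z⁻¹) p q / poch₂ z p q

/-- The compact notation `Γ(a w^{±1} z^{±1}; p, q)`: the product over the four choices of signs. -/
def ellGammaPM (p q a w z : ℂ) : ℂ :=
  ellGamma p q (a * w * z) * ellGamma p q (a * w * z⁻¹) *
    ellGamma p q (a * w⁻¹ * z) * ellGamma p q (a * w⁻¹ * z⁻¹)

/-- The integrand of the elliptic Fourier transformation with respect to `dz`,
`Γ(t w^{±1} z^{±1}; p, q) / Γ(t², z^{±2}; p, q) · α(z) / z`. -/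
def eftIntegrand (p q t : ℂ) (α : ℂ → ℂ) (w z : ℂ) : ℂ :=
  ellGammaPM p q t w z /
      (ellGamma p q (t ^ 2) * (ellGamma p q (z ^ 2) * ellGamma p q ((z ^ 2)⁻¹))) *
    α z / z

/-- The elliptic Fourier transformation `(M(t) α)(w) = M(t)_{wz} α(z)`, an integral over the
positively oriented unit circle with the factor `(p;p)_∞ (q;q)_∞ / (4 π i)`. -/
def eft (p q t : ℂ) (α : ℂ → ℂ) (w : ℂ) : ℂ :=
  poch p p * poch q q / (4 * Real.pi * Complex.I) * ∮ z in C(0, 1), eftIntegrand p q t α w z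

/-- The integral defining `(M(t) α)(w)` exists. -/
def EftConverges (p q t : ℂ) (α : ℂ → ℂ) (w : ℂ) : Prop :=
  CircleIntegrable (eftIntegrand p q t α w) 0 1

/-- `α, β` form an integral elliptic Bailey pair with respect to `t`: `α` is analytic on the unit
circle and `β(w) = M(t)_{wz} α(z)` for `w` on the unit circle, the integral being convergent. -/
structure IsBaileyPair (p q t : ℂ) (α β : ℂ → ℂ) : Prop where
  analytic : AnalyticOnNhd ℂ α (Metric.sphere 0 1)
  converges : ∀ w ∈ Metric.sphere (0 : ℂ) 1, EftConverges p q t α w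
  eq_eft : ∀ w ∈ Metric.sphere (0 : ℂ) 1, β w = eft p q t α w

/-- `D(s; y, w) = Γ(√(pq) s⁻¹ y^{±1} w^{±1}; p, q)`, where `r` is the chosen square root
`√(pq)`. -/
def baileyD (p q r s y w : ℂ) : ℂ := ellGammaPM p q (r * s⁻¹) y w

end

end EllBailey

/-! The theorem is Fubini plus one evaluated integral. Insert β = M(t)α into β′(w) and interchange
the x- and z-integrations; all kernels are continuous on the torus. With c = √(pq)/(st), the inner
x-integrand is a constant times ∏ⱼ Γ(τⱼ x^{±1}) / Γ(x^{±2}), where τ = (s w^{±1}, c y^{±1}, t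
z^{±1}). The hypotheses give ∏ τⱼ = pq and |τⱼ| < 1, so this is the elliptic beta integral, with
value ∏_{i<j} Γ(τᵢτⱼ) (`betaIntegral_eq`). Sorting the fifteen factors and using the reflection
Γ(x)Γ(pq/x) = 1 leaves the kernel of M(st) times D(s; y, z) (`baileyD_mul_integral`).

Most of the work is the beta integral. Let `betaRatio` be the integral divided by the expected
product. Under (a, b) ↦ (qa, b/q) both satisfy the same first-order difference equation
(`betaRatio_shift`). For the integral, the weighted difference of the two integrands is a multiple
of G(z) + G(1/z), where G integrates to zero because its contour integral equals its own negative
(`circleIntegral_telescope`). That pointwise decomposition is a theta function identity,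
`partialFraction_eq_zero`, deduced from the Weierstrass addition formula `threeTerm_eq_zero`.

With ab fixed, the ratio is thus a holomorphic function of a, invariant under a ↦ qa, on an annulus
wider than a fundamental one; the maximum principle makes it constant (`betaRatio_slide`). Two such
slides bring two parameters to ±iρ. As ρ → 1 the integrand concentrates at z = ±i like a Poisson
kernel, and the constant can be read off (`tendsto_betaRatio`). The slides require one parameter of
modulus below |q|; `betaRatio_eq` removes this restriction by analytic continuation. -/

namespace EllBailey

open Filter Topology Set Complex MeasureTheory

/-! ### Infinite products ∏ (1 − z cᵢ) with summable cᵢ. -/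

section Products

variable {ι : Type*} {c : ι → ℂ}

lemma multipliable_one_sub_mul (hc : Summable fun i => ‖c i‖) (z : ℂ) :
    Multipliable fun i => 1 - z * c i := by
  have : Summable fun i => ‖-(z * c i)‖ := by
    simpa [norm_mul] using hc.mul_left ‖z‖
  simpa [sub_eq_add_neg] using multipliable_one_add_of_summable this

lemma tprod_one_sub_mul_ne_zero (hc : Summable fun i => ‖c i‖) {z : ℂ}
    (h : ∀ i, z * c i ≠ 1) : ∏' i, (1 - z * c i) ≠ 0 := by
  have h1 : Summable fun i => ‖-(z * c i)‖ := by
    simpa [norm_mul] using hc.mul_left ‖z‖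
  have := tprod_one_add_ne_zero_of_summable (f := fun i => -(z * c i))
    (fun i hi => h i (by linear_combination -hi)) h1
  simpa [sub_eq_add_neg] using this

lemma differentiable_tprod_one_sub_mul (hc : Summable fun i => ‖c i‖) :
    Differentiable ℂ fun z => ∏' i, (1 - z * c i) := by
  intro z
  have h1 := Summable.hasProdLocallyUniformlyOn_one_add (f := fun i (z : ℂ) => -(z * c i))
    (Metric.isOpen_ball (x := (0 : ℂ)) (ε := ‖z‖ + 1)) (hc.mul_left (‖z‖ + 1))
    (Eventually.of_forall fun i x hx => by
      rw [norm_neg, norm_mul]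
      gcongr
      simpa using (mem_ball_zero_iff.1 hx).le)
    (fun i => by fun_prop)
  rw [hasProdLocallyUniformlyOn_iff_tendstoLocallyUniformlyOn] at h1
  have h2 := h1.differentiableOn (Eventually.of_forall fun s => by fun_prop) Metric.isOpen_ball
  have h3 := h2.differentiableAt (Metric.isOpen_ball.mem_nhds (x := z) (by simp))
  simpa [sub_eq_add_neg] using h3

end Products

/-! ### Single and double shifted factorials. -/

section Poch

variable {p q z : ℂ}

lemma summable_norm_pow (hq : ‖q‖ < 1) : Summable fun j : ℕ => ‖q ^ j‖ := by
  simpa [norm_pow] using summable_geometric_of_lt_one (norm_nonneg q) hq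

lemma summable_norm_pow_mul_pow (hp : ‖p‖ < 1) (hq : ‖q‖ < 1) :
    Summable fun jk : ℕ × ℕ => ‖p ^ jk.1 * q ^ jk.2‖ := by
  simpa only [norm_mul] using (summable_norm_pow hp).mul_of_nonneg (summable_norm_pow hq)
    (fun _ => norm_nonneg _) (fun _ => norm_nonneg _)

lemma poch_differentiable (hq : ‖q‖ < 1) : Differentiable ℂ fun z => poch z q :=
  differentiable_tprod_one_sub_mul (summable_norm_pow hq)

lemma poch_ne_zero (hq : ‖q‖ < 1) (h : ∀ j : ℕ, z * q ^ j ≠ 1) : poch z q ≠ 0 :=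
  tprod_one_sub_mul_ne_zero (summable_norm_pow hq) h

lemma mul_ne_one_of_norm_lt_one {a b : ℂ} (ha : ‖a‖ < 1) (hb : ‖b‖ ≤ 1) : a * b ≠ 1 := by
  intro h
  have := congrArg norm h
  rw [norm_mul, norm_one] at this
  nlinarith [norm_nonneg a, norm_nonneg b]

lemma norm_pow_le_one (hq : ‖q‖ < 1) (j : ℕ) : ‖q ^ j‖ ≤ 1 := by
  rw [norm_pow]; exact pow_le_one₀ (norm_nonneg _) hq.le

lemma poch_ne_zero_of_norm_lt_one (hq : ‖q‖ < 1) (hz : ‖z‖ < 1) : poch z q ≠ 0 :=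
  poch_ne_zero hq fun j => mul_ne_one_of_norm_lt_one hz (norm_pow_le_one hq j)

lemma poch_step (hq : ‖q‖ < 1) (z : ℂ) : poch z q = (1 - z) * poch (z * q) q := by
  have h' : Multipliable fun n : ℕ => 1 - z * q ^ (n + 1) :=
    (multipliable_one_sub_mul (summable_norm_pow hq) (z * q)).congr fun n => by
      rw [pow_succ', mul_assoc]
  have h1 : poch z q = (1 - z * q ^ 0) * ∏' n : ℕ, (1 - z * q ^ (n + 1)) :=
    tprod_eq_zero_mul' (f := fun n : ℕ => 1 - z * q ^ n) h'
  rw [h1, pow_zero, mul_one]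
  congr 1
  exact tprod_congr fun n => by rw [pow_succ', mul_assoc]

lemma poch₂_eq (z p q : ℂ) : poch₂ z p q = ∏' jk : ℕ × ℕ, (1 - z * (p ^ jk.1 * q ^ jk.2)) :=
  tprod_congr fun _ => by rw [mul_assoc]

lemma poch₂_comm (z p q : ℂ) : poch₂ z p q = poch₂ z q p := by
  unfold poch₂
  rw [← (Equiv.prodComm ℕ ℕ).tprod_eq]
  exact tprod_congr fun _ => by simp; ring

lemma poch₂_differentiable (hp : ‖p‖ < 1) (hq : ‖q‖ < 1) :
    Differentiable ℂ fun z => poch₂ z p q := by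
  simp only [poch₂_eq]
  exact differentiable_tprod_one_sub_mul (summable_norm_pow_mul_pow hp hq)

lemma poch₂_ne_zero_of_norm_lt_one (hp : ‖p‖ < 1) (hq : ‖q‖ < 1) (hz : ‖z‖ < 1) :
    poch₂ z p q ≠ 0 := by
  rw [poch₂_eq]
  refine tprod_one_sub_mul_ne_zero (summable_norm_pow_mul_pow hp hq) fun i => ?_
  refine mul_ne_one_of_norm_lt_one hz ?_
  rw [norm_mul]
  exact mul_le_one₀ (norm_pow_le_one hp _) (norm_nonneg _) (norm_pow_le_one hq _)

/-- Grouping the double product by the power of q gives ∏ₖ (z qᵏ; p)_∞; the factor k = 0 is then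
split off. -/
lemma poch₂_step (hp : ‖p‖ < 1) (hq : ‖q‖ < 1) (z : ℂ) :
    poch₂ z p q = poch z p * poch₂ (z * q) p q := by
  have hs : ∀ z : ℂ, Multipliable fun x : ℕ × ℕ => 1 - z * (q ^ x.1 * p ^ x.2) := fun z =>
    multipliable_one_sub_mul (c := fun x : ℕ × ℕ => q ^ x.1 * p ^ x.2)
      (summable_norm_pow_mul_pow hq hp) z
  have hf : ∀ z : ℂ, HasProd (fun k : ℕ => poch (z * q ^ k) p) (poch₂ z p q) := by
    intro z
    have h2 := (hs z).hasProd.prod_fiberwise (g := fun k => poch (z * q ^ k) p) fun k => by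
      have h3 := (multipliable_one_sub_mul (summable_norm_pow hp) (z * q ^ k)).hasProd
      simp only [mul_assoc] at h3
      simpa only [poch, mul_assoc] using h3
    rwa [← poch₂_eq, poch₂_comm] at h2
  have key : ∀ z, poch₂ z p q = ∏' k : ℕ, poch (z * q ^ k) p := fun z => (hf z).tprod_eq.symm
  have hm : Multipliable fun k : ℕ => poch (z * q ^ (k + 1)) p :=
    (hf (z * q)).multipliable.congr fun k => by rw [pow_succ', mul_assoc]
  have h1 : ∏' k : ℕ, poch (z * q ^ k) p =
      poch (z * q ^ 0) p * ∏' k : ℕ, poch (z * q ^ (k + 1)) p :=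
    tprod_eq_zero_mul' (f := fun k : ℕ => poch (z * q ^ k) p) hm
  rw [key, h1, key, pow_zero, mul_one]
  congr 1
  exact tprod_congr fun n => by rw [pow_succ', mul_assoc]

lemma poch₂_step' (hp : ‖p‖ < 1) (hq : ‖q‖ < 1) (z : ℂ) :
    poch₂ z p q = poch z q * poch₂ (z * p) p q := by
  rw [poch₂_comm, poch₂_step hq hp, poch₂_comm]

end Poch

/-! ### The theta function, its quasi-periodicity and its zeros. -/

/-- The modified theta function `θ(z; q) = (z; q)_∞ (q z⁻¹; q)_∞`. -/
noncomputable def theta (q z : ℂ) : ℂ := poch z q * poch (q * z⁻¹) q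

section Theta

variable {q z : ℂ}

lemma theta_mul_q (hq0 : q ≠ 0) (hq : ‖q‖ < 1) (hz : z ≠ 0) :
    theta q (q * z) = -z⁻¹ * theta q z := by
  unfold theta
  rw [poch_step hq z, mul_inv, mul_inv_cancel_left₀ hq0, poch_step hq z⁻¹, mul_comm q z,
    mul_comm q z⁻¹]
  field_simp
  ring

lemma theta_inv (hq : ‖q‖ < 1) (hz : z ≠ 0) : theta q z⁻¹ = -z⁻¹ * theta q z := by
  unfold theta
  rw [poch_step hq z, inv_inv, poch_step hq z⁻¹, mul_comm q z, mul_comm q z⁻¹]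
  field_simp
  ring

lemma theta_q_div (hq0 : q ≠ 0) (z : ℂ) : theta q (q * z⁻¹) = theta q z := by
  unfold theta
  rw [mul_inv, inv_inv, mul_inv_cancel_left₀ hq0, mul_comm]

lemma theta_one (hq : ‖q‖ < 1) : theta q 1 = 0 := by
  simp [theta, poch_step hq 1]

lemma theta_differentiableAt (hq : ‖q‖ < 1) (hz : z ≠ 0) : DifferentiableAt ℂ (theta q) z := by
  have h := poch_differentiable hq
  have h1 : DifferentiableAt ℂ (fun z : ℂ => q * z⁻¹) z := (differentiableAt_inv hz).const_mul q
  exact (h z).mul (DifferentiableAt.comp (g := fun w => poch w q) z (h (q * z⁻¹)) h1)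

lemma exists_zpow_of_theta_eq_zero (hq0 : q ≠ 0) (hq : ‖q‖ < 1) (hz : z ≠ 0)
    (h : theta q z = 0) : ∃ k : ℤ, z = q ^ k := by
  unfold theta at h
  rcases mul_eq_zero.1 h with h | h
  · by_contra hk
    push Not at hk
    refine poch_ne_zero hq (fun j hj => hk (-j) ?_) h
    rw [zpow_neg, zpow_natCast]
    exact eq_inv_of_mul_eq_one_left hj
  · by_contra hk
    push Not at hk
    refine poch_ne_zero hq (fun j hj => hk (j + 1) ?_) h
    field_simp at hj
    rw [zpow_add₀ hq0, zpow_natCast, zpow_one, ← hj]; ring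

lemma theta_ne_zero_of_norm (hq : ‖q‖ < 1) (hz : ‖z‖ < 1) (hz' : ‖q‖ < ‖z‖) :
    theta q z ≠ 0 := by
  have hz0 : 0 < ‖z‖ := (norm_nonneg _).trans_lt hz'
  refine mul_ne_zero (poch_ne_zero_of_norm_lt_one hq hz) (poch_ne_zero_of_norm_lt_one hq ?_)
  rw [norm_mul, norm_inv, ← div_eq_mul_inv, div_lt_one hz0]
  exact hz'

/-- θ(z) = (1 − z) · (a function that does not vanish at 1). -/
lemma theta_deriv_one (hq : ‖q‖ < 1) : deriv (theta q) 1 ≠ 0 := by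
  have h := poch_differentiable hq
  have h1 : theta q = fun z => (1 - z) * (poch (z * q) q * poch (q * z⁻¹) q) := by
    funext z; rw [theta, poch_step hq z]; ring
  have h2 : DifferentiableAt ℂ (fun z => poch (z * q) q * poch (q * z⁻¹) q) 1 := by
    have e1 : DifferentiableAt ℂ (fun z : ℂ => q * z⁻¹) 1 :=
      (differentiableAt_inv one_ne_zero).const_mul q
    have e2 : DifferentiableAt ℂ (fun z : ℂ => z * q) 1 := by fun_prop
    exact ((h _).comp (1 : ℂ) e2).mul ((h _).comp (1 : ℂ) e1)
  have h3 : HasDerivAt (fun z : ℂ => 1 - z) (-1) 1 := by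
    simpa using (hasDerivAt_id (1 : ℂ)).const_sub 1
  have h4 := (h3.mul h2.hasDerivAt).deriv
  rw [h1]
  refine ne_of_eq_of_ne h4 ?_
  simp [poch_ne_zero_of_norm_lt_one hq hq]

/-- Differentiating θ(qz) = −z⁻¹θ(z) at a zero gives q θ′(qz) = −z⁻¹θ′(z), so simplicity of the zero
at 1 spreads to every power of q. -/
lemma theta_deriv_zpow (hq0 : q ≠ 0) (hq : ‖q‖ < 1) (k : ℤ) : deriv (theta q) (q ^ k) ≠ 0 := by
  have key : ∀ z : ℂ, z ≠ 0 → theta q z = 0 →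
      q * deriv (theta q) (q * z) = -z⁻¹ * deriv (theta q) z := by
    intro z hz h0
    have h1 : HasDerivAt (fun w => theta q (q * w)) (deriv (theta q) (q * z) * q) z := by
      have := (theta_differentiableAt hq (mul_ne_zero hq0 hz)).hasDerivAt
      refine this.comp z ?_
      simpa using (hasDerivAt_id z).const_mul q
    have h2 : HasDerivAt (fun w => -w⁻¹ * theta q w) (-z⁻¹ * deriv (theta q) z) z := by
      have e := ((hasDerivAt_inv hz).neg.mul (theta_differentiableAt hq hz).hasDerivAt)
      refine e.congr_deriv ?_
      simp [h0]
    have h3 : (fun w => theta q (q * w)) =ᶠ[𝓝 z] fun w => -w⁻¹ * theta q w := by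
      filter_upwards [isOpen_ne.mem_nhds hz] with w hw using theta_mul_q hq0 hq hw
    rw [mul_comm]
    exact h1.unique (h2.congr_of_eventuallyEq h3)
  have hz : ∀ k : ℤ, theta q (q ^ k) = 0 := by
    intro k
    induction k using Int.induction_on with
    | zero => simp [theta_one hq]
    | succ n ih =>
      rw [add_comm, zpow_add₀ hq0, zpow_one, theta_mul_q hq0 hq (zpow_ne_zero _ hq0), ih, mul_zero]
    | pred n ih =>
      have := theta_mul_q hq0 hq (zpow_ne_zero (-(n : ℤ) - 1) hq0)
      rw [← zpow_one_add₀ hq0, add_sub_cancel, ih] at this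
      simpa [hq0, zpow_ne_zero] using this.symm
  induction k using Int.induction_on with
  | zero => simpa using theta_deriv_one hq
  | succ n ih =>
    have := key _ (zpow_ne_zero _ hq0) (hz n)
    rw [← zpow_one_add₀ hq0, add_comm] at this
    intro h
    rw [h, mul_zero] at this
    simp [hq0] at this
    exact ih (by simpa using this)
  | pred n ih =>
    have := key _ (zpow_ne_zero _ hq0) (hz (-(n : ℤ) - 1))
    rw [← zpow_one_add₀ hq0, add_sub_cancel] at this
    intro h
    rw [h, mul_zero] at this
    exact ih (by simpa [hq0] using this)

end Theta

/-! ### Multiplicatively periodic holomorphic functions are constant. -/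

section Periodic

variable {q : ℂ}

/-- The annulus is the image under exp of a convex vertical strip. -/
lemma isPreconnected_annulus {r R : ℝ} (hr : 0 < r) (hR : 0 < R) :
    IsPreconnected {z : ℂ | r < ‖z‖ ∧ ‖z‖ < R} := by
  have h1 : IsPreconnected {u : ℂ | Real.log r < u.re ∧ u.re < Real.log R} :=
    ((convex_halfSpace_re_gt _).inter (convex_halfSpace_re_lt _)).isPreconnected
  have h2 := h1.image Complex.exp Complex.continuous_exp.continuousOn
  convert h2 using 1
  ext z
  constructor
  · rintro ⟨h3, h4⟩
    have hz : z ≠ 0 := norm_pos_iff.1 (hr.trans h3)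
    refine ⟨Complex.log z, ⟨?_, ?_⟩, Complex.exp_log hz⟩
    · rw [Complex.log_re]; exact Real.log_lt_log hr h3
    · rw [Complex.log_re]; exact Real.log_lt_log (hr.trans h3) h4
  · rintro ⟨u, ⟨h3, h4⟩, rfl⟩
    rw [mem_ofPred_eq, Complex.norm_exp]
    exact ⟨(Real.log_lt_iff_lt_exp hr).1 h3, (Real.lt_log_iff_exp_lt hR).1 h4⟩

/-- A function holomorphic on an annulus wider than a fundamental annulus of multiplication by `q`
and invariant under this multiplication is constant. -/
lemma eq_of_mul_periodic {r R : ℝ} {f : ℂ → ℂ} (hq0 : q ≠ 0) (hq : ‖q‖ < 1) (hr : 0 < r)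
    (hrR : r < ‖q‖ * R) (hf : DifferentiableOn ℂ f {z | r < ‖z‖ ∧ ‖z‖ < R})
    (hper : ∀ z, r < ‖q * z‖ → ‖z‖ < R → f (q * z) = f z) {z w : ℂ}
    (hz : r < ‖z‖ ∧ ‖z‖ < R) (hw : r < ‖w‖ ∧ ‖w‖ < R) : f z = f w := by
  set U := {z : ℂ | r < ‖z‖ ∧ ‖z‖ < R} with hU
  have hq1 : 0 < ‖q‖ := norm_pos_iff.2 hq0
  have hR : 0 < R := pos_of_mul_pos_right (hr.trans hrR) hq1.le
  -- r < |q|s and s < R put the closed fundamental annulus |q|s ≤ |z| ≤ s inside the domain; |q|R <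
  -- s ensures that one multiplication by q brings points with |z| > s into it.
  obtain ⟨s, hs1, hs2⟩ : ∃ s, max (r / ‖q‖) (‖q‖ * R) < s ∧ s < R := by
    refine exists_between (max_lt ?_ ?_)
    · rwa [div_lt_iff₀ hq1, mul_comm]
    · nlinarith
  rw [max_lt_iff, div_lt_iff₀ hq1] at hs1
  obtain ⟨hs1, hs3⟩ := hs1
  have hs0 : 0 < s := (mul_pos hq1 hR).trans hs3
  set K := {z : ℂ | ‖q‖ * s ≤ ‖z‖ ∧ ‖z‖ ≤ s} with hK
  have hKU : K ⊆ U := fun z hz => ⟨by linarith [hz.1], by linarith [hz.2]⟩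
  have hKc : IsCompact K := by
    have : K = {z : ℂ | ‖q‖ * s ≤ ‖z‖} ∩ Metric.closedBall 0 s := by
      ext z; simp [hK]
    rw [this]
    exact (isCompact_closedBall _ _).inter_left (isClosed_le continuous_const continuous_norm)
  have hKn : (s : ℂ) ∈ K := by
    simp only [hK, mem_ofPred_eq, Complex.norm_real, Real.norm_eq_abs, abs_of_pos hs0, le_refl,
      and_true]
    nlinarith
  -- Points with |z| ≤ s are divided by q until they reach K; n bounds the number of divisions.
  have hred1 : ∀ n : ℕ, ∀ z, ‖q‖ ^ (n + 1) * s ≤ ‖z‖ → r < ‖z‖ → ‖z‖ ≤ s →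
      ∃ z' ∈ K, f z' = f z := by
    intro n
    induction n with
    | zero => intro z h1 _ h3; exact ⟨z, ⟨by simpa using h1, h3⟩, rfl⟩
    | succ n ih =>
      intro z h1 h2 h3
      by_cases h4 : ‖q‖ * s ≤ ‖z‖
      · exact ⟨z, ⟨h4, h3⟩, rfl⟩
      push Not at h4
      have h5 : ‖z / q‖ ≤ s := by
        rw [norm_div, div_le_iff₀ hq1]; linarith
      obtain ⟨z', hz', h6⟩ := ih (z / q)
        (by rw [norm_div, le_div_iff₀ hq1]; calc _ = ‖q‖ ^ (n + 1 + 1) * s := by ring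
              _ ≤ _ := h1)
        (by rw [norm_div, lt_div_iff₀ hq1]; nlinarith) h5
      refine ⟨z', hz', h6.trans ?_⟩
      have h7 := hper (z / q) (by rwa [mul_div_cancel₀ _ hq0]) (by linarith)
      rw [← h7, mul_div_cancel₀ _ hq0]
  have hred : ∀ z ∈ U, ∃ z' ∈ K, f z' = f z := by
    rintro z ⟨h1, h2⟩
    rcases le_or_gt ‖z‖ s with h3 | h3
    · obtain ⟨n, hn⟩ := exists_pow_lt_of_lt_one (div_pos (hr.trans h1) hs0) hq
      refine hred1 n z ?_ h1 h3
      rw [lt_div_iff₀ hs0] at hn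
      have : ‖q‖ ^ (n + 1) ≤ ‖q‖ ^ n := pow_le_pow_of_le_one hq1.le hq.le n.le_succ
      nlinarith
    · refine ⟨q * z, ⟨?_, ?_⟩, hper z ?_ h2⟩ <;> rw [norm_mul] <;> nlinarith
  obtain ⟨c, hcK, hc⟩ := hKc.exists_isMaxOn ⟨_, hKn⟩
    ((hf.continuousOn.mono hKU).norm)
  have hUo : IsOpen U :=
    (isOpen_lt continuous_const continuous_norm).inter (isOpen_lt continuous_norm continuous_const)
  -- Every value of f is taken on the compact set K, so the maximum of |f| on K is a global one at
  -- an interior point of U, and the maximum principle applies.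
  have hmax : IsMaxOn (norm ∘ f) U c := by
    intro z hz
    obtain ⟨z', hz', h⟩ := hred z hz
    have := hc hz'
    simpa [h] using this
  have := Complex.eqOn_of_isPreconnected_of_isMaxOn_norm (isPreconnected_annulus hr hR) hUo hf
    (hKU hcK) hmax
  exact (this hz).trans (this hw).symm

/-- A holomorphic function on `ℂ ∖ {0}` invariant under multiplication by `q` is constant. -/
lemma eq_of_mul_periodic_punctured {f : ℂ → ℂ} (hq0 : q ≠ 0) (hq : ‖q‖ < 1)
    (hf : ∀ z, z ≠ 0 → DifferentiableAt ℂ f z) (hper : ∀ z, z ≠ 0 → f (q * z) = f z) {z w : ℂ}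
    (hz : z ≠ 0) (hw : w ≠ 0) : f z = f w := by
  have hq1 : 0 < ‖q‖ := norm_pos_iff.2 hq0
  have hz1 : 0 < ‖z‖ := norm_pos_iff.2 hz
  have hw1 : 0 < ‖w‖ := norm_pos_iff.2 hw
  have hmin : 0 < min ‖z‖ ‖w‖ := lt_min hz1 hw1
  have e1 : 0 < ‖q‖ * (min ‖z‖ ‖w‖) / 2 := by positivity
  have e2 : ‖q‖ * (min ‖z‖ ‖w‖) / 2 < min ‖z‖ ‖w‖ := by nlinarith
  have e3 := min_le_left ‖z‖ ‖w‖
  have e4 := min_le_right ‖z‖ ‖w‖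
  refine eq_of_mul_periodic (r := ‖q‖ * (min ‖z‖ ‖w‖) / 2) (R := ‖z‖ + ‖w‖) hq0 hq e1
    ?_ (fun u hu => (hf u ?_).differentiableWithinAt) (fun u hu _ => hper u ?_)
    ⟨by linarith, by linarith⟩ ⟨by linarith, by linarith⟩
  · nlinarith
  · exact norm_pos_iff.1 (e1.trans hu.1)
  · rintro rfl
    simp at hu
    linarith

end Periodic

/-- The quotient of two holomorphic functions with removable singularities removed, when the
denominator has only simple zeros at which the numerator vanishes. -/
lemma differentiableAt_quotient {f g : ℂ → ℂ} {z : ℂ} (hf : ∀ᶠ w in 𝓝 z, DifferentiableAt ℂ f w)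
    (hg : ∀ᶠ w in 𝓝 z, DifferentiableAt ℂ g w) (h : g z = 0 → f z = 0 ∧ deriv g z ≠ 0) :
    DifferentiableAt ℂ (fun w => if g w = 0 then deriv f w / deriv g w else f w / g w) z := by
  by_cases hz : g z = 0
  · obtain ⟨hfz, hd⟩ := h hz
    have hf' : DifferentiableAt ℂ (dslope f z) z :=
      ((Complex.differentiableOn_dslope hf).2 fun w hw =>
        DifferentiableAt.differentiableWithinAt hw).differentiableAt hf
    have hg' : DifferentiableAt ℂ (dslope g z) z :=
      ((Complex.differentiableOn_dslope hg).2 fun w hw =>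
        DifferentiableAt.differentiableWithinAt hw).differentiableAt hg
    have hne : dslope g z z ≠ 0 := by rwa [dslope_same]
    refine (hf'.div hg' hne).congr_of_eventuallyEq ?_
    -- Both functions carry the factor w − z; cancelling it turns the quotient into a quotient of
    -- difference quotients, which is regular because g′(z) ≠ 0.
    filter_upwards [hg'.continuousAt.eventually_ne hne] with w hw
    rcases eq_or_ne w z with rfl | hwz
    · simp [hz]
    · have hgw : g w = (w - z) * dslope g z w := by
        rw [dslope_of_ne _ hwz, slope_def_field, hz, sub_zero, mul_div_cancel₀ _ (sub_ne_zero.2 hwz)]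
      have hfw : f w = (w - z) * dslope f z w := by
        rw [dslope_of_ne _ hwz, slope_def_field, hfz, sub_zero,
          mul_div_cancel₀ _ (sub_ne_zero.2 hwz)]
      have : g w ≠ 0 := by rw [hgw]; exact mul_ne_zero (sub_ne_zero.2 hwz) hw
      simp only [this, if_false, Pi.div_apply]
      rw [hgw, hfw, mul_div_mul_left _ _ (sub_ne_zero.2 hwz)]
  · refine (hf.self_of_nhds.div hg.self_of_nhds hz).congr_of_eventuallyEq ?_
    filter_upwards [hg.self_of_nhds.continuousAt.eventually_ne hz] with w hw
    simp [hw]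

/-- A countable set has dense complement. This removes the genericity assumptions from the theta
identities below. -/
lemma eq_zero_of_eq_zero_off_countable {F : ℂ → ℂ} {S : Set ℂ} (hS : S.Countable)
    (h : ∀ x, x ≠ 0 → x ∉ S → F x = 0) {x : ℂ} (hx : x ≠ 0) (hF : ContinuousAt F x) :
    F x = 0 := by
  by_contra hne
  have h1 : ∀ᶠ w in 𝓝 x, F w ≠ 0 ∧ w ≠ 0 := (hF.eventually_ne hne).and (eventually_ne_nhds hx)
  obtain ⟨V, hV, hVo, hxV⟩ := eventually_nhds_iff.1 h1
  obtain ⟨w, hw1, hw2⟩ := (hS.dense_compl ℝ).inter_open_nonempty V hVo ⟨x, hxV⟩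
  exact (hV w hw1).1 (h w (hV w hw1).2 hw2)

/-! ### The Weierstrass addition formula and the partial fraction identity. -/

section ThetaIdentities

variable {p : ℂ}

lemma theta_ne_zero_iff (hp0 : p ≠ 0) (hp : ‖p‖ < 1) {z : ℂ} (hz : z ≠ 0) :
    theta p z ≠ 0 ↔ ∀ k : ℤ, z ≠ p ^ k := by
  refine ⟨?_, fun h h0 => ?_⟩
  · rintro h k rfl
    apply h
    clear h hz
    induction k using Int.induction_on with
    | zero => simp [theta_one hp]
    | succ n ih =>
      rw [add_comm, zpow_add₀ hp0, zpow_one, theta_mul_q hp0 hp (zpow_ne_zero _ hp0), ih, mul_zero]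
    | pred n ih =>
      have := theta_mul_q hp0 hp (zpow_ne_zero (-(n : ℤ) - 1) hp0)
      rw [← zpow_one_add₀ hp0, add_sub_cancel, ih] at this
      simpa [hp0, zpow_ne_zero] using this.symm
  · obtain ⟨k, hk⟩ := exists_zpow_of_theta_eq_zero hp0 hp hz h0
    exact h k hk

lemma theta_deriv_ne_zero (hp0 : p ≠ 0) (hp : ‖p‖ < 1) {z : ℂ} (hz : z ≠ 0)
    (h : theta p z = 0) : deriv (theta p) z ≠ 0 := by
  obtain ⟨k, rfl⟩ := exists_zpow_of_theta_eq_zero hp0 hp hz h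
  exact theta_deriv_zpow hp0 hp k

lemma theta_div_p (hp0 : p ≠ 0) (hp : ‖p‖ < 1) {z : ℂ} (hz : z ≠ 0) :
    theta p (z / p) = -(z / p) * theta p z := by
  have := theta_mul_q hp0 hp (div_ne_zero hz hp0)
  rw [mul_div_cancel₀ _ hp0] at this
  rw [this]
  field_simp

lemma differentiableAt_theta_comp (hp : ‖p‖ < 1) {f : ℂ → ℂ} {z : ℂ} (hf : DifferentiableAt ℂ f z)
    (h : f z ≠ 0) : DifferentiableAt ℂ (fun w => theta p (f w)) z :=
  DifferentiableAt.comp (g := theta p) z (theta_differentiableAt hp h) hf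

/-- `φ_a(x) = θ(a x) θ(a c / x)`, an element of the two-dimensional space of theta functions of
degree two invariant under `x ↦ c / x`. -/
noncomputable def thetaPair (p a c x : ℂ) : ℂ := theta p (a * x) * theta p (a * c / x)

lemma thetaPair_mul_p (hp0 : p ≠ 0) (hp : ‖p‖ < 1) {a c x : ℂ} (ha : a ≠ 0) (hc : c ≠ 0)
    (hx : x ≠ 0) : thetaPair p a c (p * x) = c / (p * x ^ 2) * thetaPair p a c x := by
  unfold thetaPair
  have h1 := theta_mul_q hp0 hp (mul_ne_zero ha hx)
  have h2 := theta_div_p hp0 hp (div_ne_zero (mul_ne_zero ha hc) hx)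
  rw [show a * (p * x) = p * (a * x) by ring, h1,
    show a * c / (p * x) = a * c / x / p by field_simp, h2]
  field_simp

lemma thetaPair_symm {a c x : ℂ} (hc : c ≠ 0) :
    thetaPair p a c (c / x) = thetaPair p a c x := by
  unfold thetaPair
  rw [mul_comm, mul_div_assoc', show a * c / (c / x) = a * x by field_simp]

lemma thetaPair_differentiableAt (hp : ‖p‖ < 1) {a c x : ℂ} (ha : a ≠ 0) (hc : c ≠ 0)
    (hx : x ≠ 0) : DifferentiableAt ℂ (thetaPair p a c) x := by
  have h1 : DifferentiableAt ℂ (fun x => a * x) x := by fun_prop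
  have h2 : DifferentiableAt ℂ (fun x => a * c / x) x :=
    (differentiableAt_const _).div differentiableAt_id hx
  exact (differentiableAt_theta_comp hp h1 (mul_ne_zero ha hx)).mul
    (differentiableAt_theta_comp hp h2 (div_ne_zero (mul_ne_zero ha hc) hx))

/-- A theta function of degree two that is invariant under `x ↦ c / x` and vanishes at two
inequivalent points vanishes identically. -/
lemma eq_zero_of_two_zeros (hp0 : p ≠ 0) (hp : ‖p‖ < 1) {c x₀ x₁ : ℂ} (hc : c ≠ 0)
    (hx₀ : x₀ ≠ 0) (hx₁ : x₁ ≠ 0) {h : ℂ → ℂ} (hd : ∀ z, z ≠ 0 → DifferentiableAt ℂ h z)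
    (hper : ∀ x, x ≠ 0 → h (p * x) = c / (p * x ^ 2) * h x)
    (hsymm : ∀ x, x ≠ 0 → h (c / x) = h x) (h0 : h x₀ = 0) (h1 : h x₁ = 0)
    (hgen : theta p (c / x₀ ^ 2) ≠ 0) (hne : thetaPair p x₀⁻¹ c x₁ ≠ 0) {x : ℂ} (hx : x ≠ 0) :
    h x = 0 := by
  set d := thetaPair p x₀⁻¹ c with hdd
  have hx₀' := inv_ne_zero hx₀
  have hdp : ∀ x, x ≠ 0 → d (p * x) = c / (p * x ^ 2) * d x := fun x hx =>
    thetaPair_mul_p hp0 hp hx₀' hc hx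
  have hdd' : ∀ x, x ≠ 0 → DifferentiableAt ℂ d x := fun x hx =>
    thetaPair_differentiableAt hp hx₀' hc hx
  have hzero : ∀ k : ℤ, ∀ x, x ≠ 0 → h x = 0 → h (p ^ k * x) = 0 := by
    intro k x hx h0
    induction k using Int.induction_on with
    | zero => simpa using h0
    | succ n ih =>
      rw [add_comm, zpow_add₀ hp0, zpow_one, mul_assoc,
        hper _ (mul_ne_zero (zpow_ne_zero _ hp0) hx), ih, mul_zero]
    | pred n ih =>
      have hy : p ^ (-(n : ℤ) - 1) * x ≠ 0 := mul_ne_zero (zpow_ne_zero _ hp0) hx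
      have := hper _ hy
      rw [← mul_assoc, ← zpow_one_add₀ hp0, add_sub_cancel, ih] at this
      have h3 : c / (p * (p ^ (-(n : ℤ) - 1) * x) ^ 2) ≠ 0 :=
        div_ne_zero hc (mul_ne_zero hp0 (pow_ne_zero _ hy))
      exact (mul_eq_zero.1 this.symm).resolve_left h3
  have hshift : ∀ k : ℤ, theta p (c / x₀ ^ 2 * p ^ k) ≠ 0 := by
    intro k
    have h2 : c / x₀ ^ 2 ≠ 0 := by positivity
    rw [theta_ne_zero_iff hp0 hp (mul_ne_zero h2 (zpow_ne_zero _ hp0))]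
    rw [theta_ne_zero_iff hp0 hp h2] at hgen
    intro m hm
    refine hgen (m - k) ?_
    rw [zpow_sub₀ hp0, eq_div_iff (zpow_ne_zero _ hp0), hm]
  -- The zeros of d are the points x₀pᵏ and (c/x₀)pᵏ. `hgen` says that these two classes are
  -- disjoint, so the zeros are simple, and h vanishes on both by quasi-periodicity and symmetry.
  have hsimple : ∀ x, x ≠ 0 → d x = 0 → h x = 0 ∧ deriv d x ≠ 0 := by
    intro x hx hdx
    have hu : HasDerivAt (fun x => x₀⁻¹ * x) x₀⁻¹ x := by
      simpa using (hasDerivAt_id x).const_mul x₀⁻¹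
    have hv : HasDerivAt (fun x => x₀⁻¹ * c / x) (-(x₀⁻¹ * c) / x ^ 2) x := by
      have := (hasDerivAt_inv hx).const_mul (x₀⁻¹ * c)
      refine this.congr_deriv ?_
      ring
    have hu0 : x₀⁻¹ * x ≠ 0 := mul_ne_zero hx₀' hx
    have hv0 : x₀⁻¹ * c / x ≠ 0 := div_ne_zero (mul_ne_zero hx₀' hc) hx
    have hU := HasDerivAt.comp (h₂ := theta p) x (theta_differentiableAt hp hu0).hasDerivAt hu
    have hV := HasDerivAt.comp (h₂ := theta p) x (theta_differentiableAt hp hv0).hasDerivAt hv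
    have hder : deriv d x = _ := (hU.mul hV).deriv
    simp only [Function.comp] at hder
    rw [hder]
    rcases mul_eq_zero.1 hdx with hz | hz
    · obtain ⟨k, hk⟩ := exists_zpow_of_theta_eq_zero hp0 hp hu0 hz
      have hxk : x = p ^ k * x₀ := by rw [← hk]; field_simp
      refine ⟨hxk ▸ hzero k x₀ hx₀ h0, ?_⟩
      rw [hz, zero_mul, add_zero]
      refine mul_ne_zero (mul_ne_zero (theta_deriv_ne_zero hp0 hp hu0 hz) hx₀') ?_
      have : x₀⁻¹ * c / x = c / x₀ ^ 2 * p ^ (-k) := by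
        rw [hxk, zpow_neg]; field_simp
      rw [this]; exact hshift _
    · obtain ⟨k, hk⟩ := exists_zpow_of_theta_eq_zero hp0 hp hv0 hz
      have hxk : x = p ^ (-k) * (c / x₀) := by
        rw [zpow_neg, ← hk]; field_simp
      refine ⟨hxk ▸ hzero (-k) _ (div_ne_zero hc hx₀) ((hsymm _ hx₀).trans h0), ?_⟩
      rw [hz, mul_zero, zero_add]
      refine mul_ne_zero ?_ (mul_ne_zero (theta_deriv_ne_zero hp0 hp hv0 hz) ?_)
      · have : x₀⁻¹ * x = c / x₀ ^ 2 * p ^ (-k) := by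
          rw [hxk]; field_simp
        rw [this]; exact hshift _
      · exact div_ne_zero (neg_ne_zero.2 (mul_ne_zero hx₀' hc)) (pow_ne_zero _ hx)
  -- K is h/d with its removable singularities filled in. The multipliers of h and d agree, so K is
  -- invariant under multiplication by p, hence constant; its value at x₁ is 0.
  set K : ℂ → ℂ := fun w => if d w = 0 then deriv h w / deriv d w else h w / d w with hK
  have hKd : ∀ z, z ≠ 0 → DifferentiableAt ℂ K z := by
    intro z hz
    refine differentiableAt_quotient ?_ ?_ (hsimple z hz)
    · filter_upwards [eventually_ne_nhds hz] with w hw using hd w hw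
    · filter_upwards [eventually_ne_nhds hz] with w hw using hdd' w hw
  have hKp : ∀ z, z ≠ 0 → K (p * z) = K z := by
    intro z hz
    have hgood : ∀ w, w ≠ 0 → d w ≠ 0 → K (p * w) = K w := by
      intro w hw hdw
      have e : c / (p * w ^ 2) ≠ 0 := div_ne_zero hc (mul_ne_zero hp0 (pow_ne_zero _ hw))
      have e2 : d (p * w) ≠ 0 := by rw [hdp w hw]; exact mul_ne_zero e hdw
      simp only [hK, hdw, e2, if_false]
      rw [hdp w hw, hper w hw, mul_div_mul_left _ _ e]
    by_cases hdz : d z = 0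
    -- At a zero of d the invariance is obtained as a limit from the punctured neighbourhood, where
    -- d ≠ 0.
    · have h2 : ∀ᶠ w in 𝓝[≠] z, d w ≠ 0 :=
        (hdd' z hz).hasDerivAt.eventually_ne (hsimple z hz hdz).2
      have h3 : ∀ᶠ w in 𝓝[≠] z, K (p * w) = K w := by
        filter_upwards [h2, (eventually_ne_nhds hz).filter_mono nhdsWithin_le_nhds] with w hw hw'
          using hgood w hw' hw
      have c1 : Tendsto (fun w => K (p * w)) (𝓝[≠] z) (𝓝 (K (p * z))) := by
        have : ContinuousAt (fun w => K (p * w)) z :=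
          ContinuousAt.comp (g := K) (hKd _ (mul_ne_zero hp0 hz)).continuousAt (by fun_prop)
        exact this.tendsto.mono_left nhdsWithin_le_nhds
      have c2 : Tendsto K (𝓝[≠] z) (𝓝 (K z)) :=
        (hKd z hz).continuousAt.tendsto.mono_left nhdsWithin_le_nhds
      exact tendsto_nhds_unique_of_eventuallyEq c1 c2 h3
    · exact hgood z hz hdz
  by_cases hdx : d x = 0
  · exact (hsimple x hx hdx).1
  have := eq_of_mul_periodic_punctured hp0 hp hKd hKp hx hx₁
  simp only [hK, hdx, hne, if_false, h1, zero_div] at this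
  simpa [hdx] using this

lemma countable_setOf_theta_eq_zero (hp0 : p ≠ 0) (hp : ‖p‖ < 1) :
    {z : ℂ | z ≠ 0 ∧ theta p z = 0}.Countable := by
  refine (countable_range fun k : ℤ => p ^ k).mono ?_
  rintro z ⟨hz, h⟩
  obtain ⟨k, hk⟩ := exists_zpow_of_theta_eq_zero hp0 hp hz h
  exact ⟨k, hk.symm⟩

lemma countable_setOf_theta_sq_eq_zero (hp0 : p ≠ 0) (hp : ‖p‖ < 1) :
    {z : ℂ | z ≠ 0 ∧ theta p (z ^ 2) = 0}.Countable := by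
  have h : {z : ℂ | z ≠ 0 ∧ theta p (z ^ 2) = 0} ⊆ ⋃ k : ℤ, {z : ℂ | z ^ 2 = p ^ k} := by
    rintro z ⟨hz, h⟩
    obtain ⟨k, hk⟩ := exists_zpow_of_theta_eq_zero hp0 hp (pow_ne_zero 2 hz) h
    exact mem_iUnion.2 ⟨k, hk⟩
  refine (countable_iUnion fun k => ?_).mono h
  by_cases hne : ({z : ℂ | z ^ 2 = p ^ k}).Nonempty
  · obtain ⟨w, hw⟩ := hne
    refine (Set.Finite.subset (Set.toFinite {w, -w}) fun z hz => ?_).countable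
    have : z ^ 2 = w ^ 2 := by rw [mem_ofPred_eq] at hz hw; rw [hz, hw]
    rcases sq_eq_sq_iff_eq_or_eq_neg.1 this with h | h <;> simp [h]
  · rw [not_nonempty_iff_eq_empty.1 hne]; exact countable_empty

lemma continuousAt_theta_comp (hp : ‖p‖ < 1) {X : Type*} [TopologicalSpace X] {f : X → ℂ} {x : X}
    (hf : ContinuousAt f x) (h : f x ≠ 0) : ContinuousAt (fun w => theta p (f w)) x :=
  ContinuousAt.comp (g := theta p) (theta_differentiableAt hp h).continuousAt hf

/-- The difference of the two sides of the three-term identity. -/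
noncomputable def threeTerm (p a c z x : ℂ) : ℂ :=
  theta p c * theta p (z ^ 2) * thetaPair p a c x
    - theta p (a * z) * theta p (a * c / z) * thetaPair p z c x
    + z ^ 2 * (theta p (a / z) * theta p (a * c * z)) * thetaPair p z⁻¹ c x

/-- In x, all three terms have the same multiplier and symmetry, so it suffices to see the sum
vanish at x = z and x = z⁻¹. At each of these one term contains θ(1) = 0 and the other two cancel.
-/
lemma threeTerm_eq_zero_of_ne (hp0 : p ≠ 0) (hp : ‖p‖ < 1) {a c z x : ℂ} (ha : a ≠ 0) (hc : c ≠ 0)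
    (hz : z ≠ 0) (hx : x ≠ 0) (h1 : theta p c ≠ 0) (h2 : theta p (c / z ^ 2) ≠ 0)
    (h3 : theta p (z ^ 2) ≠ 0) : threeTerm p a c z x = 0 := by
  have hz' := inv_ne_zero hz
  have hinv : theta p (z⁻¹ * z⁻¹) = -(z ^ 2)⁻¹ * theta p (z ^ 2) := by
    rw [← theta_inv hp (pow_ne_zero 2 hz)]; congr 1; field_simp
  refine eq_zero_of_two_zeros hp0 hp hc hz hz' (h := threeTerm p a c z) ?_ ?_ ?_ ?_ ?_ h2 ?_ hx
  · intro x hx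
    exact (((thetaPair_differentiableAt hp ha hc hx).const_mul _).sub
      ((thetaPair_differentiableAt hp hz hc hx).const_mul _)).add
      ((thetaPair_differentiableAt hp hz' hc hx).const_mul _)
  · intro x hx
    unfold threeTerm
    rw [thetaPair_mul_p hp0 hp ha hc hx, thetaPair_mul_p hp0 hp hz hc hx,
      thetaPair_mul_p hp0 hp hz' hc hx]
    ring
  · intro x hx
    unfold threeTerm
    rw [thetaPair_symm hc, thetaPair_symm hc, thetaPair_symm hc]
  · unfold threeTerm thetaPair
    rw [inv_mul_cancel₀ hz, theta_one hp, show z * c / z = c by field_simp,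
      show z * z = z ^ 2 by ring]
    ring
  · unfold threeTerm thetaPair
    rw [hinv, mul_inv_cancel₀ hz, theta_one hp, show z⁻¹ * c / z⁻¹ = c by field_simp,
      show a * z⁻¹ = a / z by ring, show a * c / z⁻¹ = a * c * z by field_simp]
    field_simp
    ring
  · unfold thetaPair
    rw [hinv, show z⁻¹ * c / z⁻¹ = c by field_simp]
    exact mul_ne_zero (mul_ne_zero (neg_ne_zero.2 (inv_ne_zero (pow_ne_zero 2 hz))) h3) h1

lemma continuousAt_threeTerm (hp : ‖p‖ < 1) {a c z x : ℂ} (ha : a ≠ 0) (hc : c ≠ 0) (hz : z ≠ 0)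
    (hx : x ≠ 0) :
    ContinuousAt (fun v : ℂ × ℂ => threeTerm p a v.1 v.2 x) (c, z) := by
  have e1 : ContinuousAt (fun v : ℂ × ℂ => v.1) (c, z) := continuousAt_fst
  have e2 : ContinuousAt (fun v : ℂ × ℂ => v.2) (c, z) := continuousAt_snd
  have e3 : ContinuousAt (fun v : ℂ × ℂ => v.2⁻¹) (c, z) := e2.inv₀ hz
  unfold threeTerm thetaPair
  refine ((ContinuousAt.mul (ContinuousAt.mul ?_ ?_) (ContinuousAt.mul ?_ ?_)).sub
    (ContinuousAt.mul (ContinuousAt.mul ?_ ?_) (ContinuousAt.mul ?_ ?_))).add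
    (ContinuousAt.mul (ContinuousAt.mul (e2.pow 2) (ContinuousAt.mul ?_ ?_))
      (ContinuousAt.mul ?_ ?_)) <;>
  refine continuousAt_theta_comp hp ?_ (by positivity)
  all_goals try simp only [div_eq_mul_inv]
  all_goals fun_prop (disch := assumption)

/-- The three-term relation for theta functions (Weierstrass addition formula). -/
lemma threeTerm_eq_zero (hp0 : p ≠ 0) (hp : ‖p‖ < 1) {a c z x : ℂ} (ha : a ≠ 0) (hc : c ≠ 0)
    (hz : z ≠ 0) (hx : x ≠ 0) : threeTerm p a c z x = 0 := by
  -- The exceptional values are removed first in c, with θ(z²) ≠ 0 held fixed, and then in z.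
  have step : ∀ z, z ≠ 0 → theta p (z ^ 2) ≠ 0 → threeTerm p a c z x = 0 := by
    intro z hz hz2
    have hS : ({w : ℂ | w ≠ 0 ∧ theta p w = 0} ∪
        {w : ℂ | w / z ^ 2 ≠ 0 ∧ theta p (w / z ^ 2) = 0}).Countable := by
      refine (countable_setOf_theta_eq_zero hp0 hp).union ?_
      exact (countable_setOf_theta_eq_zero hp0 hp).preimage
        fun u v h => div_left_inj' (pow_ne_zero 2 hz) |>.1 h
    refine eq_zero_of_eq_zero_off_countable (F := fun c => threeTerm p a c z x) hS ?_ hc ?_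
    · intro w hw hwS
      simp only [mem_union, mem_ofPred_eq, not_or, not_and] at hwS
      exact threeTerm_eq_zero_of_ne hp0 hp ha hw hz hx (hwS.1 hw)
        (hwS.2 (div_ne_zero hw (pow_ne_zero 2 hz))) hz2
    · exact ContinuousAt.comp (f := fun c : ℂ => (c, z)) (continuousAt_threeTerm hp ha hc hz hx)
        (by fun_prop)
  refine eq_zero_of_eq_zero_off_countable (F := fun z => threeTerm p a c z x)
    (countable_setOf_theta_sq_eq_zero hp0 hp) ?_ hz ?_
  · intro w hw hwS
    exact step w hw fun h => hwS ⟨hw, h⟩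
  · exact ContinuousAt.comp (f := fun z : ℂ => (c, z)) (continuousAt_threeTerm hp ha hc hz hx)
      (by fun_prop)

/-- The three-term relation in the form in which it enters the partial fraction identity. -/
lemma theta_three_term (hp0 : p ≠ 0) (hp : ‖p‖ < 1) {t₁ t₂ t₃ c z : ℂ} (h1 : t₁ ≠ 0) (h2 : t₂ ≠ 0)
    (h3 : t₃ ≠ 0) (hc : c ≠ 0) (hz : z ≠ 0) :
    theta p (t₁ / z) * theta p (t₁ * t₃ * c) * theta p (t₁ * t₂ * c) * theta p (t₁ * t₂ * t₃ * z)
      - theta p (t₁ * t₂ * t₃ * c * z) * theta p (t₁ * t₂) * theta p (t₁ * t₃) *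
        theta p (t₁ * c / z)
      = -(theta p c * theta p (t₁ * (t₁ * t₂ * t₃ * c)) * (t₁ / z) * theta p (t₂ * z) *
        theta p (t₃ * z)) := by
  -- A square root m of t₂t₃c makes the arguments match: with a = zm/c, z replaced by t₁m and x =
  -- t₂c/m, all products appearing in the addition formula become monomials free of m.
  obtain ⟨m, hm⟩ : ∃ m : ℂ, m ^ 2 = t₂ * t₃ * c := IsAlgClosed.exists_pow_nat_eq _ two_pos
  have hm0 : m ≠ 0 := by
    rintro rfl
    have : t₂ * t₃ * c ≠ 0 := by positivity
    exact this (by rw [← hm]; ring)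
  have H := threeTerm_eq_zero hp0 hp (a := z * m / c) (c := c) (z := t₁ * m) (x := t₂ * c / m)
    (by positivity) hc (by positivity) (by positivity)
  unfold threeTerm thetaPair at H
  have e1 : (t₁ * m) ^ 2 = t₁ * (t₁ * t₂ * t₃ * c) := by rw [mul_pow, hm]; ring
  have e2 : z * m / c * (t₂ * c / m) = t₂ * z := by field_simp
  have e3 : z * m / c * c / (t₂ * c / m) = t₃ * z := by
    field_simp; rw [hm]; ring
  have e4 : z * m / c * (t₁ * m) = t₁ * t₂ * t₃ * z := by
    field_simp; rw [hm]; ring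
  have e5 : z * m / c * c / (t₁ * m) = (t₁ / z)⁻¹ := by field_simp
  have e6 : t₁ * m * (t₂ * c / m) = t₁ * t₂ * c := by field_simp
  have e7 : t₁ * m * c / (t₂ * c / m) = t₁ * t₃ * c := by
    field_simp; rw [hm]; ring
  have e8 : z * m / c / (t₁ * m) = (t₁ * c / z)⁻¹ := by field_simp
  have e9 : z * m / c * c * (t₁ * m) = t₁ * t₂ * t₃ * c * z := by
    field_simp; rw [hm]; ring
  have e10 : (t₁ * m)⁻¹ * (t₂ * c / m) = (t₁ * t₃)⁻¹ := by
    field_simp; rw [hm]; ring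
  have e11 : (t₁ * m)⁻¹ * c / (t₂ * c / m) = (t₁ * t₂)⁻¹ := by field_simp
  rw [e1, e2, e3, e4, e5, e6, e7, e8, e9, e10, e11, theta_inv hp (by positivity),
    theta_inv hp (by positivity), theta_inv hp (by positivity), theta_inv hp (by positivity)] at H
  field_simp at H ⊢
  linear_combination H

/-- The difference of the two sides of the partial fraction identity. -/
noncomputable def partialFraction (p t₁ t₂ t₃ t₄ t₅ z A : ℂ) : ℂ :=
  theta p (z ^ 2) * (theta p (t₁ * z) * theta p (t₁ / z) *
      (theta p (A / t₂) * theta p (A / t₃) * theta p (A / t₄) * theta p (A / t₅))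
    - theta p (A * z) * theta p (A / z) *
      (theta p (t₁ * t₂) * theta p (t₁ * t₃) * theta p (t₁ * t₄) * theta p (t₁ * t₅)))
    - theta p (t₁ * A) * t₁ * (z ^ 3 * (theta p (t₁ / z) * theta p (t₂ / z) * theta p (t₃ / z) *
        theta p (t₄ / z) * theta p (t₅ / z)) * theta p (A * z)
      - z⁻¹ * (theta p (t₁ * z) * theta p (t₂ * z) * theta p (t₃ * z) *
        theta p (t₄ * z) * theta p (t₅ * z)) * theta p (A / z))

/-- Here t₄ = x, t₅ = c/x and A = t₁t₂t₃c. The extra factor θ(c) lets the addition formula expand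
the products θ(A/t₄)θ(A/t₅) (`T1`) and θ(t₁t₄)θ(t₁t₅) (`T2`) in the pairs based at z and z⁻¹;
comparing coefficients leaves one three-term relation for z and one for z⁻¹. -/
lemma theta_mul_partialFraction (hp0 : p ≠ 0) (hp : ‖p‖ < 1) {t₁ t₂ t₃ x c z : ℂ} (h1 : t₁ ≠ 0)
    (h2 : t₂ ≠ 0) (h3 : t₃ ≠ 0) (hx : x ≠ 0) (hc : c ≠ 0) (hz : z ≠ 0) :
    theta p c * partialFraction p t₁ t₂ t₃ x (c / x) z (t₁ * t₂ * t₃ * c) = 0 := by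
  have S1 := theta_three_term hp0 hp h1 h2 h3 hc hz
  have S2 := theta_three_term hp0 hp h1 h2 h3 hc (inv_ne_zero hz)
  have T1 := threeTerm_eq_zero hp0 hp (a := t₁ * t₂ * t₃) (by positivity) hc hz hx
  have T2 := threeTerm_eq_zero hp0 hp (a := t₁) h1 hc hz hx
  unfold threeTerm thetaPair at T1 T2
  simp only [div_inv_eq_mul] at S2
  simp only [← div_eq_mul_inv] at S2
  unfold partialFraction
  have e1 : t₁ * t₂ * t₃ * c / t₂ = t₁ * t₃ * c := by field_simp
  have e2 : t₁ * t₂ * t₃ * c / t₃ = t₁ * t₂ * c := by field_simp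
  have e3 : t₁ * t₂ * t₃ * c / (c / x) = t₁ * t₂ * t₃ * x := by field_simp
  have e4 : c / x / z = z⁻¹ * c / x := by field_simp
  have e5 : c / x * z = z * c / x := by field_simp
  have e6 : t₁ * (c / x) = t₁ * c / x := by field_simp
  have e7 : x / z = z⁻¹ * x := by field_simp
  have e8 : x * z = z * x := by ring
  rw [e1, e2, e3, e4, e5, e6, e7, e8]
  have i1 := mul_inv_cancel₀ hz
  simp only [div_eq_mul_inv] at *
  generalize theta p (t₁ * t₂ * t₃ * c * x⁻¹) = A1 at *
  generalize theta p (t₁ * t₂ * t₃ * x) = A2 at *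
  generalize theta p (t₁ * x) = A3 at *
  generalize theta p (t₁ * c * x⁻¹) = A4 at *
  generalize theta p (z * x) = A5 at *
  generalize theta p (z * c * x⁻¹) = A6 at *
  generalize theta p (z⁻¹ * x) = A7 at *
  generalize theta p (z⁻¹ * c * x⁻¹) = A8 at *
  generalize theta p (t₁ * t₂ * t₃ * c * z) = B1 at *
  generalize theta p (t₁ * t₂ * t₃ * c * z⁻¹) = B2 at *
  generalize theta p (t₁ * t₃ * c) = B3 at *
  generalize theta p (t₁ * t₂ * c) = B4 at *
  generalize theta p (t₁ * t₂) = B5 at *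
  generalize theta p (t₁ * t₃) = B6 at *
  generalize theta p (t₁ * z) = C1 at *
  generalize theta p (t₁ * z⁻¹) = C2 at *
  generalize theta p (t₁ * (t₁ * t₂ * t₃ * c)) = C3 at *
  generalize theta p (t₁ * c * z) = C4 at *
  generalize theta p (t₁ * c * z⁻¹) = C5 at *
  generalize theta p (t₁ * t₂ * t₃ * z) = C6 at *
  generalize theta p (t₁ * t₂ * t₃ * z⁻¹) = C7 at *
  linear_combination C1 * C2 * B3 * B4 * T1 - B1 * B2 * B5 * B6 * T2 +
    A5 * A6 * C1 * B2 * S1 - z ^ 2 * A7 * A8 * B1 * C2 * S2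

/-- The factor θ(t₄t₅) cancels where it is nonzero; continuity in t₅ gives the remaining values. -/
lemma partialFraction_eq_zero (hp0 : p ≠ 0) (hp : ‖p‖ < 1) {t₁ t₂ t₃ t₄ t₅ z : ℂ} (h1 : t₁ ≠ 0)
    (h2 : t₂ ≠ 0) (h3 : t₃ ≠ 0) (h4 : t₄ ≠ 0) (h5 : t₅ ≠ 0) (hz : z ≠ 0) :
    partialFraction p t₁ t₂ t₃ t₄ t₅ z (t₁ * t₂ * t₃ * t₄ * t₅) = 0 := by
  have hS : {w : ℂ | t₄ * w ≠ 0 ∧ theta p (t₄ * w) = 0}.Countable :=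
    (countable_setOf_theta_eq_zero hp0 hp).preimage (mul_right_injective₀ h4)
  refine eq_zero_of_eq_zero_off_countable (x := t₅) hS
    (F := fun x => partialFraction p t₁ t₂ t₃ t₄ x z (t₁ * t₂ * t₃ * t₄ * x)) ?_ h5 ?_
  · intro w hw hwS
    have := theta_mul_partialFraction hp0 hp h1 h2 h3 h4 (mul_ne_zero h4 hw) hz
    rw [mul_div_cancel_left₀ _ h4, ← mul_assoc] at this
    exact (mul_eq_zero.1 this).resolve_left fun h => hwS ⟨mul_ne_zero h4 hw, h⟩
  · have hi : ContinuousAt (fun x : ℂ => x⁻¹) t₅ := continuousAt_inv₀ h5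
    have key : ∀ f : ℂ → ℂ, ContinuousAt f t₅ → f t₅ ≠ 0 →
        ContinuousAt (fun x => theta p (f x)) t₅ := fun f hf h => continuousAt_theta_comp hp hf h
    unfold partialFraction
    have k1 := key (fun x => t₁ * t₂ * t₃ * t₄ * x / t₂) (by fun_prop) (by positivity)
    have k2 := key (fun x => t₁ * t₂ * t₃ * t₄ * x / t₃) (by fun_prop) (by positivity)
    have k3 := key (fun x => t₁ * t₂ * t₃ * t₄ * x / t₄) (by fun_prop) (by positivity)
    have k4 := key (fun x => t₁ * t₂ * t₃ * t₄ * x / x)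
      (by simp only [div_eq_mul_inv]; fun_prop) (by positivity)
    have k5 := key (fun x => t₁ * t₂ * t₃ * t₄ * x * z) (by fun_prop) (by positivity)
    have k6 := key (fun x => t₁ * t₂ * t₃ * t₄ * x / z) (by fun_prop) (by positivity)
    have k7 := key (fun x => t₁ * x) (by fun_prop) (by positivity)
    have k8 := key (fun x => t₁ * (t₁ * t₂ * t₃ * t₄ * x)) (by fun_prop) (by positivity)
    have k9 := key (fun x => x / z) (by fun_prop) (by positivity)
    have k10 := key (fun x => x * z) (by fun_prop) (by positivity)
    fun_prop

end ThetaIdentities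

/-! ### The elliptic gamma function on and inside the unit circle. -/

section EllGamma

variable {p q : ℂ}

lemma ellGamma_reflect (hp0 : p ≠ 0) (hq0 : q ≠ 0) (x : ℂ) :
    ellGamma p q (p * q * x⁻¹) = (ellGamma p q x)⁻¹ := by
  unfold ellGamma
  rw [inv_div, mul_inv, inv_inv, mul_inv_cancel_left₀ (mul_ne_zero hp0 hq0)]

lemma ellGamma_mul_reflect (hp0 : p ≠ 0) (hq0 : q ≠ 0) {x y : ℂ} (hx : x ≠ 0) (h : x * y = p * q) :
    ellGamma p q y = (ellGamma p q x)⁻¹ := by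
  rw [← ellGamma_reflect hp0 hq0, ← h]
  congr 1
  field_simp

lemma ellGamma_ne_zero (hp : ‖p‖ < 1) (hq : ‖q‖ < 1) {x : ℂ} (hx : ‖x‖ < 1)
    (hx' : ‖p * q‖ < ‖x‖) : ellGamma p q x ≠ 0 := by
  have hx0 : 0 < ‖x‖ := (norm_nonneg _).trans_lt hx'
  refine div_ne_zero (poch₂_ne_zero_of_norm_lt_one hp hq ?_) (poch₂_ne_zero_of_norm_lt_one hp hq hx)
  rw [norm_mul, norm_inv, ← div_eq_mul_inv, div_lt_one hx0]
  exact hx'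

lemma ellGamma_differentiableAt (hp : ‖p‖ < 1) (hq : ‖q‖ < 1) {x : ℂ} (hx0 : x ≠ 0)
    (hx : ‖x‖ < 1) : DifferentiableAt ℂ (ellGamma p q) x := by
  have h := poch₂_differentiable hp hq
  have h1 : DifferentiableAt ℂ (fun x : ℂ => p * q * x⁻¹) x :=
    (differentiableAt_inv hx0).const_mul _
  exact (DifferentiableAt.comp (g := fun z => poch₂ z p q) x (h _) h1).div (h x)
    (poch₂_ne_zero_of_norm_lt_one hp hq hx)

lemma differentiableAt_ellGamma_comp (hp : ‖p‖ < 1) (hq : ‖q‖ < 1) {f : ℂ → ℂ} {z : ℂ}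
    (hf : DifferentiableAt ℂ f z) (h0 : f z ≠ 0) (h1 : ‖f z‖ < 1) :
    DifferentiableAt ℂ (fun w => ellGamma p q (f w)) z :=
  DifferentiableAt.comp (g := ellGamma p q) z (ellGamma_differentiableAt hp hq h0 h1) hf

lemma continuousOn_ellGamma_comp (hp : ‖p‖ < 1) (hq : ‖q‖ < 1) {X : Type*} [TopologicalSpace X]
    {f : X → ℂ} {s : Set X} (hf : ContinuousOn f s) (h0 : ∀ x ∈ s, f x ≠ 0)
    (h1 : ∀ x ∈ s, ‖f x‖ < 1) : ContinuousOn (fun w => ellGamma p q (f w)) s := fun x hx =>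
  ContinuousAt.comp_continuousWithinAt (g := ellGamma p q)
    (ellGamma_differentiableAt hp hq (h0 x hx) (h1 x hx)).continuousAt (hf x hx)

lemma ellGamma_mul_q (hp0 : p ≠ 0) (hq0 : q ≠ 0) (hp : ‖p‖ < 1) (hq : ‖q‖ < 1) {x : ℂ}
    (hx : ‖x‖ < 1) :
    ellGamma p q (q * x) = theta p x * ellGamma p q x := by
  have h1 := poch₂_ne_zero_of_norm_lt_one hp hq hx
  have h2 := poch₂_step hp hq x
  rw [h2] at h1
  unfold ellGamma theta
  rw [show p * q * (q * x)⁻¹ = p * x⁻¹ by field_simp, poch₂_step hp hq (p * x⁻¹), h2,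
    mul_comm q x, show p * x⁻¹ * q = p * q * x⁻¹ by ring]
  have h3 := left_ne_zero_of_mul h1
  field_simp

/-- The weight `1 / Γ(z^{±2}; p, q)` written as a product of two theta functions. -/
noncomputable def weight (p q z : ℂ) : ℂ := theta p (z ^ 2) * theta q (z ^ 2)⁻¹

/-- The identity includes the poles at u = 1: there division by zero makes the left side 0, which is
the true value, since θ(1; p) = 0. -/
lemma inv_ellGamma_mul_ellGamma_inv (hp : ‖p‖ < 1) (hq : ‖q‖ < 1) {u : ℂ} (hu : ‖u‖ = 1) :
    (ellGamma p q u * ellGamma p q u⁻¹)⁻¹ = theta p u * theta q u⁻¹ := by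
  have hpq : ‖p * q‖ < 1 := by
    rw [norm_mul]; exact mul_lt_one_of_nonneg_of_lt_one_left (norm_nonneg _) hp hq.le
  have h1 : poch₂ (p * q * u⁻¹) p q ≠ 0 :=
    poch₂_ne_zero_of_norm_lt_one hp hq (by rwa [norm_mul, norm_inv, hu, inv_one, mul_one])
  have h2 : poch₂ (p * q * u) p q ≠ 0 :=
    poch₂_ne_zero_of_norm_lt_one hp hq (by rwa [norm_mul, hu, mul_one])
  have h3 : poch₂ u p q = poch u p * (poch (q * u) q * poch₂ (p * q * u) p q) := by
    rw [poch₂_step hp hq u, poch₂_step' hp hq (u * q), mul_comm u q]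
    congr 3; ring
  have h4 : poch₂ u⁻¹ p q = poch u⁻¹ q * (poch (p * u⁻¹) p * poch₂ (p * q * u⁻¹) p q) := by
    rw [poch₂_step' hp hq u⁻¹, poch₂_step hp hq (u⁻¹ * p), mul_comm u⁻¹ p]
    congr 3; ring
  unfold ellGamma theta
  rw [inv_inv, h3, h4, div_mul_div_comm, inv_div]
  clear h3 h4
  generalize poch₂ (p * q * u⁻¹) p q = a at *
  generalize poch₂ (p * q * u) p q = b at *
  rw [div_eq_iff (mul_ne_zero h1 h2)]
  ring

lemma inv_ellGamma_sq (hp : ‖p‖ < 1) (hq : ‖q‖ < 1) {z : ℂ} (hz : ‖z‖ = 1) :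
    (ellGamma p q (z ^ 2) * ellGamma p q (z ^ 2)⁻¹)⁻¹ = weight p q z :=
  inv_ellGamma_mul_ellGamma_inv hp hq (by rw [norm_pow, hz, one_pow])

lemma weight_differentiableAt (hp : ‖p‖ < 1) (hq : ‖q‖ < 1) {z : ℂ} (hz : z ≠ 0) :
    DifferentiableAt ℂ (weight p q) z := by
  have h1 : DifferentiableAt ℂ (fun z : ℂ => z ^ 2) z := by fun_prop
  have h2 : DifferentiableAt ℂ (fun z : ℂ => (z ^ 2)⁻¹) z := h1.inv (pow_ne_zero 2 hz)
  exact (differentiableAt_theta_comp hp h1 (pow_ne_zero 2 hz)).mul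
    (differentiableAt_theta_comp hq h2 (inv_ne_zero (pow_ne_zero 2 hz)))

/-- The function `(1 - x) Γ(x; p, q)`, which is regular at `x = 1`. -/
noncomputable def gammaReg (p q x : ℂ) : ℂ :=
  poch₂ (p * q * x⁻¹) p q / (poch (x * q) q * poch₂ (x * p) p q)

lemma ellGamma_eq_gammaReg_div (hp : ‖p‖ < 1) (hq : ‖q‖ < 1) (x : ℂ) :
    ellGamma p q x = gammaReg p q x / (1 - x) := by
  unfold ellGamma gammaReg
  rw [poch₂_step' hp hq x, poch_step hq x, div_div]
  congr 1; ring

lemma gammaReg_denom_ne_zero (hp : ‖p‖ < 1) (hq : ‖q‖ < 1) {x : ℂ} (hx : ‖x‖ ≤ 1) :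
    poch (x * q) q * poch₂ (x * p) p q ≠ 0 := by
  refine mul_ne_zero (poch_ne_zero_of_norm_lt_one hq ?_)
    (poch₂_ne_zero_of_norm_lt_one hp hq ?_) <;> rw [norm_mul]
  · exact mul_lt_one_of_nonneg_of_lt_one_right hx (norm_nonneg _) hq
  · exact mul_lt_one_of_nonneg_of_lt_one_right hx (norm_nonneg _) hp

lemma gammaReg_continuousAt (hp : ‖p‖ < 1) (hq : ‖q‖ < 1) {x : ℂ} (hx0 : x ≠ 0) (hx : ‖x‖ ≤ 1) :
    ContinuousAt (gammaReg p q) x := by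
  have h := (poch₂_differentiable hp hq).continuous
  have h' := (poch_differentiable hq).continuous
  have h1 : ContinuousAt (fun x : ℂ => p * q * x⁻¹) x :=
    continuousAt_const.mul (continuousAt_inv₀ hx0)
  refine ContinuousAt.div (ContinuousAt.comp (g := fun z => poch₂ z p q) h.continuousAt h1)
    (Continuous.continuousAt ?_) (gammaReg_denom_ne_zero hp hq hx)
  exact (h'.comp (continuous_mul_const q)).mul (h.comp (continuous_mul_const p))

/-- This is the residue constant of Γ at 1, the source of (p;p)_∞ (q;q)_∞ in the normalization of
M(t). -/
lemma gammaReg_one (hp : ‖p‖ < 1) (hq : ‖q‖ < 1) :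
    gammaReg p q 1 = (poch p p * poch q q)⁻¹ := by
  have hpq : ‖p * q‖ < 1 := by
    rw [norm_mul]; exact mul_lt_one_of_nonneg_of_lt_one_left (norm_nonneg _) hp hq.le
  have h1 := poch₂_ne_zero_of_norm_lt_one hp hq hpq
  unfold gammaReg
  rw [inv_one, mul_one, one_mul, one_mul, poch₂_step hp hq p]
  field_simp

end EllGamma

/-! ### Rotation, scaling and inversion in integrals against dz/z. -/

section CircleIntegrals

lemma circleIntegral_div_eq (F : ℂ → ℂ) {R : ℝ} (hR : R ≠ 0) :
    (∮ z in C(0, R), F z / z) = I * ∫ θ in (0 : ℝ)..2 * Real.pi, F (circleMap 0 R θ) := by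
  rw [circleIntegral, ← intervalIntegral.integral_const_mul]
  refine intervalIntegral.integral_congr fun θ _ => ?_
  have : circleMap 0 R θ ≠ 0 := circleMap_ne_center hR
  simp only [deriv_circleMap, smul_eq_mul]
  field_simp

/-- In the angle, multiplication by c is a change of radius and a translation by arg c, absorbed by
periodicity. -/
lemma circleIntegral_mul_left_div (F : ℂ → ℂ) {c : ℂ} (hc : c ≠ 0) :
    (∮ z in C(0, 1), F (c * z) / z) = ∮ z in C(0, ‖c‖), F z / z := by
  rw [circleIntegral_div_eq (fun z => F (c * z)) one_ne_zero,
    circleIntegral_div_eq F (norm_ne_zero_iff.2 hc)]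
  congr 1
  have h1 : ∀ θ : ℝ, c * circleMap 0 1 θ = circleMap 0 ‖c‖ (θ + arg c) := by
    intro θ
    conv_lhs => rw [← Complex.norm_mul_exp_arg_mul_I c]
    simp only [circleMap, zero_add, ofReal_one, one_mul, ofReal_add, add_mul, Complex.exp_add]
    ring
  simp only [h1]
  rw [intervalIntegral.integral_comp_add_right (fun θ => F (circleMap 0 ‖c‖ θ))]
  have hp : Function.Periodic (fun θ => F (circleMap 0 ‖c‖ θ)) (2 * Real.pi) := fun θ => by
    simp only [periodic_circleMap 0 ‖c‖ θ]
  have := hp.intervalIntegral_add_eq (arg c) 0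
  rw [zero_add] at this ⊢
  rw [← this, add_comm]

lemma circleIntegral_inv_div (F : ℂ → ℂ) :
    (∮ z in C(0, 1), F z⁻¹ / z) = ∮ z in C(0, 1), F z / z := by
  rw [circleIntegral_div_eq (fun z => F z⁻¹) one_ne_zero, circleIntegral_div_eq F one_ne_zero]
  congr 1
  have h1 : ∀ θ : ℝ, (circleMap 0 1 θ)⁻¹ = circleMap 0 1 (-θ) := by
    intro θ
    simp [circleMap, ← Complex.exp_neg]
  simp only [h1]
  rw [intervalIntegral.integral_comp_neg (fun θ => F (circleMap 0 1 θ))]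
  have hp : Function.Periodic (fun θ => F (circleMap 0 1 θ)) (2 * Real.pi) := fun θ => by
    simp only [periodic_circleMap 0 1 θ]
  have := hp.intervalIntegral_add_eq (-(2 * Real.pi)) 0
  rw [zero_add, neg_add_cancel] at this
  rw [← this, neg_zero]

end CircleIntegrals

/-! ### The elliptic beta integral and its q-difference equation. -/

section BetaIntegral

variable {p q : ℂ}

/-- The integrand `∏ⱼ Γ(τⱼ z^{±1}) / Γ(z^{±2})` of the elliptic beta integral with respect to
`dz / z`. -/
noncomputable def betaKernel (p q : ℂ) (τ : Fin 6 → ℂ) (z : ℂ) : ℂ :=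
  (∏ j, (ellGamma p q (τ j * z) * ellGamma p q (τ j * z⁻¹))) * weight p q z

/-- The elliptic beta integral without its normalizing factor. -/
noncomputable def betaIntegral (p q : ℂ) (τ : Fin 6 → ℂ) : ℂ :=
  ∮ z in C(0, 1), betaKernel p q τ z / z

/-- The product `∏_{i < j} Γ(τᵢ τⱼ)`. -/
noncomputable def betaProd (p q : ℂ) (τ : Fin 6 → ℂ) : ℂ :=
  ∏ i, ∏ j, if i < j then ellGamma p q (τ i * τ j) else 1

/-- The parameters satisfy the balancing condition and lie in the unit disc. -/
structure Balanced (p q : ℂ) (τ : Fin 6 → ℂ) : Prop where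
  prod_eq : ∏ j, τ j = p * q
  norm_lt : ∀ j, ‖τ j‖ < 1

lemma norm_mul_lt_one {a b : ℂ} (ha : ‖a‖ < 1) (hb : ‖b‖ ≤ 1) : ‖a * b‖ < 1 := by
  rw [norm_mul]; exact mul_lt_one_of_nonneg_of_lt_one_left (norm_nonneg _) ha hb

lemma Balanced.ne_zero (hp0 : p ≠ 0) (hq0 : q ≠ 0) {τ : Fin 6 → ℂ} (h : Balanced p q τ) (j : Fin 6) :
    τ j ≠ 0 := by
  intro hj
  have := Finset.prod_eq_zero (Finset.mem_univ j) hj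
  rw [h.prod_eq] at this
  exact mul_ne_zero hp0 hq0 this

/-- The other four parameters have product of modulus below 1. The bound keeps τᵢτⱼ away from the
zeros of Γ. -/
lemma Balanced.norm_lt_mul (hp0 : p ≠ 0) (hq0 : q ≠ 0) {τ : Fin 6 → ℂ} (h : Balanced p q τ)
    {i j : Fin 6} (hij : i ≠ j) : ‖p * q‖ < ‖τ i * τ j‖ := by
  have h1 : τ i * τ j * ∏ k ∈ (Finset.univ.erase i).erase j, τ k = p * q := by
    rw [← h.prod_eq, mul_assoc, Finset.mul_prod_erase _ _ (by simp [hij.symm]),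
      Finset.mul_prod_erase _ _ (Finset.mem_univ i)]
  have hne : ((Finset.univ.erase i).erase j).Nonempty := by
    rw [← Finset.card_pos, Finset.card_erase_of_mem (by simp [hij.symm]),
      Finset.card_erase_of_mem (Finset.mem_univ i)]
    simp
  rw [← h1, norm_mul (τ i * τ j), norm_prod]
  refine mul_lt_of_lt_one_right
    (norm_pos_iff.2 (mul_ne_zero (h.ne_zero hp0 hq0 i) (h.ne_zero hp0 hq0 j))) ?_
  have := Finset.prod_lt_prod_of_nonempty (s := (Finset.univ.erase i).erase j)
    (f := fun k => ‖τ k‖) (g := fun _ => 1)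
    (fun k _ => norm_pos_iff.2 (h.ne_zero hp0 hq0 k)) (fun k _ => h.norm_lt k) hne
  simpa using this

lemma Balanced.betaProd_ne_zero (hp0 : p ≠ 0) (hq0 : q ≠ 0) (hp : ‖p‖ < 1) (hq : ‖q‖ < 1)
    {τ : Fin 6 → ℂ} (h : Balanced p q τ) : betaProd p q τ ≠ 0 := by
  refine Finset.prod_ne_zero_iff.2 fun i _ => Finset.prod_ne_zero_iff.2 fun j _ => ?_
  split_ifs with hij
  · exact ellGamma_ne_zero hp hq (norm_mul_lt_one (h.norm_lt i) (h.norm_lt j).le)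
      (h.norm_lt_mul hp0 hq0 hij.ne)
  · exact one_ne_zero

/-- The auxiliary function of the telescoping argument. -/
noncomputable def telescope (p q b : ℂ) (t : Fin 5 → ℂ) (z : ℂ) : ℂ :=
  z⁻¹ * theta q (z ^ 2)⁻¹ * (∏ j, (ellGamma p q (q * (t j * z)) * ellGamma p q (t j * z⁻¹))) *
    (ellGamma p q (b * z) * ellGamma p q (b / q * z⁻¹))

lemma telescope_reflect (hq0 : q ≠ 0) (hq : ‖q‖ < 1) (b : ℂ) (t : Fin 5 → ℂ) {z : ℂ}
    (hz : z ≠ 0) : telescope p q b t (q * z)⁻¹ = -telescope p q b t z := by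
  unfold telescope
  have hz2 : z ^ 2 ≠ 0 := pow_ne_zero 2 hz
  have h1 : theta q (((q * z)⁻¹ ^ 2)⁻¹) = -(q * z ^ 2)⁻¹ * (-(z ^ 2)⁻¹ * theta q (z ^ 2)) := by
    rw [← theta_mul_q hq0 hq hz2, ← theta_mul_q hq0 hq (mul_ne_zero hq0 hz2)]
    congr 1; field_simp
  have h2 : ∀ j, ellGamma p q (q * (t j * (q * z)⁻¹)) * ellGamma p q (t j * (q * z)⁻¹⁻¹) =
      ellGamma p q (q * (t j * z)) * ellGamma p q (t j * z⁻¹) := by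
    intro j
    rw [mul_comm]
    congr 2
    · rw [inv_inv]; ring
    · field_simp
  rw [h1, theta_inv hq hz2, Finset.prod_congr rfl fun j _ => h2 j, inv_inv,
    show b * (q * z)⁻¹ = b / q * z⁻¹ by field_simp, show b / q * (q * z) = b * z by field_simp]
  field_simp

lemma telescope_differentiableAt (hq0 : q ≠ 0) (hp : ‖p‖ < 1) (hq : ‖q‖ < 1)
    {b : ℂ} {t : Fin 5 → ℂ} (hb0 : b ≠ 0) (ht0 : ∀ j, t j ≠ 0) (hb : ‖b‖ < ‖q‖)
    (ht : ∀ j, ‖t j‖ < 1) {z : ℂ} (hz1 : 1 ≤ ‖z‖) (hz2 : ‖z‖ ≤ ‖q‖⁻¹) :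
    DifferentiableAt ℂ (telescope p q b t) z := by
  have hq1 : 0 < ‖q‖ := norm_pos_iff.2 hq0
  have hz : z ≠ 0 := norm_pos_iff.1 (by linarith)
  have hqz : ‖q * z‖ ≤ 1 := by
    rw [norm_mul]
    calc ‖q‖ * ‖z‖ ≤ ‖q‖ * ‖q‖⁻¹ := by gcongr
      _ = 1 := mul_inv_cancel₀ hq1.ne'
  have hzi : ‖z⁻¹‖ ≤ 1 := by rw [norm_inv]; exact inv_le_one_of_one_le₀ hz1
  have hbq : ‖b / q‖ < 1 := by rw [norm_div, div_lt_one hq1]; exact hb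
  have hinv : DifferentiableAt ℂ (fun z : ℂ => z⁻¹) z := differentiableAt_inv hz
  have hsq : DifferentiableAt ℂ (fun z : ℂ => (z ^ 2)⁻¹) z :=
    (differentiableAt_pow 2).inv (pow_ne_zero 2 hz)
  unfold telescope
  refine (hinv.mul (differentiableAt_theta_comp hq hsq (inv_ne_zero (pow_ne_zero 2 hz)))).mul
    (DifferentiableAt.fun_finsetProd fun j _ => ?_) |>.mul ?_
  · refine (differentiableAt_ellGamma_comp hp hq (by fun_prop) ?_ ?_).mul
      (differentiableAt_ellGamma_comp hp hq (by fun_prop (disch := assumption)) ?_ ?_)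
    · exact mul_ne_zero hq0 (mul_ne_zero (ht0 j) hz)
    · rw [mul_left_comm]; exact norm_mul_lt_one (ht j) hqz
    · exact mul_ne_zero (ht0 j) (inv_ne_zero hz)
    · exact norm_mul_lt_one (ht j) hzi
  · refine (differentiableAt_ellGamma_comp hp hq (by fun_prop) ?_ ?_).mul
      (differentiableAt_ellGamma_comp hp hq (by fun_prop (disch := assumption)) ?_ ?_)
    · exact mul_ne_zero hb0 hz
    · rw [show b * z = b / q * (q * z) by field_simp]; exact norm_mul_lt_one hbq hqz
    · exact mul_ne_zero (div_ne_zero hb0 hq0) (inv_ne_zero hz)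
    · exact norm_mul_lt_one hbq hzi

/-- The integrand is holomorphic on 1 ≤ |z| ≤ |q|⁻¹, so the contour can be moved to |z| = |q|⁻¹. The
reflection z ↦ 1/(qz) carries that circle back to the unit circle and changes the sign of G, so the
integral equals its own negative. -/
lemma circleIntegral_telescope (hq0 : q ≠ 0) (hp : ‖p‖ < 1) (hq : ‖q‖ < 1)
    {b : ℂ} {t : Fin 5 → ℂ} (hb0 : b ≠ 0) (ht0 : ∀ j, t j ≠ 0) (hb : ‖b‖ < ‖q‖)
    (ht : ∀ j, ‖t j‖ < 1) : (∮ z in C(0, 1), telescope p q b t z / z) = 0 := by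
  set G := telescope p q b t with hG
  have hq1 : 0 < ‖q‖ := norm_pos_iff.2 hq0
  have e1 : (∮ z in C(0, 1), G z / z) = ∮ z in C(0, ‖q⁻¹‖), G z / z := by
    rw [norm_inv]
    have hd : ∀ z : ℂ, 1 ≤ ‖z‖ → ‖z‖ ≤ ‖q‖⁻¹ → DifferentiableAt ℂ (fun z => G z / z) z :=
      fun z h1 h2 => (telescope_differentiableAt hq0 hp hq hb0 ht0 hb ht h1 h2).div
        differentiableAt_id (norm_pos_iff.1 (by linarith))
    refine (circleIntegral_eq_of_differentiable_on_annulus_off_countable one_pos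
      (one_le_inv₀ hq1 |>.2 hq.le) countable_empty (fun z hz => ?_) fun z hz => ?_).symm
    · simp only [Set.mem_sdiff, Metric.mem_closedBall, Metric.mem_ball, dist_zero_right, not_lt] at hz
      exact (hd z hz.2 hz.1).continuousAt.continuousWithinAt
    · simp only [Set.mem_sdiff, Metric.mem_closedBall, Metric.mem_ball, dist_zero_right, not_le] at hz
      exact hd z hz.1.2.le hz.1.1.le
  have e2 : (∮ z in C(0, 1), G z / z) = -∮ z in C(0, 1), G (q⁻¹ * z) / z := by
    rw [← circleIntegral_inv_div (fun z => G (q⁻¹ * z)), ← neg_one_mul,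
      ← circleIntegral.integral_const_mul]
    refine circleIntegral.integral_congr zero_le_one fun z hz => ?_
    have hz0 : z ≠ 0 := by rintro rfl; simp at hz
    have h := telescope_reflect (p := p) hq0 hq b t hz0
    rw [← mul_inv, hG, h]
    ring
  rw [circleIntegral_mul_left_div G (inv_ne_zero hq0), ← e1] at e2
  linear_combination (1 / 2 : ℂ) * e2

lemma betaKernel_continuousOn (hp : ‖p‖ < 1) (hq : ‖q‖ < 1) {X : Type*} [TopologicalSpace X]
    {s : Set X} {τ : X → Fin 6 → ℂ} {z : X → ℂ} (hτ : ∀ j, ContinuousOn (fun x => τ x j) s)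
    (hz : ContinuousOn z s) (h0 : ∀ x ∈ s, ∀ j, τ x j ≠ 0) (h1 : ∀ x ∈ s, ∀ j, ‖τ x j‖ < 1)
    (hz1 : ∀ x ∈ s, ‖z x‖ = 1) : ContinuousOn (fun x => betaKernel p q (τ x) (z x)) s := by
  have hz0 : ∀ x ∈ s, z x ≠ 0 := fun x hx => norm_pos_iff.1 (by rw [hz1 x hx]; exact one_pos)
  unfold betaKernel
  refine (continuousOn_finsetProd _ fun j _ => ?_).mul fun x hx =>
    ContinuousAt.comp_continuousWithinAt (g := weight p q)
      (weight_differentiableAt hp hq (hz0 x hx)).continuousAt (hz x hx)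
  refine (continuousOn_ellGamma_comp hp hq ((hτ j).mul hz) ?_ ?_).mul
    (continuousOn_ellGamma_comp hp hq ((hτ j).mul (hz.inv₀ hz0)) ?_ ?_)
  · exact fun x hx => mul_ne_zero (h0 x hx j) (hz0 x hx)
  · exact fun x hx => norm_mul_lt_one (h1 x hx j) (hz1 x hx).le
  · exact fun x hx => mul_ne_zero (h0 x hx j) (inv_ne_zero (hz0 x hx))
  · exact fun x hx => norm_mul_lt_one (h1 x hx j) (by rw [norm_inv, hz1 x hx, inv_one])

lemma betaKernel_circleIntegrable (hp : ‖p‖ < 1) (hq : ‖q‖ < 1) {τ : Fin 6 → ℂ}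
    (h0 : ∀ j, τ j ≠ 0) (h1 : ∀ j, ‖τ j‖ < 1) :
    CircleIntegrable (fun z => betaKernel p q τ z / z) 0 1 := by
  refine ContinuousOn.circleIntegrable zero_le_one ?_
  have hz : ∀ z ∈ Metric.sphere (0 : ℂ) 1, ‖z‖ = 1 := fun z hz => by simpa using hz
  have hk : ContinuousOn (fun z => betaKernel p q τ z) (Metric.sphere 0 1) :=
    betaKernel_continuousOn hp hq (τ := fun _ => τ) (z := fun z => z)
      (fun j => continuousOn_const) continuousOn_id (fun _ _ => h0) (fun _ _ => h1) hz
  exact hk.div continuousOn_id fun z h => norm_pos_iff.1 (by rw [hz z h]; exact one_pos)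

/-- By Γ(qx) = θ(x; p)Γ(x) all terms share the same gamma factors. Balancing gives b/q = p/A, so the
remaining theta factors form `partialFraction` for the parameters a, c, d, e, f with product A. -/
lemma betaKernel_shift_sub (hp0 : p ≠ 0) (hq0 : q ≠ 0) (hp : ‖p‖ < 1) (hq : ‖q‖ < 1)
    {a b c d e f A : ℂ} (h : Balanced p q ![a, b, c, d, e, f]) (hb : ‖b‖ < ‖q‖)
    (hA : A = a * c * d * e * f) {z : ℂ} (hz : ‖z‖ = 1) :
    betaKernel p q ![q * a, b / q, c, d, e, f] z *
        (theta p (A / c) * theta p (A / d) * theta p (A / e) * theta p (A / f)) -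
      betaKernel p q ![a, b, c, d, e, f] z *
        (theta p (a * c) * theta p (a * d) * theta p (a * e) * theta p (a * f)) =
      -(theta p (a * A) * a) * (telescope p q b ![a, c, d, e, f] z +
        telescope p q b ![a, c, d, e, f] z⁻¹) := by
  have hz0 : z ≠ 0 := norm_pos_iff.1 (by rw [hz]; exact one_pos)
  have hzi : ‖z⁻¹‖ = 1 := by rw [norm_inv, hz, inv_one]
  have hq1 : 0 < ‖q‖ := norm_pos_iff.2 hq0
  have n := h.norm_lt
  have n0 := h.ne_zero hp0 hq0
  simp only [Fin.forall_fin_succ, Matrix.cons_val_zero, Matrix.cons_val_succ,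
    IsEmpty.forall_iff, and_true] at n n0
  obtain ⟨na, nb, nc, nd, ne, nf⟩ := n
  obtain ⟨a0, b0, c0, d0, e0, f0⟩ := n0
  have hprod := h.prod_eq
  simp [Fin.prod_univ_six] at hprod
  have hbA : b / q = p / A := by
    have : A ≠ 0 := by rw [hA]; positivity
    rw [div_eq_div_iff hq0 this, hA]
    linear_combination hprod
  have hA0 : A ≠ 0 := by rw [hA]; positivity
  have hbq : ‖b / q‖ < 1 := by rw [norm_div, div_lt_one hq1]; exact hb
  have g1 : ∀ t : ℂ, ‖t‖ < 1 → ellGamma p q (q * (t * z)) =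
      theta p (t * z) * ellGamma p q (t * z) := fun t ht =>
    ellGamma_mul_q hp0 hq0 hp hq (norm_mul_lt_one ht hz.le)
  have g2 : ∀ t : ℂ, ‖t‖ < 1 → ellGamma p q (q * (t * z⁻¹)) =
      theta p (t * z⁻¹) * ellGamma p q (t * z⁻¹) := fun t ht =>
    ellGamma_mul_q hp0 hq0 hp hq (norm_mul_lt_one ht hzi.le)
  have k1 : ellGamma p q (b * z) = theta p (A * z⁻¹) * ellGamma p q (b / q * z) := by
    have := g1 _ hbq
    rw [show q * (b / q * z) = b * z by field_simp] at this
    rw [this, ← theta_q_div hp0 (A * z⁻¹)]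
    congr 2
    rw [hbA]; field_simp
  have k2 : ellGamma p q (b * z⁻¹) = theta p (A * z) * ellGamma p q (b / q * z⁻¹) := by
    have := g2 _ hbq
    rw [show q * (b / q * z⁻¹) = b * z⁻¹ by field_simp] at this
    rw [this, ← theta_q_div hp0 (A * z)]
    congr 2
    rw [hbA]; field_simp
  have H := partialFraction_eq_zero hp0 hp a0 c0 d0 e0 f0 hz0
  rw [← hA] at H
  have hW := theta_inv hq (pow_ne_zero 2 hz0)
  have hW' : theta q (z ^ 2) = -z ^ 2 * theta q (z ^ 2)⁻¹ := by
    rw [hW]; field_simp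
  unfold betaKernel telescope weight
  unfold partialFraction at H
  simp only [Fin.prod_univ_six, Fin.prod_univ_five, Matrix.cons_val]
  rw [inv_inv, inv_pow, inv_inv, hW', mul_assoc q a z, mul_assoc q a z⁻¹, g1 a na, g2 a na, k1, k2,
    g1 c nc, g2 c nc, g1 d nd, g2 d nd, g1 e ne, g2 e ne, g1 f nf, g2 f nf]
  simp only [div_eq_mul_inv _ z] at H
  have i1 := mul_inv_cancel₀ hz0
  generalize theta q (z ^ 2)⁻¹ = W at *
  linear_combination ellGamma p q (a * z) * ellGamma p q (a * z⁻¹) *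
    (ellGamma p q (b / q * z) * ellGamma p q (b / q * z⁻¹)) *
    (ellGamma p q (c * z) * ellGamma p q (c * z⁻¹)) *
    (ellGamma p q (d * z) * ellGamma p q (d * z⁻¹)) *
    (ellGamma p q (e * z) * ellGamma p q (e * z⁻¹)) *
    (ellGamma p q (f * z) * ellGamma p q (f * z⁻¹)) * W * H

lemma betaProd_shift (hp0 : p ≠ 0) (hq0 : q ≠ 0) (hp : ‖p‖ < 1) (hq : ‖q‖ < 1)
    {a b c d e f A : ℂ} (h : Balanced p q ![a, b, c, d, e, f]) (hb : ‖b‖ < ‖q‖)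
    (hA : A = a * c * d * e * f) :
    betaProd p q ![q * a, b / q, c, d, e, f] *
        (theta p (A / c) * theta p (A / d) * theta p (A / e) * theta p (A / f)) =
      betaProd p q ![a, b, c, d, e, f] *
        (theta p (a * c) * theta p (a * d) * theta p (a * e) * theta p (a * f)) := by
  have hq1 : 0 < ‖q‖ := norm_pos_iff.2 hq0
  have n := h.norm_lt
  have n0 := h.ne_zero hp0 hq0
  simp only [Fin.forall_fin_succ, Matrix.cons_val_zero, Matrix.cons_val_succ,
    IsEmpty.forall_iff, and_true] at n n0
  obtain ⟨na, nb, nc, nd, ne, nf⟩ := n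
  obtain ⟨a0, b0, c0, d0, e0, f0⟩ := n0
  have hprod := h.prod_eq
  simp [Fin.prod_univ_six] at hprod
  have hA0 : A ≠ 0 := by rw [hA]; positivity
  have hbA : b / q = p / A := by
    rw [div_eq_div_iff hq0 hA0, hA]
    linear_combination hprod
  have hbq : ‖b / q‖ < 1 := by rw [norm_div, div_lt_one hq1]; exact hb
  have g1 : ∀ t : ℂ, ‖t‖ < 1 → ellGamma p q (q * a * t) =
      theta p (a * t) * ellGamma p q (a * t) := fun t ht => by
    rw [mul_assoc]
    exact ellGamma_mul_q hp0 hq0 hp hq (norm_mul_lt_one na ht.le)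
  have g2 : ∀ t : ℂ, t ≠ 0 → ‖t‖ < 1 → ellGamma p q (b * t) =
      theta p (A / t) * ellGamma p q (b / q * t) := fun t ht0 ht => by
    have := ellGamma_mul_q hp0 hq0 hp hq (norm_mul_lt_one hbq ht.le)
    rw [show q * (b / q * t) = b * t by field_simp] at this
    rw [this, ← theta_q_div hp0 (A / t)]
    congr 2
    rw [hbA]; field_simp
  unfold betaProd
  simp [Fin.prod_univ_six]
  rw [g1 c nc, g1 d nd, g1 e ne, g1 f nf, g2 c c0 nc, g2 d d0 nd, g2 e e0 ne, g2 f f0 nf,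
    show q * a * (b / q) = a * b by field_simp]
  ring

/-- The elliptic beta integral divided by the product `∏_{i < j} Γ(τᵢ τⱼ)`. -/
noncomputable def betaRatio (p q : ℂ) (τ : Fin 6 → ℂ) : ℂ := betaIntegral p q τ / betaProd p q τ

/-- Integral and product obey the same relation with coefficients X and Y; the one for the integral
comes from integrating `betaKernel_shift_sub`, whose right side integrates to zero. -/
lemma betaRatio_shift (hp0 : p ≠ 0) (hq0 : q ≠ 0) (hp : ‖p‖ < 1) (hq : ‖q‖ < 1)
    {a b c d e f : ℂ} (h : Balanced p q ![a, b, c, d, e, f])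
    (h' : Balanced p q ![q * a, b / q, c, d, e, f]) :
    betaRatio p q ![q * a, b / q, c, d, e, f] = betaRatio p q ![a, b, c, d, e, f] := by
  have hq1 : 0 < ‖q‖ := norm_pos_iff.2 hq0
  have hb : ‖b‖ < ‖q‖ := by
    have := h'.norm_lt 1
    simpa [norm_div, div_lt_one hq1] using this
  obtain ⟨A, hA⟩ : ∃ A, A = a * c * d * e * f := ⟨_, rfl⟩
  have hN := betaProd_shift hp0 hq0 hp hq h hb hA
  set X := theta p (A / c) * theta p (A / d) * theta p (A / e) * theta p (A / f) with hX
  set Y := theta p (a * c) * theta p (a * d) * theta p (a * e) * theta p (a * f) with hY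
  have hI : betaIntegral p q ![q * a, b / q, c, d, e, f] * X =
      betaIntegral p q ![a, b, c, d, e, f] * Y := by
    rw [← sub_eq_zero]
    unfold betaIntegral
    rw [mul_comm _ X, mul_comm _ Y, ← circleIntegral.integral_const_mul,
      ← circleIntegral.integral_const_mul, ← circleIntegral.integral_sub]
    rotate_left
    · exact (betaKernel_circleIntegrable hp hq (h'.ne_zero hp0 hq0) h'.norm_lt).const_smul (a := X)
    · exact (betaKernel_circleIntegrable hp hq (h.ne_zero hp0 hq0) h.norm_lt).const_smul (a := Y)
    have ht0 : ∀ j, (![a, c, d, e, f] : Fin 5 → ℂ) j ≠ 0 := by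
      have := h.ne_zero hp0 hq0
      simp [Fin.forall_fin_succ] at this ⊢
      tauto
    have ht1 : ∀ j, ‖(![a, c, d, e, f] : Fin 5 → ℂ) j‖ < 1 := by
      have := h.norm_lt
      simp [Fin.forall_fin_succ] at this ⊢
      tauto
    have hb0 : b ≠ 0 := h.ne_zero hp0 hq0 1
    have hT := circleIntegral_telescope hq0 hp hq hb0 ht0 hb ht1
    have hT' := circleIntegral_inv_div (telescope p q b ![a, c, d, e, f])
    rw [hT] at hT'
    have hG : CircleIntegrable (fun z => telescope p q b ![a, c, d, e, f] z / z) 0 1 := by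
      refine ContinuousOn.circleIntegrable zero_le_one fun z hz => ?_
      have hz1 : ‖z‖ = 1 := by simpa using hz
      exact ((telescope_differentiableAt hq0 hp hq hb0 ht0 hb ht1 hz1.ge
        (by rw [hz1]; exact one_le_inv₀ hq1 |>.2 hq.le)).continuousAt.div continuousAt_id
        (norm_pos_iff.1 (by rw [id, hz1]; exact one_pos))).continuousWithinAt
    have hG' : CircleIntegrable (fun z => telescope p q b ![a, c, d, e, f] z⁻¹ / z) 0 1 := by
      refine ContinuousOn.circleIntegrable zero_le_one fun z hz => ?_
      have hz1 : ‖z‖ = 1 := by simpa using hz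
      have hz0 : z ≠ 0 := norm_pos_iff.1 (by rw [hz1]; exact one_pos)
      have hzi : ‖z⁻¹‖ = 1 := by rw [norm_inv, hz1, inv_one]
      have c1 := (telescope_differentiableAt hq0 hp hq hb0 ht0 hb ht1 hzi.ge
        (by rw [hzi]; exact one_le_inv₀ hq1 |>.2 hq.le)).continuousAt
      exact ((ContinuousAt.comp (f := fun z : ℂ => z⁻¹) c1 (continuousAt_inv₀ hz0)).div
        continuousAt_id hz0).continuousWithinAt
    calc _ = ∮ z in C(0, 1), -(theta p (a * A) * a) *
          (telescope p q b ![a, c, d, e, f] z / z + telescope p q b ![a, c, d, e, f] z⁻¹ / z) := by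
          refine circleIntegral.integral_congr zero_le_one fun z hz => ?_
          have := betaKernel_shift_sub hp0 hq0 hp hq h hb hA (z := z) (by simpa using hz)
          linear_combination z⁻¹ * this
      _ = 0 := by
          rw [circleIntegral.integral_const_mul, circleIntegral.integral_add hG hG', hT, hT']
          ring
  have hN1 := h.betaProd_ne_zero hp0 hq0 hp hq
  have hN2 := h'.betaProd_ne_zero hp0 hq0 hp hq
  have hX0 : X ≠ 0 := by
    have b0 := h.ne_zero hp0 hq0 1
    have hA0 : A ≠ 0 := by
      have := h.ne_zero hp0 hq0
      simp [Fin.forall_fin_succ] at this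
      rw [hA]; simp; tauto
    have hprod := h.prod_eq
    simp [Fin.prod_univ_six] at hprod
    -- Since (A/x)(bx/q) = p with the second factor inside the unit disc, |p| < |A/x| < 1, an
    -- annulus on which θ(·; p) has no zeros.
    have key : ∀ x : ℂ, x ≠ 0 → ‖x‖ < 1 → ‖A / x‖ < 1 → theta p (A / x) ≠ 0 := by
      intro x hx0 hx hx1
      refine theta_ne_zero_of_norm hp hx1 ?_
      have e1 : A / x * (b / q * x) = p := by
        rw [hA]; field_simp; linear_combination hprod
      have e2 : ‖b / q * x‖ < 1 := norm_mul_lt_one (h'.norm_lt 1) hx.le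
      have e3 := congrArg norm e1
      rw [norm_mul] at e3
      have e4 : 0 < ‖A / x‖ := norm_pos_iff.2 (div_ne_zero hA0 hx0)
      nlinarith
    have n := h.norm_lt
    have n0 := h.ne_zero hp0 hq0
    simp only [Fin.forall_fin_succ, Matrix.cons_val_zero, Matrix.cons_val_succ,
      IsEmpty.forall_iff, and_true] at n n0
    obtain ⟨na, nb, nc, nd, ne, nf⟩ := n
    obtain ⟨a0, -, c0, d0, e0, f0⟩ := n0
    refine mul_ne_zero (mul_ne_zero (mul_ne_zero (key c c0 nc ?_) (key d d0 nd ?_))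
      (key e e0 ne ?_)) (key f f0 nf ?_) <;> rw [hA]
    · rw [show a * c * d * e * f / c = a * d * e * f by field_simp]
      exact norm_mul_lt_one (norm_mul_lt_one (norm_mul_lt_one na nd.le) ne.le) nf.le
    · rw [show a * c * d * e * f / d = a * c * e * f by field_simp]
      exact norm_mul_lt_one (norm_mul_lt_one (norm_mul_lt_one na nc.le) ne.le) nf.le
    · rw [show a * c * d * e * f / e = a * c * d * f by field_simp]
      exact norm_mul_lt_one (norm_mul_lt_one (norm_mul_lt_one na nc.le) nd.le) nf.le
    · rw [show a * c * d * e * f / f = a * c * d * e by field_simp]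
      exact norm_mul_lt_one (norm_mul_lt_one (norm_mul_lt_one na nc.le) nd.le) ne.le
  unfold betaRatio
  rw [div_eq_div_iff hN2 hN1]
  apply mul_right_cancel₀ hX0
  linear_combination betaProd p q ![a, b, c, d, e, f] * hI
    - betaIntegral p q ![a, b, c, d, e, f] * hN

end BetaIntegral

/-! ### Holomorphic dependence on parameters, and sliding two parameters. -/

/-- A circle integral depends holomorphically on a parameter. -/
lemma differentiableOn_circleIntegral {U : Set ℂ} (hU : IsOpen U) {F : ℂ → ℂ → ℂ}
    (hc : ContinuousOn (fun v : ℂ × ℂ => F v.1 v.2) (U ×ˢ Metric.sphere 0 1))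
    (hd : ∀ z ∈ Metric.sphere (0 : ℂ) 1, DifferentiableOn ℂ (fun l => F l z) U) :
    DifferentiableOn ℂ (fun l => ∮ z in C(0, 1), F l z) U := by
  intro l₀ hl₀
  obtain ⟨ε, hε, hεU⟩ := Metric.nhds_basis_closedBall.mem_iff.1 (hU.mem_nhds hl₀)
  have hmem : ∀ θ : ℝ, circleMap 0 1 θ ∈ Metric.sphere (0 : ℂ) 1 := fun θ =>
    circleMap_mem_sphere 0 zero_le_one θ
  have hcomp : IsCompact (Metric.closedBall l₀ ε ×ˢ Metric.sphere (0 : ℂ) 1) :=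
    (isCompact_closedBall _ _).prod (isCompact_sphere _ _)
  obtain ⟨M, hM⟩ := hcomp.exists_bound_of_continuousOn (hc.mono (prod_mono hεU subset_rfl))
  have hM' : ∀ l ∈ Metric.closedBall l₀ ε, ∀ θ : ℝ, ‖F l (circleMap 0 1 θ)‖ ≤ M :=
    fun l hl θ => hM (l, circleMap 0 1 θ) ⟨hl, hmem θ⟩
  have hcont : ∀ l ∈ U, Continuous fun θ : ℝ => F l (circleMap 0 1 θ) := by
    intro l hl
    rw [← continuousOn_univ]
    exact hc.comp (f := fun θ : ℝ => (l, circleMap 0 1 θ))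
      (continuous_const.prodMk (continuous_circleMap 0 1)).continuousOn
      fun θ _ => ⟨hl, hmem θ⟩
  have hder : ∀ l ∈ U, ∀ θ : ℝ, HasDerivAt (fun l => F l (circleMap 0 1 θ))
      (deriv (fun l => F l (circleMap 0 1 θ)) l) l := fun l hl θ =>
    ((hd _ (hmem θ)).differentiableAt (hU.mem_nhds hl)).hasDerivAt
  have hε2 : 0 < ε / 2 := half_pos hε
  -- Cauchy's estimate on discs of radius ε/2, which stay inside the closed ε-disc where |F| ≤ M.
  have hbound : ∀ θ : ℝ, ∀ l ∈ Metric.ball l₀ (ε / 2),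
      ‖deriv (fun l => F l (circleMap 0 1 θ)) l‖ ≤ M / (ε / 2) := by
    intro θ l hl
    have hsub : Metric.closedBall l (ε / 2) ⊆ Metric.closedBall l₀ ε :=
      Metric.closedBall_subset_closedBall' (by rw [Metric.mem_ball] at hl; linarith)
    refine norm_deriv_le_of_forall_mem_sphere_norm_le hε2 ?_ fun w hw =>
      hM' w (hsub (Metric.sphere_subset_closedBall hw)) θ
    refine DifferentiableOn.diffContOnCl ?_
    rw [closure_ball _ hε2.ne']
    exact (hd _ (hmem θ)).mono (hsub.trans hεU)
  -- The derivative is measurable in θ as a pointwise limit of continuous difference quotients.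
  have hmeas : AEStronglyMeasurable (fun θ : ℝ => deriv (fun l => F l (circleMap 0 1 θ)) l₀)
      (volume.restrict (uIoc 0 (2 * Real.pi))) := by
    obtain ⟨v, hv0, hvε, hv⟩ : ∃ v : ℕ → ℂ, (∀ n, v n ≠ 0) ∧ (∀ n, ‖v n‖ ≤ ε) ∧
        Tendsto v atTop (𝓝 0) := by
      refine ⟨fun n => ((ε / (n + 1) : ℝ) : ℂ), fun n => ?_, fun n => ?_, ?_⟩
      · have : ε / ((n : ℝ) + 1) ≠ 0 := by positivity
        exact Complex.ofReal_ne_zero.2 this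
      · rw [Complex.norm_real, Real.norm_of_nonneg (by positivity)]
        refine div_le_self hε.le ?_
        linarith [(Nat.cast_nonneg n : (0 : ℝ) ≤ n)]
      · have := (tendsto_one_div_add_atTop_nhds_zero_nat (𝕜 := ℝ)).const_mul ε
        simp only [mul_one_div, mul_zero] at this
        exact (Complex.continuous_ofReal.tendsto' 0 0 Complex.ofReal_zero).comp this
    refine aestronglyMeasurable_of_tendsto_ae atTop
      (f := fun (n : ℕ) (θ : ℝ) => (v n)⁻¹ • (F (l₀ + v n) (circleMap 0 1 θ) -
        F l₀ (circleMap 0 1 θ))) (fun n => ?_) (Eventually.of_forall fun θ => ?_)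
    · have hvU : l₀ + v n ∈ U := hεU (by simpa using hvε n)
      exact (continuous_const.mul ((hcont _ hvU).sub (hcont _ hl₀))).aestronglyMeasurable
    · refine (hder l₀ hl₀ θ).tendsto_slope_zero.comp ?_
      exact tendsto_nhdsWithin_iff.2 ⟨hv, Eventually.of_forall hv0⟩
  have hcd : Continuous fun θ : ℝ => deriv (circleMap 0 1) θ := by
    simp only [deriv_circleMap]
    exact (continuous_circleMap 0 1).mul continuous_const
  have hball : Metric.ball l₀ (ε / 2) ⊆ U := fun l hl =>
    hεU (Metric.mem_closedBall.2 (by rw [Metric.mem_ball] at hl; linarith))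
  have := (intervalIntegral.hasDerivAt_integral_of_dominated_loc_of_deriv_le (μ := volume)
    (a := 0) (b := 2 * Real.pi)
    (F := fun l θ => deriv (circleMap 0 1) θ • F l (circleMap 0 1 θ))
    (F' := fun l θ => deriv (circleMap 0 1) θ • deriv (fun l => F l (circleMap 0 1 θ)) l)
    (x₀ := l₀) (s := Metric.ball l₀ (ε / 2)) (bound := fun _ => M / (ε / 2))
    (Metric.ball_mem_nhds _ hε2) ?_ ?_ ?_ ?_ ?_ ?_).2
  · exact this.differentiableAt.differentiableWithinAt
  · filter_upwards [hU.mem_nhds hl₀] with l hl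
    exact (hcd.smul (hcont l hl)).aestronglyMeasurable
  · exact (hcd.smul (hcont l₀ hl₀)).intervalIntegrable _ _
  · exact hcd.aestronglyMeasurable.smul hmeas
  · refine Eventually.of_forall fun θ _ l hl => ?_
    rw [norm_smul, deriv_circleMap]
    simpa using hbound θ l hl
  · exact intervalIntegrable_const
  · exact Eventually.of_forall fun θ _ l hl => (hder l (hball hl) θ).const_mul _

section BetaIntegral

variable {p q : ℂ}

lemma differentiableOn_betaRatio (hp0 : p ≠ 0) (hq0 : q ≠ 0) (hp : ‖p‖ < 1) (hq : ‖q‖ < 1)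
    {U : Set ℂ} (hU : IsOpen U) {τ : ℂ → Fin 6 → ℂ}
    (hτ : ∀ j, DifferentiableOn ℂ (fun l => τ l j) U) (hB : ∀ l ∈ U, Balanced p q (τ l)) :
    DifferentiableOn ℂ (fun l => betaRatio p q (τ l)) U := by
  have hz : ∀ z ∈ Metric.sphere (0 : ℂ) 1, ‖z‖ = 1 := fun z hz => by simpa using hz
  have hz0 : ∀ z ∈ Metric.sphere (0 : ℂ) 1, z ≠ 0 := fun z h =>
    norm_pos_iff.1 (by rw [hz z h]; exact one_pos)
  have h0 := fun l hl => (hB l hl).ne_zero hp0 hq0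
  have h1 := fun l hl => (hB l hl).norm_lt
  refine DifferentiableOn.div ?_ ?_ fun l hl => (hB l hl).betaProd_ne_zero hp0 hq0 hp hq
  · refine differentiableOn_circleIntegral hU (F := fun l z => betaKernel p q (τ l) z / z) ?_ ?_
    · refine ContinuousOn.div ?_ continuousOn_snd fun v hv => hz0 _ hv.2
      exact betaKernel_continuousOn hp hq (τ := fun v : ℂ × ℂ => τ v.1)
        (fun j => (hτ j).continuousOn.comp continuousOn_fst fun v hv => hv.1) continuousOn_snd
        (fun v hv => h0 _ hv.1) (fun v hv => h1 _ hv.1) fun v hv => hz _ hv.2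
    · intro z hzs
      unfold betaKernel
      refine (DifferentiableOn.mul_const ?_ _).div_const _
      refine DifferentiableOn.fun_finsetProd fun j _ l hl => ?_
      have hd := (hτ j).differentiableAt (hU.mem_nhds hl)
      exact ((differentiableAt_ellGamma_comp hp hq (hd.mul_const _)
        (mul_ne_zero (h0 l hl j) (hz0 z hzs)) (norm_mul_lt_one (h1 l hl j) (hz z hzs).le)).mul
        (differentiableAt_ellGamma_comp hp hq (hd.mul_const _)
        (mul_ne_zero (h0 l hl j) (inv_ne_zero (hz0 z hzs))) (norm_mul_lt_one (h1 l hl j)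
          (by rw [norm_inv, hz z hzs, inv_one])))).differentiableWithinAt
  · unfold betaProd
    refine DifferentiableOn.fun_finsetProd fun i _ => DifferentiableOn.fun_finsetProd fun j _ => ?_
    split_ifs with hij
    · intro l hl
      exact (differentiableAt_ellGamma_comp hp hq
        (((hτ i).differentiableAt (hU.mem_nhds hl)).mul
          ((hτ j).differentiableAt (hU.mem_nhds hl)))
        (mul_ne_zero (h0 l hl i) (h0 l hl j))
        (norm_mul_lt_one (h1 l hl i) (h1 l hl j).le)).differentiableWithinAt
    · exact differentiableOn_const _

lemma isOpen_annulus (r R : ℝ) : IsOpen {z : ℂ | r < ‖z‖ ∧ ‖z‖ < R} :=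
  (isOpen_lt continuous_const continuous_norm).inter (isOpen_lt continuous_norm continuous_const)

lemma balanced_slide {a b c d e f u : ℂ}
    (h : Balanced p q ![a, b, c, d, e, f]) (hu : ‖a * b‖ < ‖u‖) (hu1 : ‖u‖ < 1) :
    Balanced p q ![u, a * b / u, c, d, e, f] := by
  have hu0 : 0 < ‖u‖ := (norm_nonneg _).trans_lt hu
  have hu0' : u ≠ 0 := norm_pos_iff.1 hu0
  have h1 := h.prod_eq
  have h2 := h.norm_lt
  constructor
  · simp [Fin.prod_univ_six] at h1 ⊢
    rw [← h1]; field_simp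
  · simp only [Fin.forall_fin_succ, Matrix.cons_val_zero, Matrix.cons_val_succ,
      IsEmpty.forall_iff, and_true] at h2 ⊢
    refine ⟨hu1, ?_, h2.2.2⟩
    rw [norm_div, div_lt_one hu0]; exact hu

/-- The normalized elliptic beta integral does not change when two parameters with a sufficiently
small product vary with this product fixed. -/
lemma betaRatio_slide (hp0 : p ≠ 0) (hq0 : q ≠ 0) (hp : ‖p‖ < 1) (hq : ‖q‖ < 1)
    {a b c d e f u : ℂ} (h : Balanced p q ![a, b, c, d, e, f]) (hab : ‖a * b‖ < ‖q‖)
    (hu : ‖a * b‖ < ‖u‖) (hu1 : ‖u‖ < 1) :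
    betaRatio p q ![u, a * b / u, c, d, e, f] = betaRatio p q ![a, b, c, d, e, f] := by
  have a0 := h.ne_zero hp0 hq0 0
  have b0 := h.ne_zero hp0 hq0 1
  simp only [Matrix.cons_val] at a0 b0
  have na := h.norm_lt 0
  have nb := h.norm_lt 1
  simp only [Matrix.cons_val] at na nb
  have hB : ∀ u ∈ {z : ℂ | ‖a * b‖ < ‖z‖ ∧ ‖z‖ < 1}, Balanced p q ![u, a * b / u, c, d, e, f] :=
    fun u hu => balanced_slide h hu.1 hu.2
  -- The annulus |ab| < |u| < 1 is wider than a fundamental annulus precisely because |ab| < |q|.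
  have key := eq_of_mul_periodic (f := fun u => betaRatio p q ![u, a * b / u, c, d, e, f])
    hq0 hq (norm_pos_iff.2 (mul_ne_zero a0 b0)) (by rwa [mul_one])
    (differentiableOn_betaRatio hp0 hq0 hp hq (isOpen_annulus _ _) ?_ hB) ?_ (z := u) (w := a)
    ⟨hu, hu1⟩ ⟨?_, na⟩
  · simpa [mul_div_cancel_left₀ _ a0] using key
  · have hne : ∀ z ∈ {z : ℂ | ‖a * b‖ < ‖z‖ ∧ ‖z‖ < 1}, z ≠ 0 := fun z hz =>
      norm_pos_iff.1 ((norm_nonneg _).trans_lt hz.1)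
    intro j
    fin_cases j
    · exact differentiableOn_id
    · exact (differentiableOn_const _).div differentiableOn_id hne
    all_goals exact differentiableOn_const _
  · intro z hz1 hz2
    have hz3 : ‖a * b‖ < ‖z‖ := by
      rw [norm_mul q] at hz1
      exact hz1.trans_le (mul_le_of_le_one_left (norm_nonneg _) hq.le)
    have hqz : ‖q * z‖ < 1 := norm_mul_lt_one hq hz2.le
    have e : a * b / (q * z) = a * b / z / q := by rw [div_div, mul_comm z q]
    have B1 := hB z ⟨hz3, hz2⟩
    have B2 := hB (q * z) ⟨hz1, hqz⟩
    rw [e] at B2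
    rw [e]
    exact betaRatio_shift hp0 hq0 hp hq B1 B2
  · rw [norm_mul]
    exact mul_lt_of_lt_one_right (norm_pos_iff.2 a0) nb

end BetaIntegral

/-! ### A Poisson-type kernel concentrating at z = ±i. -/

/-- The Poisson kernel in `-z²`, divided by `1 + R`. -/
noncomputable def peak (R : ℝ) (z : ℂ) : ℂ :=
  (1 - R) / ((1 + R * z ^ 2) * (1 + R * (z ^ 2)⁻¹))

lemma one_add_mul_ne_zero {R : ℝ} (hR0 : 0 < R) (hR : R < 1) {w : ℂ} (hw : ‖w‖ ≤ 1) :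
    1 + R * w ≠ 0 := by
  intro h
  have h1 : (R : ℂ) * w = -1 := by linear_combination h
  have h2 := congrArg norm h1
  rw [norm_mul, norm_neg, norm_one, Complex.norm_real, Real.norm_of_nonneg hR0.le] at h2
  nlinarith

lemma peak_eq_ofReal {R : ℝ} {z : ℂ} (hz : ‖z‖ = 1) :
    peak R z = (((1 - R) / ‖1 + R * z ^ 2‖ ^ 2 : ℝ) : ℂ) := by
  have hz2 : ‖z ^ 2‖ = 1 := by rw [norm_pow, hz, one_pow]
  have h1 : 1 + R * (z ^ 2)⁻¹ = (starRingEnd ℂ) (1 + R * z ^ 2) := by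
    rw [Complex.inv_eq_conj hz2]; simp
  unfold peak
  rw [h1, Complex.mul_conj, Complex.normSq_eq_norm_sq]
  push_cast
  rfl

/-- For vw = 1, (1 − R)/((1 + Rv)(1 + Rw)) = (1 + R)⁻¹ (1/(1 + Rv) + 1/(1 + Rw) − 1), and each of
the three terms, integrated against dz/z, contributes ±2πi. -/
lemma circleIntegral_peak {R : ℝ} (hR0 : 0 < R) (hR : R < 1) :
    (∮ z in C(0, 1), peak R z / z) = 2 * Real.pi * I / (1 + R) := by
  have hR1 : (1 + R : ℂ) ≠ 0 := by
    have : (1 + R : ℝ) ≠ 0 := by positivity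
    exact_mod_cast this
  have hne : ∀ z : ℂ, ‖z‖ ≤ 1 → 1 + R * z ^ 2 ≠ 0 := fun z hz =>
    one_add_mul_ne_zero hR0 hR (by rw [norm_pow]; exact pow_le_one₀ (norm_nonneg _) hz)
  have hz0 : ∀ z ∈ Metric.sphere (0 : ℂ) 1, z ≠ 0 := by
    rintro z hz rfl; simp at hz
  have hz1 : ∀ z ∈ Metric.sphere (0 : ℂ) 1, ‖z‖ = 1 := fun z hz => by simpa using hz
  have i1 : (∮ z in C(0, 1), (1 + R * z ^ 2)⁻¹ / z) = 2 * Real.pi * I := by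
    have hd : DifferentiableOn ℂ (fun z : ℂ => (1 + R * z ^ 2)⁻¹) (Metric.closedBall 0 1) := by
      intro z hz
      refine DifferentiableAt.differentiableWithinAt ?_
      refine DifferentiableAt.inv (by fun_prop) (hne z (by simpa using hz))
    have := hd.circleIntegral_sub_inv_smul (w := 0) (by simp)
    simpa [div_eq_inv_mul] using this
  have i2 : (∮ z in C(0, 1), (1 + R * z⁻¹ ^ 2)⁻¹ / z) = 2 * Real.pi * I := by
    rw [circleIntegral_inv_div (fun z => (1 + R * z ^ 2)⁻¹), i1]
  have i3 : (∮ z in C((0 : ℂ), 1), z⁻¹) = 2 * Real.pi * I := by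
    simpa using circleIntegral.integral_sub_center_inv 0 one_ne_zero
  have c1 : CircleIntegrable (fun z : ℂ => (1 + R * z ^ 2)⁻¹ / z) 0 1 := by
    refine ContinuousOn.circleIntegrable zero_le_one ?_
    refine ContinuousOn.div (ContinuousOn.inv₀ (by fun_prop) fun z hz => hne z (hz1 z hz).le)
      continuousOn_id hz0
  have c2 : CircleIntegrable (fun z : ℂ => (1 + R * z⁻¹ ^ 2)⁻¹ / z) 0 1 := by
    refine ContinuousOn.circleIntegrable zero_le_one ?_
    refine ContinuousOn.div (ContinuousOn.inv₀ ?_ fun z hz => hne _ ?_) continuousOn_id hz0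
    · exact continuousOn_const.add (continuousOn_const.mul
        ((continuousOn_id.inv₀ hz0).pow 2))
    · rw [norm_inv, hz1 z hz, inv_one]
  have c3 : CircleIntegrable (fun z : ℂ => z⁻¹) 0 1 :=
    ContinuousOn.circleIntegrable zero_le_one (continuousOn_id.inv₀ hz0)
  calc _ = ∮ z in C(0, 1), (1 + R : ℂ)⁻¹ *
        ((1 + R * z ^ 2)⁻¹ / z + (1 + R * z⁻¹ ^ 2)⁻¹ / z - z⁻¹) := by
        refine circleIntegral.integral_congr zero_le_one fun z hz => ?_
        have h1 := hne z (hz1 z hz).le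
        have h2 := hne z⁻¹ (by rw [norm_inv, hz1 z hz, inv_one])
        have h3 := hz0 z hz
        unfold peak
        rw [inv_pow] at *
        have h4 : z ^ 2 * (z ^ 2)⁻¹ = 1 := mul_inv_cancel₀ (pow_ne_zero 2 h3)
        generalize (z ^ 2)⁻¹ = w at *
        generalize z ^ 2 = v at *
        simp only [div_eq_mul_inv]
        have key : (1 - (R : ℂ)) * ((1 + R * v) * (1 + R * w))⁻¹ =
            (1 + R : ℂ)⁻¹ * ((1 + R * v)⁻¹ + (1 + R * w)⁻¹ - 1) := by
          field_simp
          linear_combination (R : ℂ) ^ 2 * h4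
        rw [key]; ring
    _ = _ := by
        have c12 : CircleIntegrable (fun z : ℂ => (1 + R * z ^ 2)⁻¹ / z +
          (1 + R * z⁻¹ ^ 2)⁻¹ / z) 0 1 := c1.add c2
        rw [circleIntegral.integral_const_mul, circleIntegral.integral_sub c12 c3,
          circleIntegral.integral_add c1 c2, i1, i2, i3]
        field_simp
        ring

lemma norm_peak {R : ℝ} (hR : R < 1) {z : ℂ} (hz : ‖z‖ = 1) :
    ‖peak R z‖ = (1 - R) / ‖1 + R * z ^ 2‖ ^ 2 := by
  rw [peak_eq_ofReal hz, Complex.norm_real, Real.norm_of_nonneg]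
  exact div_nonneg (by linarith) (by positivity)

/-- On the circle 1 − R ≤ |1 + Rz²|, hence |1 + z²| ≤ 2|1 + Rz²|. Away from z² = −1 the kernel is
therefore O(1 − R). -/
lemma norm_peak_mul_le {R : ℝ} (hR0 : 0 < R) (hR : R < 1) {z : ℂ} (hz : ‖z‖ = 1) :
    ‖peak R z‖ * ‖1 + z ^ 2‖ ^ 2 ≤ 4 * (1 - R) := by
  have hz2 : ‖z ^ 2‖ = 1 := by rw [norm_pow, hz, one_pow]
  have h0 : 0 < ‖1 + R * z ^ 2‖ := norm_pos_iff.2 (one_add_mul_ne_zero hR0 hR hz2.le)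
  have h1 : 1 - R ≤ ‖1 + R * z ^ 2‖ := by
    have := norm_sub_norm_le (1 : ℂ) (-(R * z ^ 2))
    rw [norm_one, norm_neg, norm_mul, hz2, Complex.norm_real, Real.norm_of_nonneg hR0.le,
      sub_neg_eq_add, mul_one] at this
    exact this
  have h2 : ‖1 + z ^ 2‖ ≤ ‖1 + R * z ^ 2‖ + (1 - R) := by
    calc ‖1 + z ^ 2‖ = ‖(1 + R * z ^ 2) + ((1 - R : ℝ) : ℂ) * z ^ 2‖ := by
          congr 1; push_cast; ring
      _ ≤ _ := by
          refine (norm_add_le _ _).trans ?_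
          rw [norm_mul _ (z ^ 2), hz2, Complex.norm_real, Real.norm_of_nonneg (by linarith), mul_one]
  have h3 : ‖1 + z ^ 2‖ ^ 2 ≤ (2 * ‖1 + R * z ^ 2‖) ^ 2 :=
    pow_le_pow_left₀ (norm_nonneg _) (by linarith) 2
  rw [norm_peak hR hz, div_mul_eq_mul_div, div_le_iff₀ (by positivity)]
  nlinarith

lemma integral_norm_peak {R : ℝ} (hR0 : 0 < R) (hR : R < 1) :
    ∫ θ in (0 : ℝ)..2 * Real.pi, ‖peak R (circleMap 0 1 θ)‖ ≤ 2 * Real.pi := by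
  have h := circleIntegral_peak hR0 hR
  rw [circleIntegral_div_eq _ one_ne_zero] at h
  have h1 : ∀ θ : ℝ, peak R (circleMap 0 1 θ) = ((‖peak R (circleMap 0 1 θ)‖ : ℝ) : ℂ) := by
    intro θ
    have hz : ‖circleMap 0 1 θ‖ = 1 := by simp
    rw [norm_peak hR hz, peak_eq_ofReal hz]
  rw [intervalIntegral.integral_congr (fun θ _ => h1 θ), intervalIntegral.integral_ofReal] at h
  have h2 : ((∫ θ in (0 : ℝ)..2 * Real.pi, ‖peak R (circleMap 0 1 θ)‖ : ℝ) : ℂ) =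
      ((2 * Real.pi / (1 + R) : ℝ) : ℂ) := by
    push_cast
    apply mul_left_cancel₀ I_ne_zero
    rw [h]; ring
  rw [Complex.ofReal_inj.1 h2]
  exact div_le_self (by positivity) (by linarith)

lemma continuous_norm_peak {R : ℝ} (hR0 : 0 < R) (hR : R < 1) :
    Continuous fun θ : ℝ => ‖peak R (circleMap 0 1 θ)‖ := by
  have hz : ∀ θ, ‖circleMap 0 1 θ‖ = 1 := fun θ => by simp
  have hne : ∀ θ, ‖1 + R * circleMap 0 1 θ ^ 2‖ ^ 2 ≠ 0 := fun θ =>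
    pow_ne_zero 2 (norm_ne_zero_iff.2 (one_add_mul_ne_zero hR0 hR (by simp [hz])))
  simp only [norm_peak hR (hz _)]
  have := continuous_circleMap 0 1
  exact continuous_const.div (by fun_prop) hne

/-- Concentration of the Poisson kernel at the points `z = ± i`. -/
lemma tendsto_circleIntegral_peak {h : ℝ → ℂ → ℂ} {L : ℂ}
    (hc : ∀ z ∈ Metric.sphere (0 : ℂ) 1, ContinuousAt (fun v : ℝ × ℂ => h v.1 v.2) (1, z))
    (hL : ∀ z : ℂ, z ^ 2 = -1 → h 1 z = L)
    (hi : ∀ᶠ ρ in 𝓝[<] (1 : ℝ), CircleIntegrable (fun z => peak (ρ ^ 2) z * h ρ z / z) 0 1) :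
    Tendsto (fun ρ : ℝ => ∮ z in C(0, 1), peak (ρ ^ 2) z * h ρ z / z) (𝓝[<] 1)
      (𝓝 (Real.pi * I * L)) := by
  have hz1 : ∀ z ∈ Metric.sphere (0 : ℂ) 1, ‖z‖ = 1 := fun z hz => by simpa using hz
  have hz0 : ∀ z ∈ Metric.sphere (0 : ℂ) 1, z ≠ 0 := by
    rintro z hz rfl; simp at hz
  have hT : IsCompact (Metric.sphere (0 : ℂ) 1) := isCompact_sphere _ _
  have hρ : ∀ᶠ ρ in 𝓝[<] (1 : ℝ), 0 < ρ ^ 2 ∧ ρ ^ 2 < 1 := by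
    filter_upwards [Ioo_mem_nhdsLT (show (0 : ℝ) < 1 from one_pos)] with ρ hρ
    exact ⟨by have := hρ.1; positivity, pow_lt_one₀ hρ.1.le hρ.2 two_ne_zero⟩
  have hlim : Tendsto (fun ρ : ℝ => ρ ^ 2) (𝓝[<] 1) (𝓝 1) := by
    have : Tendsto (fun ρ : ℝ => ρ ^ 2) (𝓝 1) (𝓝 (1 ^ 2)) := (continuous_pow 2).tendsto 1
    rw [one_pow] at this
    exact this.mono_left nhdsWithin_le_nhds
  have hB : Tendsto (fun ρ : ℝ => 2 * Real.pi * I / (1 + ((ρ ^ 2 : ℝ) : ℂ)) * L) (𝓝[<] 1)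
      (𝓝 (Real.pi * I * L)) := by
    have h1 : Tendsto (fun ρ : ℝ => ((ρ ^ 2 : ℝ) : ℂ)) (𝓝[<] 1) (𝓝 1) :=
      (Complex.continuous_ofReal.tendsto' 1 1 Complex.ofReal_one).comp hlim
    have h2 : Tendsto (fun ρ : ℝ => 2 * Real.pi * I / (1 + ((ρ ^ 2 : ℝ) : ℂ)) * L) (𝓝[<] 1)
        (𝓝 (2 * Real.pi * I / (1 + 1) * L)) :=
      ((tendsto_const_nhds (x := (2 * Real.pi * I : ℂ))).div
        ((tendsto_const_nhds (x := (1 : ℂ))).add h1) (by norm_num)).mul_const L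
    convert h2 using 2
    field_simp
    norm_num
  have hdiff : Tendsto (fun ρ : ℝ => (∮ z in C(0, 1), peak (ρ ^ 2) z * h ρ z / z) -
      2 * Real.pi * I / (1 + ((ρ ^ 2 : ℝ) : ℂ)) * L) (𝓝[<] 1) (𝓝 0) := by
    rw [Metric.tendsto_nhds]
    intro ε hε
    obtain ⟨δ, hδ, hδε⟩ : ∃ δ : ℝ, 0 < δ ∧ 2 * Real.pi * (2 * δ) < ε := by
      have hpi := Real.pi_pos
      refine ⟨ε / (8 * Real.pi), by positivity, ?_⟩
      field_simp
      norm_num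
    -- Where |h(1, z) − L| ≥ δ, a compact set avoiding z² = −1, the quotient by |1 + z²|² is
    -- bounded. After multiplication by the kernel, the K-term is uniformly small by
    -- `norm_peak_mul_le`.
    obtain ⟨K, hK0, hK⟩ : ∃ K : ℝ, 0 ≤ K ∧ ∀ z ∈ Metric.sphere (0 : ℂ) 1,
        ‖h 1 z - L‖ < δ + K * ‖1 + z ^ 2‖ ^ 2 := by
      have hc1 : ContinuousOn (fun z => ‖h 1 z - L‖) (Metric.sphere (0 : ℂ) 1) := by
        intro z hz
        have := ContinuousAt.comp (f := fun z : ℂ => ((1 : ℝ), z)) (hc z hz) (by fun_prop)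
        exact ((this.sub continuousAt_const).norm).continuousWithinAt
      have hcl : IsCompact (Metric.sphere (0 : ℂ) 1 ∩ (fun z => ‖h 1 z - L‖) ⁻¹' Ici δ) :=
        hT.of_isClosed_subset (hc1.preimage_isClosed_of_isClosed Metric.isClosed_sphere isClosed_Ici)
          inter_subset_left
      have hne : ∀ z ∈ Metric.sphere (0 : ℂ) 1 ∩ (fun z => ‖h 1 z - L‖) ⁻¹' Ici δ,
          ‖1 + z ^ 2‖ ^ 2 ≠ 0 := by
        rintro z ⟨-, hz⟩ h0
        have h1 : 1 + z ^ 2 = 0 := by simpa using h0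
        have h2 := hL z (by linear_combination h1)
        simp only [mem_preimage, h2, sub_self, norm_zero, mem_Ici] at hz
        linarith
      obtain ⟨M, hM⟩ := hcl.exists_bound_of_continuousOn
        (f := fun z => ‖h 1 z - L‖ / ‖1 + z ^ 2‖ ^ 2)
        ((hc1.mono inter_subset_left).div (by fun_prop) hne)
      refine ⟨max M 0, le_max_right _ _, fun z hz => ?_⟩
      by_cases hzδ : ‖h 1 z - L‖ < δ
      · have : 0 ≤ max M 0 * ‖1 + z ^ 2‖ ^ 2 := by positivity
        linarith
      · have hmem : z ∈ Metric.sphere (0 : ℂ) 1 ∩ (fun z => ‖h 1 z - L‖) ⁻¹' Ici δ :=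
          ⟨hz, not_lt.1 hzδ⟩
        have hb := hM z hmem
        have hpos : 0 < ‖1 + z ^ 2‖ ^ 2 := lt_of_le_of_ne (by positivity) (hne z hmem).symm
        rw [Real.norm_of_nonneg (by positivity), div_le_iff₀ hpos] at hb
        have : M * ‖1 + z ^ 2‖ ^ 2 ≤ max M 0 * ‖1 + z ^ 2‖ ^ 2 := by gcongr; exact le_max_left _ _
        linarith
    -- The strict inequality at ρ = 1 persists for nearby ρ uniformly in z, by compactness of the
    -- circle.
    have hK' : ∀ᶠ ρ in 𝓝 (1 : ℝ), ∀ z ∈ Metric.sphere (0 : ℂ) 1,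
        ‖h ρ z - L‖ < δ + K * ‖1 + z ^ 2‖ ^ 2 := by
      refine hT.eventually_forall_of_forall_eventually fun z hz => ?_
      have c1 : ContinuousAt (fun v : ℝ × ℂ => ‖h v.1 v.2 - L‖) (1, z) :=
        ((hc z hz).sub continuousAt_const).norm
      have c2 : ContinuousAt (fun v : ℝ × ℂ => δ + K * ‖1 + v.2 ^ 2‖ ^ 2) (1, z) := by fun_prop
      exact c1.eventually_lt c2 (hK z hz)
    have hKlim : ∀ᶠ ρ in 𝓝[<] (1 : ℝ), K * (4 * (1 - ρ ^ 2)) < δ := by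
      have : Tendsto (fun ρ : ℝ => K * (4 * (1 - ρ ^ 2))) (𝓝[<] 1) (𝓝 (K * (4 * (1 - 1)))) :=
        ((hlim.const_sub 1).const_mul 4).const_mul K
      refine this.eventually_lt_const ?_
      simpa using hδ
    filter_upwards [hρ, hi, hK'.filter_mono nhdsWithin_le_nhds, hKlim] with ρ hρ hi hKρ hKl
    obtain ⟨hR0, hR⟩ := hρ
    have hpc : CircleIntegrable (fun z => peak (ρ ^ 2) z * L / z) 0 1 := by
      refine ContinuousOn.circleIntegrable zero_le_one ?_
      refine ContinuousOn.div (ContinuousOn.mul ?_ continuousOn_const) continuousOn_id hz0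
      unfold peak
      refine ContinuousOn.div continuousOn_const ?_ fun z hz => ?_
      · exact ContinuousOn.mul (by fun_prop) (continuousOn_const.add (continuousOn_const.mul
          ((continuousOn_pow 2).inv₀ fun z hz => pow_ne_zero 2 (hz0 z hz))))
      · exact mul_ne_zero (one_add_mul_ne_zero hR0 hR (by simp [hz1 z hz]))
          (one_add_mul_ne_zero hR0 hR (by simp [hz1 z hz]))
    have e1 : (∮ z in C(0, 1), peak (ρ ^ 2) z * h ρ z / z) -
        2 * Real.pi * I / (1 + ((ρ ^ 2 : ℝ) : ℂ)) * L =
        I * ∫ θ in (0 : ℝ)..2 * Real.pi,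
          peak (ρ ^ 2) (circleMap 0 1 θ) * (h ρ (circleMap 0 1 θ) - L) := by
      rw [← circleIntegral_peak hR0 hR, mul_comm _ L, ← circleIntegral.integral_const_mul,
        ← circleIntegral_div_eq (fun z => peak (ρ ^ 2) z * (h ρ z - L)) one_ne_zero]
      have : (fun z => L * (peak (ρ ^ 2) z / z)) = fun z => peak (ρ ^ 2) z * L / z := by
        funext z; ring
      rw [this, ← circleIntegral.integral_sub hi hpc]
      refine circleIntegral.integral_congr zero_le_one fun z _ => ?_
      ring
    rw [dist_zero_right, e1, norm_mul, norm_I, one_mul]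
    have hcp := continuous_norm_peak hR0 hR
    have e2 : ‖∫ θ in (0 : ℝ)..2 * Real.pi,
        peak (ρ ^ 2) (circleMap 0 1 θ) * (h ρ (circleMap 0 1 θ) - L)‖ ≤
        ∫ θ in (0 : ℝ)..2 * Real.pi, (δ * ‖peak (ρ ^ 2) (circleMap 0 1 θ)‖ + δ) := by
      refine intervalIntegral.norm_integral_le_of_norm_le (by positivity)
        (Eventually.of_forall fun θ _ => ?_)
        ((continuous_const.mul hcp).add continuous_const |>.intervalIntegrable _ _)
      have hz : ‖circleMap 0 1 θ‖ = 1 := by simp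
      have hb := hKρ _ (circleMap_mem_sphere 0 zero_le_one θ)
      have hb2 := norm_peak_mul_le hR0 hR hz
      have hb3 := norm_nonneg (peak (ρ ^ 2) (circleMap 0 1 θ))
      rw [norm_mul]
      generalize ‖peak (ρ ^ 2) (circleMap 0 1 θ)‖ = P at *
      generalize ‖h ρ (circleMap 0 1 θ) - L‖ = N at *
      generalize ‖1 + circleMap 0 1 θ ^ 2‖ ^ 2 = W at *
      have hK4 : K * (P * W) ≤ δ := (mul_le_mul_of_nonneg_left hb2 hK0).trans hKl.le
      nlinarith
    have e3 : ∫ θ in (0 : ℝ)..2 * Real.pi, (δ * ‖peak (ρ ^ 2) (circleMap 0 1 θ)‖ + δ) ≤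
        2 * Real.pi * (2 * δ) := by
      have hci : IntervalIntegrable (fun θ : ℝ => δ * ‖peak (ρ ^ 2) (circleMap 0 1 θ)‖) volume 0
          (2 * Real.pi) := (continuous_const.mul hcp).intervalIntegrable _ _
      rw [intervalIntegral.integral_add hci
        intervalIntegrable_const, intervalIntegral.integral_const_mul,
        intervalIntegral.integral_const]
      have := integral_norm_peak hR0 hR
      simp only [sub_zero, smul_eq_mul]
      nlinarith
    linarith
  have := hdiff.add hB
  simpa using this

/-! ### The limit of two parameters tending to ±i, and the value of the beta integral. -/

section BetaIntegral

variable {p q : ℂ}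

lemma gammaReg_ne_zero (hp : ‖p‖ < 1) (hq : ‖q‖ < 1) {x : ℂ} (hx : ‖x‖ ≤ 1)
    (hx' : ‖p * q‖ < ‖x‖) : gammaReg p q x ≠ 0 := by
  have hx0 : 0 < ‖x‖ := (norm_nonneg _).trans_lt hx'
  refine div_ne_zero (poch₂_ne_zero_of_norm_lt_one hp hq ?_) (gammaReg_denom_ne_zero hp hq hx)
  rw [norm_mul, norm_inv, ← div_eq_mul_inv, div_lt_one hx0]
  exact hx'

/-- The numerator of the regular part of the integrand in the limit `t₀ t₂ → 1`. -/
noncomputable def limitNum (p q C d e f : ℂ) (ρ : ℝ) (z : ℂ) : ℂ :=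
  gammaReg p q (-(I * ρ) * z) * gammaReg p q (-(I * ρ) * z⁻¹) *
    (gammaReg p q (I * ρ * z) * gammaReg p q (I * ρ * z⁻¹)) *
    (ellGamma p q (C / ρ ^ 2 * z) * ellGamma p q (C / ρ ^ 2 * z⁻¹)) *
    (ellGamma p q (d * z) * ellGamma p q (d * z⁻¹)) *
    (ellGamma p q (e * z) * ellGamma p q (e * z⁻¹)) *
    (ellGamma p q (f * z) * ellGamma p q (f * z⁻¹)) * weight p q z

/-- The denominator of the regular part of the integrand in the limit `t₀ t₂ → 1`. -/
noncomputable def limitDen (p q C d e f : ℂ) (ρ : ℝ) : ℂ :=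
  gammaReg p q (ρ ^ 2) *
    (ellGamma p q (-(I * ρ) * (C / ρ ^ 2)) * ellGamma p q (-(I * ρ) * d) *
      ellGamma p q (-(I * ρ) * e) * ellGamma p q (-(I * ρ) * f)) *
    (ellGamma p q (C / ρ ^ 2 * (I * ρ)) * ellGamma p q (I * ρ * d) *
      ellGamma p q (I * ρ * e) * ellGamma p q (I * ρ * f)) *
    (ellGamma p q (C / ρ ^ 2 * d) * ellGamma p q (C / ρ ^ 2 * e) * ellGamma p q (C / ρ ^ 2 * f) *
      (ellGamma p q (d * e) * ellGamma p q (d * f) * ellGamma p q (e * f)))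

/-- The polar factors of Γ(±iρ z^{±1}) multiply to the denominator of `peak`, and the factor 1 − ρ²
from Γ(ρ²) in the product supplies its numerator. What remains is continuous at ρ = 1. -/
lemma betaKernel_div_betaProd (hp : ‖p‖ < 1) (hq : ‖q‖ < 1) (C d e f : ℂ) (ρ : ℝ) (z : ℂ) :
    betaKernel p q ![-(I * ρ), C / ρ ^ 2, I * ρ, d, e, f] z /
        betaProd p q ![-(I * ρ), C / ρ ^ 2, I * ρ, d, e, f] =
      peak (ρ ^ 2) z * (limitNum p q C d e f ρ z / limitDen p q C d e f ρ) := by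
  have h1 : -(I * (ρ : ℂ)) * (I * ρ) = ρ ^ 2 := by
    linear_combination -(ρ : ℂ) ^ 2 * I_mul_I
  have h2 : (1 - -(I * (ρ : ℂ)) * z) * (1 - -(I * (ρ : ℂ)) * z⁻¹) *
      ((1 - I * ρ * z) * (1 - I * ρ * z⁻¹)) =
      (1 + ((ρ ^ 2 : ℝ) : ℂ) * z ^ 2) * (1 + ((ρ ^ 2 : ℝ) : ℂ) * (z ^ 2)⁻¹) := by
    push_cast
    have e1 : (1 - -(I * (ρ : ℂ)) * z) * (1 - I * ρ * z) = 1 + ρ ^ 2 * z ^ 2 := by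
      linear_combination -(ρ : ℂ) ^ 2 * z ^ 2 * I_mul_I
    have e2 : (1 - -(I * (ρ : ℂ)) * z⁻¹) * (1 - I * ρ * z⁻¹) = 1 + ρ ^ 2 * (z ^ 2)⁻¹ := by
      rw [← inv_pow]
      linear_combination -(ρ : ℂ) ^ 2 * z⁻¹ ^ 2 * I_mul_I
    rw [← e1, ← e2]; ring
  unfold betaKernel betaProd
  simp [Fin.prod_univ_six, -neg_mul, -mul_inv_rev]
  unfold peak limitNum limitDen
  rw [← h2, h1, ellGamma_eq_gammaReg_div hp hq (ρ ^ 2 : ℂ),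
    ellGamma_eq_gammaReg_div hp hq (-(I * ρ) * z),
    ellGamma_eq_gammaReg_div hp hq (-(I * ρ) * z⁻¹), ellGamma_eq_gammaReg_div hp hq (I * ρ * z),
    ellGamma_eq_gammaReg_div hp hq (I * ρ * z⁻¹)]
  push_cast
  generalize (1 - -(I * (ρ : ℂ)) * z) = a0
  generalize (1 - -(I * (ρ : ℂ)) * z⁻¹) = a1
  generalize (1 - I * (ρ : ℂ) * z) = a2
  generalize (1 - I * (ρ : ℂ) * z⁻¹) = a3
  generalize (1 - (ρ : ℂ) ^ 2) = a4
  generalize gammaReg p q _ = g0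
  generalize gammaReg p q _ = g1
  generalize gammaReg p q _ = g2
  generalize gammaReg p q _ = g3
  generalize gammaReg p q _ = g4
  simp only [div_eq_mul_inv, mul_inv, inv_inv]
  ring

lemma norm_mul_lt_of_prod_eq {a b c : ℂ} (h : a * b = c) (hc : c ≠ 0) (hb : ‖b‖ < 1) :
    ‖c‖ < ‖a‖ := by
  have ha : a ≠ 0 := by rintro rfl; simp at h; exact hc h.symm
  rw [← h, norm_mul]
  exact mul_lt_of_lt_one_right (norm_pos_iff.2 ha) hb

/-- For z = ±i the factors Γ(xz)Γ(x/z) cancel against Γ(−ix)Γ(ix), and the six products among C, d,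
e, f cancel by reflection since Cdef = pq. The values at −1 cancel against the weight up to 4,
leaving 4 · `gammaReg p q 1`. -/
lemma limitNum_div_limitDen_of_sq_eq (hp0 : p ≠ 0) (hq0 : q ≠ 0) (hp : ‖p‖ < 1) (hq : ‖q‖ < 1)
    {C d e f : ℂ} (hprod : C * d * e * f = p * q) (hC : ‖C‖ < 1) (hd : ‖d‖ < 1) (he : ‖e‖ < 1)
    (hf : ‖f‖ < 1) {z : ℂ} (hz : z ^ 2 = -1) :
    limitNum p q C d e f 1 z / limitDen p q C d e f 1 = 4 * (poch p p * poch q q)⁻¹ := by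
  have hpq0 := mul_ne_zero hp0 hq0
  have hpq : ‖p * q‖ < 1 := norm_mul_lt_one hp hq.le
  have hne0 := hprod ▸ hpq0
  simp only [ne_eq, mul_eq_zero, not_or] at hne0
  obtain ⟨⟨⟨C0, d0⟩, e0⟩, f0⟩ := hne0
  have nC := norm_mul_lt_of_prod_eq (b := d * e * f) (by rw [← hprod]; ring) hpq0
    (norm_mul_lt_one (norm_mul_lt_one hd he.le) hf.le) (a := C)
  have nd := norm_mul_lt_of_prod_eq (b := C * e * f) (by rw [← hprod]; ring) hpq0
    (norm_mul_lt_one (norm_mul_lt_one hC he.le) hf.le) (a := d)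
  have ne := norm_mul_lt_of_prod_eq (b := C * d * f) (by rw [← hprod]; ring) hpq0
    (norm_mul_lt_one (norm_mul_lt_one hC hd.le) hf.le) (a := e)
  have nf := norm_mul_lt_of_prod_eq (b := C * d * e) (by rw [← hprod]; ring) hpq0
    (norm_mul_lt_one (norm_mul_lt_one hC hd.le) he.le) (a := f)
  have hpair : ∀ x : ℂ, ellGamma p q (x * z) * ellGamma p q (x * z⁻¹) =
      ellGamma p q (-I * x) * ellGamma p q (I * x) := by
    intro x
    have : z = I ∨ z = -I := sq_eq_sq_iff_eq_or_eq_neg.1 (by rw [hz, I_sq])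
    rcases this with rfl | rfl
    · rw [inv_I, mul_comm x I, mul_comm x (-I), mul_comm]
    · rw [inv_neg, inv_I, neg_neg, mul_comm x I, mul_comm x (-I)]
  have hreg : gammaReg p q (-I * z) * gammaReg p q (-I * z⁻¹) *
      (gammaReg p q (I * z) * gammaReg p q (I * z⁻¹)) =
      gammaReg p q 1 ^ 2 * gammaReg p q (-1) ^ 2 := by
    have : z = I ∨ z = -I := sq_eq_sq_iff_eq_or_eq_neg.1 (by rw [hz, I_sq])
    rcases this with rfl | rfl
    · simp only [inv_I, neg_mul, mul_neg, I_mul_I, neg_neg]; ring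
    · simp only [inv_neg, inv_I, neg_mul, mul_neg, I_mul_I, neg_neg]; ring
  have hz1 : ‖z‖ = 1 := by
    have := congrArg norm hz
    rw [norm_pow, norm_neg, norm_one] at this
    exact (pow_eq_one_iff_of_nonneg (norm_nonneg _) two_ne_zero).1 this
  have hW : weight p q z = (gammaReg p q (-1) / 2 * (gammaReg p q (-1) / 2))⁻¹ := by
    rw [← inv_ellGamma_sq hp hq hz1, hz, inv_neg, inv_one, ellGamma_eq_gammaReg_div hp hq (-1)]
    norm_num
  have hr1 : gammaReg p q (-1) ≠ 0 := gammaReg_ne_zero hp hq (by simp) (by simpa using hpq)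
  have hr2 : gammaReg p q 1 ≠ 0 := gammaReg_ne_zero hp hq (by simp) (by simpa using hpq)
  have hG1 : ∀ x : ℂ, ‖x‖ < 1 → ‖p * q‖ < ‖x‖ → ellGamma p q (-I * x) ≠ 0 := fun x h1 h2 =>
    ellGamma_ne_zero hp hq (by simpa using h1) (by simpa using h2)
  have hG2 : ∀ x : ℂ, ‖x‖ < 1 → ‖p * q‖ < ‖x‖ → ellGamma p q (I * x) ≠ 0 := fun x h1 h2 =>
    ellGamma_ne_zero hp hq (by simpa using h1) (by simpa using h2)
  have hr : ∀ x y x' y' : ℂ, x * y * (x' * y') = p * q → ‖x‖ < 1 → ‖y‖ < 1 → ‖x'‖ < 1 → ‖y'‖ < 1 →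
      ellGamma p q (x * y) * ellGamma p q (x' * y') = 1 := by
    intro x y x' y' h hx hy hx' hy'
    have h3 := norm_mul_lt_of_prod_eq h hpq0 (norm_mul_lt_one hx' hy'.le)
    rw [ellGamma_mul_reflect hp0 hq0 (left_ne_zero_of_mul (h ▸ hpq0)) h]
    exact mul_inv_cancel₀ (ellGamma_ne_zero hp hq (norm_mul_lt_one hx hy.le) h3)
  have r1 := hr C d e f (by rw [← hprod]; ring) hC hd he hf
  have r2 := hr C e d f (by rw [← hprod]; ring) hC he hd hf
  have r3 := hr C f d e (by rw [← hprod]; ring) hC hf hd he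
  have hsix : ellGamma p q (C * d) * ellGamma p q (C * e) * ellGamma p q (C * f) *
      (ellGamma p q (d * e) * ellGamma p q (d * f) * ellGamma p q (e * f)) = 1 := by
    linear_combination ellGamma p q (C * e) * ellGamma p q (d * f) * ellGamma p q (C * f) *
      ellGamma p q (d * e) * r1 + ellGamma p q (C * f) * ellGamma p q (d * e) * r2 + r3
  unfold limitNum limitDen
  simp only [ofReal_one, mul_one, one_pow, div_one]
  rw [hsix, hreg, hpair, hpair, hpair, hpair, hW, ← gammaReg_one hp hq, mul_comm C I]
  have a1 := hG1 C hC nC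
  have a2 := hG1 d hd nd
  have a3 := hG1 e he ne
  have a4 := hG1 f hf nf
  have b1 := hG2 C hC nC
  have b2 := hG2 d hd nd
  have b3 := hG2 e he ne
  have b4 := hG2 f hf nf
  generalize ellGamma p q (-I * C) = x1 at *
  generalize ellGamma p q (-I * d) = x2 at *
  generalize ellGamma p q (-I * e) = x3 at *
  generalize ellGamma p q (-I * f) = x4 at *
  generalize ellGamma p q (I * C) = y1 at *
  generalize ellGamma p q (I * d) = y2 at *
  generalize ellGamma p q (I * e) = y3 at *
  generalize ellGamma p q (I * f) = y4 at *
  generalize gammaReg p q (-1) = g1 at *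
  generalize gammaReg p q 1 = g2 at *
  clear * - a1 a2 a3 a4 b1 b2 b3 b4 hr1 hr2
  field_simp
  norm_num

lemma continuousAt_limit (hp0 : p ≠ 0) (hq0 : q ≠ 0) (hp : ‖p‖ < 1) (hq : ‖q‖ < 1)
    {C d e f : ℂ} (hprod : C * d * e * f = p * q) (hC : ‖C‖ < 1) (hd : ‖d‖ < 1) (he : ‖e‖ < 1)
    (hf : ‖f‖ < 1) {z : ℂ} (hz : ‖z‖ = 1) :
    ContinuousAt (fun v : ℝ × ℂ => limitNum p q C d e f v.1 v.2 / limitDen p q C d e f v.1)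
      (1, z) := by
  have hpq0 := mul_ne_zero hp0 hq0
  have hpq : ‖p * q‖ < 1 := norm_mul_lt_one hp hq.le
  have hne0 := hprod ▸ hpq0
  simp only [ne_eq, mul_eq_zero, not_or] at hne0
  obtain ⟨⟨⟨C0, d0⟩, e0⟩, f0⟩ := hne0
  have nC := norm_mul_lt_of_prod_eq (b := d * e * f) (by rw [← hprod]; ring) hpq0
    (norm_mul_lt_one (norm_mul_lt_one hd he.le) hf.le) (a := C)
  have nd := norm_mul_lt_of_prod_eq (b := C * e * f) (by rw [← hprod]; ring) hpq0
    (norm_mul_lt_one (norm_mul_lt_one hC he.le) hf.le) (a := d)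
  have ne := norm_mul_lt_of_prod_eq (b := C * d * f) (by rw [← hprod]; ring) hpq0
    (norm_mul_lt_one (norm_mul_lt_one hC hd.le) hf.le) (a := e)
  have nf := norm_mul_lt_of_prod_eq (b := C * d * e) (by rw [← hprod]; ring) hpq0
    (norm_mul_lt_one (norm_mul_lt_one hC hd.le) he.le) (a := f)
  have hz0 : z ≠ 0 := norm_pos_iff.1 (by rw [hz]; exact one_pos)
  have cz : ContinuousAt (fun v : ℝ × ℂ => v.2) (1, z) := continuousAt_snd
  have czi : ContinuousAt (fun v : ℝ × ℂ => v.2⁻¹) (1, z) := cz.inv₀ hz0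
  have cρ : ContinuousAt (fun v : ℝ × ℂ => (v.1 : ℂ)) (1, z) :=
    Complex.continuous_ofReal.continuousAt.comp continuousAt_fst
  have c0 : ContinuousAt (fun v : ℝ × ℂ => -(I * (v.1 : ℂ))) (1, z) := by fun_prop
  have c1 : ContinuousAt (fun v : ℝ × ℂ => C / (v.1 : ℂ) ^ 2) (1, z) :=
    continuousAt_const.div (cρ.pow 2) (by simp)
  have c2 : ContinuousAt (fun v : ℝ × ℂ => I * (v.1 : ℂ)) (1, z) := by fun_prop
  have kr : ∀ s : ℝ × ℂ → ℂ, ContinuousAt s (1, z) → ‖s (1, z)‖ = 1 →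
      ContinuousAt (fun v => gammaReg p q (s v)) (1, z) := fun s hs h1 =>
    ContinuousAt.comp (g := gammaReg p q)
      (gammaReg_continuousAt hp hq (norm_pos_iff.1 (by rw [h1]; exact one_pos)) h1.le) hs
  have kg : ∀ s t : ℝ × ℂ → ℂ, ContinuousAt s (1, z) → ContinuousAt t (1, z) →
      s (1, z) ≠ 0 → t (1, z) ≠ 0 → ‖s (1, z)‖ < 1 → ‖t (1, z)‖ ≤ 1 →
      ContinuousAt (fun v => ellGamma p q (s v * t v)) (1, z) := fun s t hs ht h1 h2 h3 h4 =>
    ContinuousAt.comp (g := ellGamma p q)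
      (ellGamma_differentiableAt hp hq (mul_ne_zero h1 h2) (norm_mul_lt_one h3 h4)).continuousAt
      (hs.mul ht)
  have kg' : ∀ s t : ℝ × ℂ → ℂ, ContinuousAt s (1, z) → ContinuousAt t (1, z) →
      s (1, z) ≠ 0 → t (1, z) ≠ 0 → ‖s (1, z)‖ ≤ 1 → ‖t (1, z)‖ < 1 →
      ContinuousAt (fun v => ellGamma p q (s v * t v)) (1, z) := fun s t hs ht h1 h2 h3 h4 => by
    simpa only [mul_comm] using kg t s ht hs h2 h1 h4 h3
  have kz : ∀ s : ℝ × ℂ → ℂ, ContinuousAt s (1, z) → s (1, z) ≠ 0 → ‖s (1, z)‖ < 1 →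
      ContinuousAt (fun v => ellGamma p q (s v * v.2) * ellGamma p q (s v * v.2⁻¹)) (1, z) :=
    fun s hs h1 h2 => (kg s _ hs cz h1 hz0 h2 hz.le).mul
      (kg s _ hs czi h1 (inv_ne_zero hz0) h2 (by simp [hz]))
  have kc : ∀ x : ℂ, ContinuousAt (fun _ : ℝ × ℂ => x) (1, z) := fun _ => continuousAt_const
  have cw : ContinuousAt (fun v : ℝ × ℂ => weight p q v.2) (1, z) :=
    ContinuousAt.comp (g := weight p q) (weight_differentiableAt hp hq hz0).continuousAt cz
  unfold limitNum limitDen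
  refine ContinuousAt.div ?_ ?_ ?_
  · refine ((((ContinuousAt.mul (ContinuousAt.mul (ContinuousAt.mul ?_ ?_)
      (ContinuousAt.mul ?_ ?_)) (kz _ c1 ?_ ?_)).mul (kz _ (kc d) d0 hd)).mul
      (kz _ (kc e) e0 he)).mul (kz _ (kc f) f0 hf)).mul cw
    · exact kr _ (c0.mul cz) (by simp [hz])
    · exact kr _ (c0.mul czi) (by simp [hz])
    · exact kr _ (c2.mul cz) (by simp [hz])
    · exact kr _ (c2.mul czi) (by simp [hz])
    · simpa using C0
    · simpa using hC
  · have l1 := kr _ (cρ.pow 2) (by simp)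
    have m0 := kg' _ _ c0 c1 (by simp) (by simpa using C0) (by simp) (by simpa using hC)
    have m1 := fun x hx hx' => kg' _ _ c0 (kc x) (by simp) hx (by simp) hx'
    have m2 := kg _ _ c1 c2 (by simpa using C0) (by simp) (by simpa using hC) (by simp)
    have m3 := fun x hx hx' => kg' _ _ c2 (kc x) (by simp) hx (by simp) hx'
    have m4 := fun x hx (hx' : ‖x‖ < 1) => kg _ _ c1 (kc x) (by simpa using C0) hx
      (by simpa using hC) hx'.le
    exact ((l1.mul (((m0.mul (m1 d d0 hd)).mul (m1 e e0 he)).mul (m1 f f0 hf))).mul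
      (((m2.mul (m3 d d0 hd)).mul (m3 e e0 he)).mul (m3 f f0 hf))).mul
      ((((m4 d d0 hd).mul (m4 e e0 he)).mul (m4 f f0 hf)).mul (kc _))
  · have hG : ∀ x y : ℂ, ‖x‖ = 1 → ‖y‖ < 1 → ‖p * q‖ < ‖y‖ → ellGamma p q (x * y) ≠ 0 :=
      fun x y hx h1 h2 => ellGamma_ne_zero hp hq (by simpa [hx] using h1) (by simpa [hx] using h2)
    have hH : ∀ x y w : ℂ, x * y * w = p * q → ‖x‖ < 1 → ‖y‖ < 1 → ‖w‖ < 1 →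
        ellGamma p q (x * y) ≠ 0 := fun x y w h h1 h2 h3 =>
      ellGamma_ne_zero hp hq (norm_mul_lt_one h1 h2.le) (norm_mul_lt_of_prod_eq h hpq0 h3)
    have hI : ‖-I‖ = 1 := by simp
    have hI' : ‖I‖ = 1 := by simp
    have hr2 : gammaReg p q 1 ≠ 0 := gammaReg_ne_zero hp hq (by simp) (by simpa using hpq)
    simp only [ofReal_one, mul_one, one_pow, div_one, mul_comm C I]
    refine mul_ne_zero (mul_ne_zero (mul_ne_zero hr2 ?_) ?_) ?_
    · exact mul_ne_zero (mul_ne_zero (mul_ne_zero (hG _ _ hI hC nC) (hG _ _ hI hd nd))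
        (hG _ _ hI he ne)) (hG _ _ hI hf nf)
    · exact mul_ne_zero (mul_ne_zero (mul_ne_zero (hG _ _ hI' hC nC) (hG _ _ hI' hd nd))
        (hG _ _ hI' he ne)) (hG _ _ hI' hf nf)
    · refine mul_ne_zero (mul_ne_zero (mul_ne_zero ?_ ?_) ?_)
        (mul_ne_zero (mul_ne_zero ?_ ?_) ?_)
      · exact hH C d (e * f) (by rw [← hprod]; ring) hC hd (norm_mul_lt_one he hf.le)
      · exact hH C e (d * f) (by rw [← hprod]; ring) hC he (norm_mul_lt_one hd hf.le)
      · exact hH C f (d * e) (by rw [← hprod]; ring) hC hf (norm_mul_lt_one hd he.le)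
      · exact hH d e (C * f) (by rw [← hprod]; ring) hd he (norm_mul_lt_one hC hf.le)
      · exact hH d f (C * e) (by rw [← hprod]; ring) hd hf (norm_mul_lt_one hC he.le)
      · exact hH e f (C * d) (by rw [← hprod]; ring) he hf (norm_mul_lt_one hC hd.le)

lemma balanced_limit {C d e f : ℂ} (hprod : C * d * e * f = p * q) (hd : ‖d‖ < 1)
    (he : ‖e‖ < 1) (hf : ‖f‖ < 1) {ρ : ℝ} (hρ0 : 0 < ρ) (hρ : ρ < 1) (hC : ‖C‖ < ρ ^ 2) :
    Balanced p q ![-(I * ρ), C / ρ ^ 2, I * ρ, d, e, f] := by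
  have hρc : (ρ : ℂ) ≠ 0 := Complex.ofReal_ne_zero.2 hρ0.ne'
  constructor
  · rw [← hprod, Fin.prod_univ_six]
    simp only [Matrix.cons_val]
    field_simp
    linear_combination -(C * d * e * f) * I_sq
  · simp only [Fin.forall_fin_succ, Matrix.cons_val_zero, Matrix.cons_val_succ,
      IsEmpty.forall_iff, and_true]
    have h1 : ‖I * (ρ : ℂ)‖ < 1 := by simpa [abs_of_pos hρ0] using hρ
    refine ⟨by rwa [norm_neg], ?_, h1, hd, he, hf⟩
    rw [norm_div, norm_pow, Complex.norm_real, Real.norm_of_nonneg hρ0.le,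
      div_lt_one (by positivity)]
    exact hC

/-- The value of the elliptic beta integral in the limit in which two parameters approach `± i`. -/
lemma tendsto_betaRatio (hp0 : p ≠ 0) (hq0 : q ≠ 0) (hp : ‖p‖ < 1) (hq : ‖q‖ < 1)
    {C d e f : ℂ} (hprod : C * d * e * f = p * q) (hC : ‖C‖ < 1) (hd : ‖d‖ < 1) (he : ‖e‖ < 1)
    (hf : ‖f‖ < 1) :
    Tendsto (fun ρ : ℝ => betaRatio p q ![-(I * ρ), C / ρ ^ 2, I * ρ, d, e, f]) (𝓝[<] 1)
      (𝓝 (Real.pi * I * (4 * (poch p p * poch q q)⁻¹))) := by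
  have hev : ∀ᶠ ρ : ℝ in 𝓝[<] 1,
      Balanced p q ![-(I * ρ), C / ρ ^ 2, I * ρ, d, e, f] := by
    have h1 : ∀ᶠ ρ in 𝓝[<] (1 : ℝ), ‖C‖ < ρ ^ 2 := by
      have : Tendsto (fun ρ : ℝ => ρ ^ 2) (𝓝 1) (𝓝 (1 ^ 2)) := (continuous_pow 2).tendsto 1
      refine (this.eventually_const_lt ?_).filter_mono nhdsWithin_le_nhds
      simpa using hC
    filter_upwards [Ioo_mem_nhdsLT (show (0 : ℝ) < 1 from one_pos), h1] with ρ hρ h1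
    exact balanced_limit hprod hd he hf hρ.1 hρ.2 h1
  have hk := betaKernel_div_betaProd hp hq C d e f
  refine (tendsto_circleIntegral_peak
    (h := fun ρ z => limitNum p q C d e f ρ z / limitDen p q C d e f ρ)
    (fun z hz => continuousAt_limit hp0 hq0 hp hq hprod hC hd he hf (by simpa using hz))
    (fun z hz => limitNum_div_limitDen_of_sq_eq hp0 hq0 hp hq hprod hC hd he hf hz) ?_).congr' ?_
  · filter_upwards [hev] with ρ hρ
    have h1 := (betaKernel_circleIntegrable hp hq (hρ.ne_zero hp0 hq0) hρ.norm_lt).const_smul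
      (a := (betaProd p q ![-(I * ρ), C / ρ ^ 2, I * ρ, d, e, f])⁻¹)
    refine (circleIntegrable_congr (fun z _ => ?_)).1 h1
    rw [← hk ρ z, Pi.smul_apply, smul_eq_mul]
    ring
  · refine Eventually.of_forall fun ρ => ?_
    unfold betaRatio betaIntegral
    beta_reduce
    rw [div_eq_inv_mul, ← circleIntegral.integral_const_mul]
    refine circleIntegral.integral_congr zero_le_one fun z _ => ?_
    rw [← hk ρ z]
    ring

lemma betaRatio_swap (a b c d e f : ℂ) :
    betaRatio p q ![a, b, c, d, e, f] = betaRatio p q ![c, b, a, d, e, f] := by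
  have h1 : betaIntegral p q ![a, b, c, d, e, f] = betaIntegral p q ![c, b, a, d, e, f] := by
    unfold betaIntegral betaKernel
    congr 1
    funext z
    simp only [Fin.prod_univ_six, Matrix.cons_val]
    ring
  have h2 : betaProd p q ![a, b, c, d, e, f] = betaProd p q ![c, b, a, d, e, f] := by
    unfold betaProd
    simp [Fin.prod_univ_six, -mul_eq_mul_right_iff, -mul_eq_mul_left_iff]
    rw [mul_comm c b, mul_comm c a, mul_comm b a]
    ring
  unfold betaRatio
  rw [h1, h2]

lemma balanced_swap {a b c d e f : ℂ} (h : Balanced p q ![a, b, c, d, e, f]) :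
    Balanced p q ![c, b, a, d, e, f] := by
  have h1 := h.prod_eq
  have h2 := h.norm_lt
  constructor
  · rw [← h1]
    simp only [Fin.prod_univ_six, Matrix.cons_val]
    ring
  · simp only [Fin.forall_fin_succ, Matrix.cons_val_zero, Matrix.cons_val_succ,
      IsEmpty.forall_iff, and_true] at h2 ⊢
    tauto

/-- Slide (a, b) to (iρ, ab/(iρ)), exchange the first parameter with c, then slide (c, ab/(iρ)) to
(−iρ, abc/ρ²). The ratio is unchanged for every ρ near 1, so it equals the limit. -/
lemma betaRatio_eq_of_norm_lt (hp0 : p ≠ 0) (hq0 : q ≠ 0) (hp : ‖p‖ < 1) (hq : ‖q‖ < 1)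
    {a b c d e f : ℂ} (h : Balanced p q ![a, b, c, d, e, f]) (hb : ‖b‖ < ‖q‖) :
    betaRatio p q ![a, b, c, d, e, f] = Real.pi * I * (4 * (poch p p * poch q q)⁻¹) := by
  have n := h.norm_lt
  simp only [Fin.forall_fin_succ, Matrix.cons_val_zero, Matrix.cons_val_succ,
    IsEmpty.forall_iff, and_true] at n
  obtain ⟨na, nb, nc, nd, ne, nf⟩ := n
  have hprod : a * b * c * d * e * f = p * q := by
    have := h.prod_eq
    simpa [Fin.prod_univ_six] using this
  have hq1 : 0 < ‖q‖ := norm_pos_iff.2 hq0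
  have hab : ‖a * b‖ < ‖q‖ := by
    rw [norm_mul]; nlinarith [norm_nonneg a, norm_nonneg b]
  have habc : ‖a * b * c‖ < ‖q‖ := by
    rw [norm_mul]; nlinarith [norm_nonneg (a * b), norm_nonneg c]
  have hlim := tendsto_betaRatio hp0 hq0 hp hq hprod (habc.trans hq) nd ne nf
  refine tendsto_nhds_unique (tendsto_const_nhds.congr' ?_) hlim
  -- This makes |abc|/ρ < |q|, the smallness condition of the second slide.
  have h1 : ∀ᶠ ρ in 𝓝[<] (1 : ℝ), ‖a * b * c‖ / ‖q‖ < ρ :=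
    (eventually_gt_nhds ((div_lt_one hq1).2 habc)).filter_mono nhdsWithin_le_nhds
  have h2 : ∀ᶠ ρ in 𝓝[<] (1 : ℝ), ‖a * b‖ < ρ :=
    (eventually_gt_nhds (hab.trans hq)).filter_mono nhdsWithin_le_nhds
  have h3 : ∀ᶠ ρ in 𝓝[<] (1 : ℝ), ‖q‖ < ρ :=
    (eventually_gt_nhds hq).filter_mono nhdsWithin_le_nhds
  filter_upwards [Ioo_mem_nhdsLT (show (0 : ℝ) < 1 from one_pos), h1, h2, h3] with ρ hρ h1 h2 h3
  obtain ⟨hρ0, hρ1⟩ := hρ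
  have hρc : (ρ : ℂ) ≠ 0 := Complex.ofReal_ne_zero.2 hρ0.ne'
  have hu : ‖I * (ρ : ℂ)‖ = ρ := by simp [abs_of_pos hρ0]
  have hu' : ‖-(I * (ρ : ℂ))‖ = ρ := by rw [norm_neg, hu]
  have s1 := betaRatio_slide hp0 hq0 hp hq h hab (u := I * ρ) (by rwa [hu]) (by rwa [hu])
  have B1 := balanced_swap (balanced_slide h (u := I * ρ) (by rwa [hu]) (by rwa [hu]))
  have hcb : ‖c * (a * b / (I * ρ))‖ < ‖q‖ := by
    rw [show c * (a * b / (I * ρ)) = a * b * c / (I * ρ) by ring, norm_div, hu, div_lt_iff₀ hρ0]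
    rw [div_lt_iff₀ hq1] at h1
    linarith
  have s2 := betaRatio_slide hp0 hq0 hp hq B1 hcb (u := -(I * ρ)) (by rw [hu']; exact hcb.trans h3)
    (by rwa [hu'])
  have e : a * b * c / (ρ : ℂ) ^ 2 = c * (a * b / (I * ρ)) / -(I * ρ) := by
    rw [mul_div_assoc', div_div, div_eq_div_iff (pow_ne_zero 2 hρc)
      (mul_ne_zero (mul_ne_zero I_ne_zero hρc) (neg_ne_zero.2 (mul_ne_zero I_ne_zero hρc)))]
    linear_combination -(a * b * c * (ρ : ℂ) ^ 2) * I_sq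
  rw [← s1, betaRatio_swap, ← s2, e]

/-- The elliptic beta integral in terms of the normalized ratio. -/
lemma betaRatio_eq (hp0 : p ≠ 0) (hq0 : q ≠ 0) (hp : ‖p‖ < 1) (hq : ‖q‖ < 1) {τ : Fin 6 → ℂ}
    (h : Balanced p q τ) :
    betaRatio p q τ = Real.pi * I * (4 * (poch p p * poch q q)⁻¹) := by
  have h0 := h.ne_zero hp0 hq0
  have hpos : ∀ j, 0 < ‖τ j‖ := fun j => norm_pos_iff.2 (h0 j)
  have hsmall : ∀ σ : Fin 6 → ℂ, Balanced p q σ → ‖σ 1‖ < ‖q‖ →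
      betaRatio p q σ = Real.pi * I * (4 * (poch p p * poch q q)⁻¹) := by
    intro σ hσ h1
    have : σ = ![σ 0, σ 1, σ 2, σ 3, σ 4, σ 5] := by
      ext j; fin_cases j <;> rfl
    rw [this] at hσ ⊢
    exact betaRatio_eq_of_norm_lt hp0 hq0 hp hq hσ h1
  set L : Fin 6 → ℝ := fun j => Real.log ‖τ j‖ with hL
  have hLneg : ∀ j, L j < 0 := fun j => Real.log_neg (hpos j) (h.norm_lt j)
  have hLsum : ∑ j, L j = Real.log ‖p * q‖ := by
    rw [← h.prod_eq, norm_prod, Real.log_prod fun j _ => (hpos j).ne']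
  -- The exponents sum to zero, so the deformation τⱼ exp(l mⱼ) preserves the balancing. At l = 1
  -- every parameter but τ₁ would reach modulus 1, and τ₁ would reach |pq| < |q|; hence for l = s
  -- slightly below 1 the case already settled applies.
  set m : Fin 6 → ℝ := fun j => if j = 1 then (∑ i, L i) - L 1 else -L j with hm
  have hmsum : ∑ j, m j = 0 := by
    simp only [hm, Fin.sum_univ_six, Fin.reduceEq, if_true, if_false]
    ring
  set T : ℂ → Fin 6 → ℂ := fun l j => τ j * Complex.exp (l * m j) with hT
  have hnorm : ∀ l j, ‖T l j‖ = Real.exp (L j + l.re * m j) := by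
    intro l j
    simp only [hT, norm_mul, Complex.norm_exp, hL]
    rw [Real.exp_add, Real.exp_log (hpos j)]
    simp
  set U : Set ℂ := {l | ∀ j, L j + l.re * m j < 0} with hU
  have hUeq : U = ⋂ j, {l : ℂ | L j + l.re * m j < 0} := by
    ext l; simp [hU]
  have hUo : IsOpen U := by
    rw [hUeq]
    exact isOpen_iInter_of_finite fun j => isOpen_lt (by fun_prop) continuous_const
  have hUc : Convex ℝ U := by
    intro x hx y hy s t hs ht hst j
    have h1 := hx j
    have h2 := hy j
    simp only [Complex.add_re, Complex.real_smul, Complex.re_ofReal_mul]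
    have e : L j + (s * x.re + t * y.re) * m j =
        s * (L j + x.re * m j) + t * (L j + y.re * m j) := by
      linear_combination -(L j) * hst
    rw [e]
    rcases hs.eq_or_lt with rfl | hs'
    · have : t = 1 := by linarith
      subst this; linarith
    · nlinarith
  have hB : ∀ l ∈ U, Balanced p q (T l) := by
    intro l hl
    constructor
    · simp only [hT, Finset.prod_mul_distrib, h.prod_eq, ← Complex.exp_sum, ← Finset.mul_sum]
      rw [← Complex.ofReal_sum, hmsum]
      simp
    · intro j
      rw [hnorm]
      exact Real.exp_lt_one_iff.2 (hl j)
  have hd : DifferentiableOn ℂ (fun l => betaRatio p q (T l)) U := by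
    refine differentiableOn_betaRatio hp0 hq0 hp hq hUo (fun j => ?_) hB
    simp only [hT]
    fun_prop
  have hq1 : 0 < ‖q‖ := norm_pos_iff.2 hq0
  have hp1 : 0 < ‖p‖ := norm_pos_iff.2 hp0
  have hsum_lt : (∑ j, L j) < Real.log ‖q‖ := by
    rw [hLsum, norm_mul]
    exact Real.log_lt_log (mul_pos hp1 hq1) (mul_lt_of_lt_one_left hq1 hp)
  have hm1 : m 1 = (∑ i, L i) - L 1 := by simp [hm]
  have hm1neg : m 1 < 0 := by
    rw [hm1, Fin.sum_univ_six]
    linarith [hLneg 0, hLneg 2, hLneg 3, hLneg 4, hLneg 5]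
  obtain ⟨s, hs0, hs1, hs⟩ : ∃ s : ℝ, 0 < s ∧ s < 1 ∧ L 1 + s * m 1 < Real.log ‖q‖ := by
    have hc : Tendsto (fun s : ℝ => L 1 + s * m 1) (𝓝[<] 1) (𝓝 (L 1 + 1 * m 1)) :=
      ((continuous_const.add (continuous_id.mul continuous_const)).tendsto 1).mono_left
        nhdsWithin_le_nhds
    have h1 := hc.eventually_lt_const (show L 1 + 1 * m 1 < Real.log ‖q‖ by
      rw [hm1]; linarith)
    obtain ⟨s, hs, hs'⟩ := (h1.and (Ioo_mem_nhdsLT (show (0 : ℝ) < 1 from one_pos))).exists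
    exact ⟨s, hs'.1, hs'.2, hs⟩
  have hsU : (s : ℂ) ∈ U := by
    intro j
    rw [Complex.ofReal_re]
    by_cases hj : j = 1
    · subst hj
      have := hLneg 1
      nlinarith
    · simp only [hm, hj, if_false]
      nlinarith [hLneg j]
  have hev : (fun l => betaRatio p q (T l)) =ᶠ[𝓝 (s : ℂ)]
      fun _ => Real.pi * I * (4 * (poch p p * poch q q)⁻¹) := by
    have h1 : ∀ᶠ l : ℂ in 𝓝 (s : ℂ), L 1 + l.re * m 1 < Real.log ‖q‖ :=
      ContinuousAt.eventually_lt (by fun_prop) continuousAt_const (by simpa using hs)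
    filter_upwards [hUo.mem_nhds hsU, h1] with l hl hl1
    refine hsmall _ (hB l hl) ?_
    rw [hnorm]
    exact (Real.lt_log_iff_exp_lt hq1).1 hl1
  have h0U : (0 : ℂ) ∈ U := fun j => by simpa using hLneg j
  -- The identity theorem on the convex set U carries the constant value from a neighbourhood of s
  -- to l = 0, the original parameters.
  have := (hd.analyticOnNhd hUo).eqOn_of_preconnected_of_eventuallyEq analyticOnNhd_const
    hUc.isPreconnected hsU hev h0U
  simpa [hT] using this

/-- The elliptic beta integral evaluation. -/
theorem betaIntegral_eq (hp0 : p ≠ 0) (hq0 : q ≠ 0) (hp : ‖p‖ < 1) (hq : ‖q‖ < 1)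
    {τ : Fin 6 → ℂ} (h : Balanced p q τ) :
    poch p p * poch q q / (4 * Real.pi * I) * betaIntegral p q τ = betaProd p q τ := by
  have h1 := betaRatio_eq hp0 hq0 hp hq h
  have h2 := poch_ne_zero_of_norm_lt_one hp hp
  have h3 := poch_ne_zero_of_norm_lt_one hq hq
  have h4 := h.betaProd_ne_zero hp0 hq0 hp hq
  have h5 : (Real.pi : ℂ) ≠ 0 := Complex.ofReal_ne_zero.2 Real.pi_ne_zero
  unfold betaRatio at h1
  rw [div_eq_iff h4] at h1
  rw [h1]
  field_simp

end BetaIntegral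

/-! ### The elliptic Fourier transform and the kernel identity behind the Bailey lemma. -/

section BaileyLemma

variable {p q : ℂ}

/-- The kernel of the elliptic Fourier transformation with respect to `dz / z`. -/
noncomputable def eftKernel (p q t w z : ℂ) : ℂ :=
  ellGammaPM p q t w z * (ellGamma p q (t ^ 2))⁻¹ * weight p q z

lemma eftIntegrand_eq (hp : ‖p‖ < 1) (hq : ‖q‖ < 1) (t : ℂ) (α : ℂ → ℂ) (w : ℂ) {z : ℂ}
    (hz : ‖z‖ = 1) : eftIntegrand p q t α w z = eftKernel p q t w z * α z / z := by
  unfold eftIntegrand eftKernel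
  rw [← inv_ellGamma_sq hp hq hz, div_eq_mul_inv (ellGammaPM p q t w z), mul_inv,
    ← mul_assoc (ellGammaPM p q t w z)]

lemma eft_eq (hp : ‖p‖ < 1) (hq : ‖q‖ < 1) (t : ℂ) (α : ℂ → ℂ) (w : ℂ) :
    eft p q t α w = poch p p * poch q q / (4 * Real.pi * I) * (I * ∫ θ in (0 : ℝ)..2 * Real.pi,
      eftKernel p q t w (circleMap 0 1 θ) * α (circleMap 0 1 θ)) := by
  unfold eft
  rw [← circleIntegral_div_eq (fun z => eftKernel p q t w z * α z) one_ne_zero]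
  congr 1
  refine circleIntegral.integral_congr zero_le_one fun z hz => ?_
  exact eftIntegrand_eq hp hq t α w (by simpa using hz)

lemma ellGammaPM_continuousOn (hp : ‖p‖ < 1) (hq : ‖q‖ < 1) {X : Type*} [TopologicalSpace X]
    {S : Set X} {a : ℂ} {w z : X → ℂ} (hw : ContinuousOn w S) (hz : ContinuousOn z S)
    (ha : a ≠ 0) (hw0 : ∀ x ∈ S, w x ≠ 0) (h1 : ∀ x ∈ S, ‖a * w x‖ < 1)
    (h2 : ∀ x ∈ S, ‖a * (w x)⁻¹‖ < 1) (hz1 : ∀ x ∈ S, ‖z x‖ = 1) :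
    ContinuousOn (fun x => ellGammaPM p q a (w x) (z x)) S := by
  have hz0 : ∀ x ∈ S, z x ≠ 0 := fun x hx => norm_pos_iff.1 (by rw [hz1 x hx]; exact one_pos)
  have hz1' : ∀ x ∈ S, ‖(z x)⁻¹‖ = 1 := fun x hx => by rw [norm_inv, hz1 x hx, inv_one]
  have e1 : ContinuousOn (fun x => a * w x) S := continuousOn_const.mul hw
  have e2 : ContinuousOn (fun x => a * (w x)⁻¹) S := continuousOn_const.mul (hw.inv₀ hw0)
  have n1 : ∀ x ∈ S, a * w x ≠ 0 := fun x hx => mul_ne_zero ha (hw0 x hx)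
  have n2 : ∀ x ∈ S, a * (w x)⁻¹ ≠ 0 := fun x hx => mul_ne_zero ha (inv_ne_zero (hw0 x hx))
  unfold ellGammaPM
  refine ((ContinuousOn.mul ?_ ?_).mul ?_).mul ?_
  · exact continuousOn_ellGamma_comp hp hq (e1.mul hz)
      (fun x hx => mul_ne_zero (n1 x hx) (hz0 x hx))
      (fun x hx => norm_mul_lt_one (h1 x hx) (hz1 x hx).le)
  · exact continuousOn_ellGamma_comp hp hq (e1.mul (hz.inv₀ hz0))
      (fun x hx => mul_ne_zero (n1 x hx) (inv_ne_zero (hz0 x hx)))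
      (fun x hx => norm_mul_lt_one (h1 x hx) (hz1' x hx).le)
  · exact continuousOn_ellGamma_comp hp hq (e2.mul hz)
      (fun x hx => mul_ne_zero (n2 x hx) (hz0 x hx))
      (fun x hx => norm_mul_lt_one (h2 x hx) (hz1 x hx).le)
  · exact continuousOn_ellGamma_comp hp hq (e2.mul (hz.inv₀ hz0))
      (fun x hx => mul_ne_zero (n2 x hx) (inv_ne_zero (hz0 x hx)))
      (fun x hx => norm_mul_lt_one (h2 x hx) (hz1' x hx).le)

lemma ellGammaPM_differentiableAt (hp : ‖p‖ < 1) (hq : ‖q‖ < 1) {a y z : ℂ} (ha : a ≠ 0)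
    (hy : y ≠ 0) (hz : z ≠ 0) (h1 : ‖a * y * z‖ < 1) (h2 : ‖a * y * z⁻¹‖ < 1)
    (h3 : ‖a * y⁻¹ * z‖ < 1) (h4 : ‖a * y⁻¹ * z⁻¹‖ < 1) :
    DifferentiableAt ℂ (ellGammaPM p q a y) z := by
  have hi : DifferentiableAt ℂ (fun z : ℂ => z⁻¹) z := differentiableAt_inv hz
  have n1 := mul_ne_zero ha hy
  have n2 := mul_ne_zero ha (inv_ne_zero hy)
  have hz' := inv_ne_zero hz
  unfold ellGammaPM
  refine ((DifferentiableAt.mul ?_ ?_).mul ?_).mul ?_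
  · exact differentiableAt_ellGamma_comp hp hq (by fun_prop) (mul_ne_zero n1 hz) h1
  · exact differentiableAt_ellGamma_comp hp hq (hi.const_mul _) (mul_ne_zero n1 hz') h2
  · exact differentiableAt_ellGamma_comp hp hq (by fun_prop) (mul_ne_zero n2 hz) h3
  · exact differentiableAt_ellGamma_comp hp hq (hi.const_mul _) (mul_ne_zero n2 hz') h4

lemma ellGammaPM_analyticOnNhd (hp : ‖p‖ < 1) (hq : ‖q‖ < 1) {a y : ℂ} (ha : a ≠ 0)
    (hy : y ≠ 0) (h1 : ‖a * y‖ < 1) (h2 : ‖a * y⁻¹‖ < 1) :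
    AnalyticOnNhd ℂ (ellGammaPM p q a y) (Metric.sphere 0 1) := by
  intro z hz
  have hz1 : ‖z‖ = 1 := by simpa using hz
  have hz0 : z ≠ 0 := norm_pos_iff.1 (by rw [hz1]; exact one_pos)
  have hz1' : ‖z⁻¹‖ ≤ 1 := by rw [norm_inv, hz1, inv_one]
  rw [analyticAt_iff_eventually_differentiableAt]
  have hc : ContinuousAt (fun z : ℂ => z) z := continuousAt_id
  have hi : ContinuousAt (fun z : ℂ => z⁻¹) z := continuousAt_inv₀ hz0
  have c1 := (hc.const_mul (a * y)).norm.eventually_lt_const (norm_mul_lt_one h1 hz1.le)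
  have c2 := (hi.const_mul (a * y)).norm.eventually_lt_const (norm_mul_lt_one h1 hz1')
  have c3 := (hc.const_mul (a * y⁻¹)).norm.eventually_lt_const (norm_mul_lt_one h2 hz1.le)
  have c4 := (hi.const_mul (a * y⁻¹)).norm.eventually_lt_const (norm_mul_lt_one h2 hz1')
  filter_upwards [c1, c2, c3, c4, isOpen_ne.mem_nhds hz0] with x h1 h2 h3 h4 hx
  exact ellGammaPM_differentiableAt hp hq ha hy hx h1 h2 h3 h4

lemma eftKernel_continuousOn (hp : ‖p‖ < 1) (hq : ‖q‖ < 1) {X : Type*} [TopologicalSpace X]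
    {S : Set X} {t : ℂ} {w z : X → ℂ} (hw : ContinuousOn w S) (hz : ContinuousOn z S)
    (ht0 : t ≠ 0) (ht : ‖t‖ < 1) (hw1 : ∀ x ∈ S, ‖w x‖ = 1) (hz1 : ∀ x ∈ S, ‖z x‖ = 1) :
    ContinuousOn (fun x => eftKernel p q t (w x) (z x)) S := by
  have hw0 : ∀ x ∈ S, w x ≠ 0 := fun x hx => norm_pos_iff.1 (by rw [hw1 x hx]; exact one_pos)
  have hz0 : ∀ x ∈ S, z x ≠ 0 := fun x hx => norm_pos_iff.1 (by rw [hz1 x hx]; exact one_pos)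
  refine ((ellGammaPM_continuousOn hp hq hw hz ht0 hw0
    (fun x hx => norm_mul_lt_one ht (hw1 x hx).le)
    (fun x hx => norm_mul_lt_one ht (by rw [norm_inv, hw1 x hx, inv_one])) hz1).mul
    continuousOn_const).mul fun x hx => ?_
  exact ContinuousAt.comp_continuousWithinAt (g := weight p q)
    (weight_differentiableAt hp hq (hz0 x hx)).continuousAt (hz x hx)

lemma eftConverges_of_continuousOn (hp : ‖p‖ < 1) (hq : ‖q‖ < 1) {t : ℂ} {α : ℂ → ℂ}
    (hα : ContinuousOn α (Metric.sphere 0 1)) (ht0 : t ≠ 0) (ht : ‖t‖ < 1) {w : ℂ}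
    (hw : ‖w‖ = 1) : EftConverges p q t α w := by
  have hz : ∀ z ∈ Metric.sphere (0 : ℂ) 1, ‖z‖ = 1 := fun z hz => by simpa using hz
  refine ContinuousOn.circleIntegrable zero_le_one ?_
  refine ContinuousOn.congr (f := fun z => eftKernel p q t w z * α z / z) ?_
    fun z h => eftIntegrand_eq hp hq t α w (hz z h)
  exact ((eftKernel_continuousOn hp hq continuousOn_const continuousOn_id ht0 ht
    (fun _ _ => hw) hz).mul hα).div continuousOn_id
    fun z h => norm_pos_iff.1 (by rw [hz z h]; exact one_pos)

/-- The elliptic Fourier transform of a continuous function is continuous. -/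
lemma eft_continuousOn (hp : ‖p‖ < 1) (hq : ‖q‖ < 1) {t : ℂ} {α : ℂ → ℂ}
    (hα : ContinuousOn α (Metric.sphere 0 1)) (ht0 : t ≠ 0) (ht : ‖t‖ < 1) :
    ContinuousOn (eft p q t α) (Metric.sphere 0 1) := by
  have hz : ∀ z ∈ Metric.sphere (0 : ℂ) 1, ‖z‖ = 1 := fun z hz => by simpa using hz
  rw [continuousOn_iff_continuous_domRestrict]
  have e : (Metric.sphere (0 : ℂ) 1).domRestrict (eft p q t α) =
      fun w : Metric.sphere (0 : ℂ) 1 =>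
      poch p p * poch q q / (4 * Real.pi * I) * (I * ∫ θ in (0 : ℝ)..2 * Real.pi,
        eftKernel p q t w.1 (circleMap 0 1 θ) * α (circleMap 0 1 θ)) :=
    funext fun w => eft_eq hp hq t α w.1
  rw [e]
  refine continuous_const.mul (continuous_const.mul ?_)
  refine intervalIntegral.continuous_parametric_intervalIntegral_of_continuous' ?_ _ _
  refine Continuous.mul ?_ ?_
  · rw [← continuousOn_univ]
    exact eftKernel_continuousOn hp hq (continuous_subtype_val.comp continuous_fst).continuousOn
      ((continuous_circleMap 0 1).comp continuous_snd).continuousOn ht0 ht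
      (fun x _ => hz _ x.1.2) (fun x _ => by simp)
  · exact hα.comp_continuous ((continuous_circleMap 0 1).comp continuous_snd) fun x => by simp

/-- The elliptic beta integral behind the Bailey lemma. -/
lemma baileyD_mul_integral (hp0 : p ≠ 0) (hq0 : q ≠ 0) (hp : ‖p‖ < 1) (hq : ‖q‖ < 1)
    {r s t y : ℂ} (hr : r ^ 2 = p * q) (hy0 : y ≠ 0) (hs : ‖s‖ < 1) (ht : ‖t‖ < 1)
    (hy : ‖r * y‖ < ‖s * t‖) (hy' : ‖r * y⁻¹‖ < ‖s * t‖) {w z : ℂ} (hw : ‖w‖ = 1)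
    (hz : ‖z‖ = 1) :
    baileyD p q r t⁻¹ y w * (poch p p * poch q q / (4 * Real.pi * I) *
      (I * ∫ θ in (0 : ℝ)..2 * Real.pi, eftKernel p q s w (circleMap 0 1 θ) *
        baileyD p q r (s * t) y (circleMap 0 1 θ) * eftKernel p q t (circleMap 0 1 θ) z)) =
      eftKernel p q (s * t) w z * baileyD p q r s y z := by
  have hpq0 : p * q ≠ 0 := mul_ne_zero hp0 hq0
  have hst0 : s * t ≠ 0 := norm_pos_iff.1 ((norm_nonneg _).trans_lt hy)
  obtain ⟨hs0, ht0⟩ := mul_ne_zero_iff.1 hst0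
  have hr0 : r ≠ 0 := by rintro rfl; apply hpq0; rw [← hr]; ring
  have hw0 : w ≠ 0 := norm_pos_iff.1 (by rw [hw]; exact one_pos)
  have hz0 : z ≠ 0 := norm_pos_iff.1 (by rw [hz]; exact one_pos)
  have hw' : ‖w⁻¹‖ = 1 := by rw [norm_inv, hw, inv_one]
  have hz' : ‖z⁻¹‖ = 1 := by rw [norm_inv, hz, inv_one]
  have hstp : 0 < ‖s * t‖ := norm_pos_iff.2 hst0
  set c := r * (s * t)⁻¹ with hc
  have hcy : ‖c * y‖ < 1 := by
    rw [show c * y = r * y / (s * t) by rw [hc]; field_simp, norm_div, div_lt_one hstp]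
    exact hy
  have hcy' : ‖c * y⁻¹‖ < 1 := by
    rw [show c * y⁻¹ = r * y⁻¹ / (s * t) by rw [hc]; field_simp, norm_div, div_lt_one hstp]
    exact hy'
  -- Balancing holds because s²c²t² = r² = pq; |c y^{±1}| < 1 is exactly the hypothesis |r y^{±1}| <
  -- |st|.
  set τ : Fin 6 → ℂ := ![s * w, s * w⁻¹, c * y, c * y⁻¹, t * z, t * z⁻¹] with hτ
  have hB : Balanced p q τ := by
    constructor
    · simp only [hτ, hc, Fin.prod_univ_six, Matrix.cons_val]
      rw [← hr]
      field_simp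
    · simp only [hτ, Fin.forall_fin_succ, Matrix.cons_val_zero, Matrix.cons_val_succ,
        IsEmpty.forall_iff, and_true]
      exact ⟨norm_mul_lt_one hs hw.le, norm_mul_lt_one hs hw'.le, hcy, hcy',
        norm_mul_lt_one ht hz.le, norm_mul_lt_one ht hz'.le⟩
  have hG : ∀ a b : ℂ, ‖a‖ < 1 → ‖b‖ < 1 → a * b = p * q → ellGamma p q a * ellGamma p q b = 1 := by
    intro a b ha hb hab
    rw [ellGamma_mul_reflect hp0 hq0 (left_ne_zero_of_mul (hab ▸ hpq0)) hab]
    exact mul_inv_cancel₀ (ellGamma_ne_zero hp hq ha (norm_mul_lt_of_prod_eq hab hpq0 hb))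
  have hint : ∀ x : ℂ, x ≠ 0 →
      eftKernel p q s w x * baileyD p q r (s * t) y x * eftKernel p q t x z =
      betaKernel p q τ x * ((ellGamma p q (s ^ 2))⁻¹ * (ellGamma p q (t ^ 2))⁻¹ *
        weight p q z) := by
    intro x hx
    simp only [eftKernel, baileyD, betaKernel, ellGammaPM, Fin.prod_univ_six, hτ,
      Matrix.cons_val, ← hc]
    rw [mul_right_comm t z x, mul_right_comm t z x⁻¹, mul_right_comm t z⁻¹ x,
      mul_right_comm t z⁻¹ x⁻¹]
    ring
  have hI : (I * ∫ θ in (0 : ℝ)..2 * Real.pi, eftKernel p q s w (circleMap 0 1 θ) *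
        baileyD p q r (s * t) y (circleMap 0 1 θ) * eftKernel p q t (circleMap 0 1 θ) z) =
      betaIntegral p q τ * ((ellGamma p q (s ^ 2))⁻¹ * (ellGamma p q (t ^ 2))⁻¹ *
        weight p q z) := by
    rw [betaIntegral, circleIntegral_div_eq _ one_ne_zero, mul_assoc I,
      ← intervalIntegral.integral_mul_const]
    congr 1
    refine intervalIntegral.integral_congr fun θ _ => hint _ (circleMap_ne_center one_ne_zero)
  rw [hI, ← mul_assoc (_ / _), betaIntegral_eq hp0 hq0 hp hq hB]
  -- Of the fifteen pairs, three are of the form au · au⁻¹ and give the squares; the other twelve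
  -- form the three fourfold products.
  have hprod : betaProd p q τ = ellGamma p q (s ^ 2) * ellGamma p q (t ^ 2) * ellGamma p q (c ^ 2) *
      ellGammaPM p q (s * t) w z * ellGammaPM p q (r * t⁻¹) w y *
      ellGammaPM p q (r * s⁻¹) y z := by
    have e1 : ∀ a u : ℂ, u ≠ 0 → a * u * (a * u⁻¹) = a ^ 2 := fun a u hu => by field_simp
    have e2 : ∀ u v : ℂ, s * u * (t * v) = s * t * u * v := fun u v => by ring
    have e3 : ∀ u v : ℂ, s * u * (c * v) = r * t⁻¹ * u * v := fun u v => by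
      rw [hc]; field_simp
    have e4 : ∀ u v : ℂ, c * u * (t * v) = r * s⁻¹ * u * v := fun u v => by
      rw [hc]; field_simp
    simp only [betaProd, Fin.prod_univ_six, Fin.reduceLT, if_true, if_false, lt_irrefl, hτ,
      Matrix.cons_val, e1 _ _ hw0, e1 _ _ hy0, e1 _ _ hz0, e2, e3, e4, one_mul, mul_one,
      ellGammaPM]
    ring
  have hs1 := norm_mul_lt_one hs hs.le
  have ht1 := norm_mul_lt_one ht ht.le
  have hst := norm_mul_lt_one hs ht.le
  have hcc : c * y * (c * y⁻¹) = c ^ 2 := by field_simp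
  have hc1 : ‖c ^ 2‖ < 1 := by rw [← hcc]; exact norm_mul_lt_one hcy hcy'.le
  have hcst : (s * t) ^ 2 * c ^ 2 = p * q := by rw [← hr, hc]; field_simp
  have hs2 : ellGamma p q (s ^ 2) ≠ 0 := ellGamma_ne_zero hp hq (by rwa [pow_two])
    (norm_mul_lt_of_prod_eq (b := t ^ 2 * c ^ 2) (by rw [← hcst]; ring) hpq0
      (norm_mul_lt_one (by rwa [pow_two]) hc1.le))
  have ht2 : ellGamma p q (t ^ 2) ≠ 0 := ellGamma_ne_zero hp hq (by rwa [pow_two])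
    (norm_mul_lt_of_prod_eq (b := s ^ 2 * c ^ 2) (by rw [← hcst]; ring) hpq0
      (norm_mul_lt_one (by rwa [pow_two]) hc1.le))
  -- Reflection with (st)²c² = pq supplies the normalization 1/Γ((st)²) of the kernel of M(st).
  have hc2 : ellGamma p q (c ^ 2) = (ellGamma p q ((s * t) ^ 2))⁻¹ :=
    ellGamma_mul_reflect hp0 hq0 (pow_ne_zero 2 hst0) hcst
  -- D(t⁻¹; y, w) = Γ(r t y^{±1}w^{±1}), and each argument times the one with t and all signs
  -- inverted equals r² = pq, so reflection applies four times.
  have hD : baileyD p q r t⁻¹ y w * ellGammaPM p q (r * t⁻¹) w y = 1 := by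
    have hv : ∀ v, ‖c * v‖ < 1 → ∀ u, ‖u‖ = 1 →
        ‖r * t⁻¹ * u * v‖ < 1 ∧ ‖r * t * v * u‖ < 1 := by
      intro v hv u hu
      constructor
      · rw [show r * t⁻¹ * u * v = c * v * s * u by rw [hc]; field_simp]
        exact norm_mul_lt_one (norm_mul_lt_one hv hs.le) hu.le
      · rw [show r * t * v * u = c * v * s * (t * t) * u by rw [hc]; field_simp]
        exact norm_mul_lt_one (norm_mul_lt_one (norm_mul_lt_one hv hs.le) ht1.le) hu.le
    have g1 := hG _ _ (hv y hcy w hw).2 (hv y⁻¹ hcy' w⁻¹ hw').1 (by rw [← hr]; field_simp)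
    have g2 := hG _ _ (hv y hcy w⁻¹ hw').2 (hv y⁻¹ hcy' w hw).1 (by rw [← hr]; field_simp)
    have g3 := hG _ _ (hv y⁻¹ hcy' w hw).2 (hv y hcy w⁻¹ hw').1 (by rw [← hr]; field_simp)
    have g4 := hG _ _ (hv y⁻¹ hcy' w⁻¹ hw').2 (hv y hcy w hw).1 (by rw [← hr]; field_simp)
    unfold baileyD ellGammaPM
    rw [inv_inv]
    calc _ = (ellGamma p q (r * t * y * w) * ellGamma p q (r * t⁻¹ * w⁻¹ * y⁻¹)) *
          (ellGamma p q (r * t * y * w⁻¹) * ellGamma p q (r * t⁻¹ * w * y⁻¹)) *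
          (ellGamma p q (r * t * y⁻¹ * w) * ellGamma p q (r * t⁻¹ * w⁻¹ * y)) *
          (ellGamma p q (r * t * y⁻¹ * w⁻¹) * ellGamma p q (r * t⁻¹ * w * y)) := by ring
      _ = 1 := by rw [g1, g2, g3, g4]; ring
  rw [hprod, hc2, eftKernel, show baileyD p q r s y z = ellGammaPM p q (r * s⁻¹) y z from rfl]
  calc _ = (ellGamma p q (s ^ 2) * (ellGamma p q (s ^ 2))⁻¹) *
        (ellGamma p q (t ^ 2) * (ellGamma p q (t ^ 2))⁻¹) *
        (baileyD p q r t⁻¹ y w * ellGammaPM p q (r * t⁻¹) w y) *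
        (ellGammaPM p q (s * t) w z * (ellGamma p q ((s * t) ^ 2))⁻¹ * weight p q z *
          ellGammaPM p q (r * s⁻¹) y z) := by ring
    _ = _ := by rw [mul_inv_cancel₀ hs2, mul_inv_cancel₀ ht2, hD]; ring

end BaileyLemma

end EllBailey

/-! ### The Bailey lemma by Fubini. -/

open EllBailey in
theorem mainTheorem6 (p q r s t y : ℂ)
    (hp0 : p ≠ 0) (hp : ‖p‖ < 1) (hq0 : q ≠ 0) (hq : ‖q‖ < 1)
    (hr : r ^ 2 = p * q) (hy0 : y ≠ 0)
    (hs : ‖s‖ < 1) (ht : ‖t‖ < 1)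
    (hy : ‖r * y‖ < ‖s * t‖) (hy' : ‖r * y⁻¹‖ < ‖s * t‖)
    (α β : ℂ → ℂ) (hαβ : IsBaileyPair p q t α β) :
    (∀ w ∈ Metric.sphere (0 : ℂ) 1,
      EftConverges p q s (fun x => baileyD p q r (s * t) y x * β x) w) ∧
    IsBaileyPair p q (s * t)
      (fun w => baileyD p q r s y w * α w)
      (fun w => baileyD p q r t⁻¹ y w *
        eft p q s (fun x => baileyD p q r (s * t) y x * β x) w) := by
  have hpq0 : p * q ≠ 0 := mul_ne_zero hp0 hq0
  have hst0 : s * t ≠ 0 := norm_pos_iff.1 ((norm_nonneg _).trans_lt hy)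
  obtain ⟨hs0, ht0⟩ := mul_ne_zero_iff.1 hst0
  have hr0 : r ≠ 0 := by rintro rfl; apply hpq0; rw [← hr]; ring
  have hst : ‖s * t‖ < 1 := norm_mul_lt_one hs ht.le
  have hstp : 0 < ‖s * t‖ := norm_pos_iff.2 hst0
  have hsphere : ∀ z ∈ Metric.sphere (0 : ℂ) 1, ‖z‖ = 1 := fun z hz => by simpa using hz
  have hbound : ∀ v : ℂ, ‖r * v‖ < ‖s * t‖ → ‖r * (s * t)⁻¹ * v‖ < 1 := by
    intro v hv
    rw [show r * (s * t)⁻¹ * v = r * v / (s * t) by field_simp, norm_div, div_lt_one hstp]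
    exact hv
  have hbound' : ∀ v : ℂ, ‖r * v‖ < ‖s * t‖ → ‖r * s⁻¹ * v‖ < 1 := by
    intro v hv
    rw [show r * s⁻¹ * v = r * (s * t)⁻¹ * v * t by field_simp]
    exact norm_mul_lt_one (hbound v hv) ht.le
  have hα := hαβ.analytic.continuousOn
  -- No regularity of β is assumed; its continuity on the circle comes from being a transform of α.
  have hβ : ContinuousOn β (Metric.sphere 0 1) :=
    (eft_continuousOn hp hq hα ht0 ht).congr hαβ.eq_eft
  have hD : ContinuousOn (baileyD p q r (s * t) y) (Metric.sphere 0 1) :=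
    (ellGammaPM_analyticOnNhd hp hq (mul_ne_zero hr0 (inv_ne_zero hst0)) hy0 (hbound y hy)
      (hbound _ hy')).continuousOn
  have hD' : AnalyticOnNhd ℂ (baileyD p q r s y) (Metric.sphere 0 1) :=
    ellGammaPM_analyticOnNhd hp hq (mul_ne_zero hr0 (inv_ne_zero hs0)) hy0 (hbound' y hy)
      (hbound' _ hy')
  have hA := hD'.mul hαβ.analytic
  refine ⟨fun w hw => eftConverges_of_continuousOn hp hq (hD.mul hβ) hs0 hs (hsphere w hw),
    hA, fun w hw => eftConverges_of_continuousOn hp hq hA.continuousOn hst0 hst (hsphere w hw),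
    fun w hw => ?_⟩
  have hw1 := hsphere w hw
  have hcirc : ∀ θ : ℝ, circleMap (0 : ℂ) 1 θ ∈ Metric.sphere (0 : ℂ) 1 := fun θ => by simp
  have hc1 : ∀ θ : ℝ, ‖circleMap (0 : ℂ) 1 θ‖ = 1 := fun θ => by simp
  set κ := poch p p * poch q q / (4 * Real.pi * Complex.I) with hκ
  -- F is the joint integrand in the angles φ of x and θ of z. Integrating θ first gives β′ up to
  -- constants; integrating φ first gives M(st)α′ by `baileyD_mul_integral`.
  set F : ℝ → ℝ → ℂ := fun φ θ => eftKernel p q s w (circleMap 0 1 φ) *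
    baileyD p q r (s * t) y (circleMap 0 1 φ) *
    eftKernel p q t (circleMap 0 1 φ) (circleMap 0 1 θ) * α (circleMap 0 1 θ) with hF
  have hFc : Continuous (Function.uncurry F) := by
    have c1 : Continuous fun x : ℝ × ℝ => circleMap (0 : ℂ) 1 x.1 :=
      (continuous_circleMap 0 1).comp continuous_fst
    have c2 : Continuous fun x : ℝ × ℝ => circleMap (0 : ℂ) 1 x.2 :=
      (continuous_circleMap 0 1).comp continuous_snd
    refine Continuous.mul (Continuous.mul (Continuous.mul ?_ ?_) ?_) ?_
    · rw [← continuousOn_univ]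
      exact eftKernel_continuousOn hp hq continuousOn_const c1.continuousOn hs0 hs
        (fun _ _ => hw1) (fun x _ => hc1 _)
    · exact hD.comp_continuous c1 fun x => hcirc _
    · rw [← continuousOn_univ]
      exact eftKernel_continuousOn hp hq c1.continuousOn c2.continuousOn ht0 ht
        (fun x _ => hc1 _) (fun x _ => hc1 _)
    · exact hα.comp_continuous c2 fun x => hcirc _
  have hL : ∀ φ : ℝ, eftKernel p q s w (circleMap 0 1 φ) *
      (baileyD p q r (s * t) y (circleMap 0 1 φ) * β (circleMap 0 1 φ)) =
      κ * Complex.I * ∫ θ in (0 : ℝ)..2 * Real.pi, F φ θ := by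
    intro φ
    rw [hαβ.eq_eft _ (hcirc φ), eft_eq hp hq, ← hκ]
    simp only [hF, mul_assoc, intervalIntegral.integral_const_mul]
    ring
  have hR : ∀ θ : ℝ, eftKernel p q (s * t) w (circleMap 0 1 θ) *
      (baileyD p q r s y (circleMap 0 1 θ) * α (circleMap 0 1 θ)) =
      baileyD p q r t⁻¹ y w * κ * Complex.I * ∫ φ in (0 : ℝ)..2 * Real.pi, F φ θ := by
    intro θ
    rw [← mul_assoc, ← baileyD_mul_integral hp0 hq0 hp hq hr hy0 hs ht hy hy' hw1 (hc1 θ), ← hκ]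
    simp only [hF, intervalIntegral.integral_mul_const]
    ring
  have hswap : ∫ φ in (0 : ℝ)..2 * Real.pi, ∫ θ in (0 : ℝ)..2 * Real.pi, F φ θ =
      ∫ θ in (0 : ℝ)..2 * Real.pi, ∫ φ in (0 : ℝ)..2 * Real.pi, F φ θ := by
    refine MeasureTheory.intervalIntegral_intervalIntegral_swap ?_
    exact (hFc.continuousOn.integrableOn_compact (isCompact_uIcc.prod isCompact_uIcc)).mono_set
      (Set.prod_mono Set.uIoc_subset_uIcc Set.uIoc_subset_uIcc)
  simp only [eft_eq hp hq, ← hκ, hL, hR, intervalIntegral.integral_const_mul, hswap]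
  ring
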